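/- Let $K$ be an algebraically closed field of characteristic $p>2$ and let $\mathfrak g=\mathfrak g_{\bar 0}\oplus\mathfrak g_{\bar 1}$ be one of the Lie superalgebras $\mathfrak{gl}(m|n)$, $\mathfrak{sl}(m|n)$, $\mathfrak{osp}(2|2n)$ over $K$, with its $\mathbb Z$-grading $\mathfrak g=\mathfrak g_{-1}\oplus\mathfrak g_{\bar 0}\oplus\mathfrak g_1$, $\mathfrak g_{\bar 1}=\mathfrak g_{-1}\oplus\mathfrak g_1$, where $\mathfrak g_{1}$ is spanned by the root vectors of the positive odd roots for the distinguished Borel subalgebra; put $\mathfrak g_+=\mathfrak g_{\bar 0}\oplus\mathfrak g_1$. Let $\chi\in\mathfrak g_{\bar 0}^*$ be arbitrary. For a subalgebra $\mathfrak s\in\{\mathfrak g,\mathfrak g_+,\mathfrak g_{\bar 0}\}$ let $U_\chi(\mathfrak s)$ be the quotient of the universal enveloping superalgebra $U(\mathfrak s)$ by the ideal generated by all $x^p-x^{[p]}-\chi(x)^p$, $x\in\mathfrak g_{\bar 0}$. Modules, submodules and irreducibility are understood in the super ($\mathbb Z/2$-graded) sense. (1) If $M$ is an irreducible $U_\chi(\mathfrak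 g)$-module, then $M^{\mathfrak g_1}=\{m\in M:\mathfrak g_1 m=0\}$, with the grading inherited from $M$, is an irreducible $U_\chi(\mathfrak g_{\bar 0})$-module. (2) For a $U_\chi(\mathfrak g_{\bar 0})$-module $L^0$ put $\psi(L^0)=U_\chi(\mathfrak g)\otimes_{U_\chi(\mathfrak g_+)}L^0$, where $\mathfrak g_1$ acts on $L^0$ by zero. If $L^0$ is irreducible and typical, then there is a parity-preserving isomorphism of $U_\chi(\mathfrak g_{\bar 0})$-modules $L^0\cong\psi(L^0)^{\mathfrak g_1}$. Here typical means the following. Let $\mathfrak h$ be the diagonal Cartan subalgebra, $\mathfrak n^+_{\bar 0}$ the nilradical of the standard Borel subalgebra of $\mathfrak g_{\bar 0}$, and $\rho=\frac12\big(\sum_{\alpha\in\Delta^+_{\bar 0}}\alpha-\sum_{\beta\in\Delta^+_{\bar 1}}\beta\big)$. A weight $\lambda\in\mathfrak h^*$ is typical if $(\lambda+\rho\,|\,\beta)\neq0$ for all positive odd roots $\beta$, where $(\lambda|\beta)=\lambda(t_\beta)$ and $t_\beta\in\mathfrak h$ is the element corresponding to $\beta$ under the supertrace form (up to normalization). If $\chi(\mathfrak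 n_{\bar 0}^+)=0$, an irreducible $L^0$ is typical if $(L^0)^{\mathfrak n_{\bar 0}^+}$ contains a nonzero weight vector whose weight is typical; for general $\chi$ one first conjugates by an element of the adjoint group of $\mathfrak g_{\bar 0}$ so that $\chi$ vanishes on $\mathfrak n_{\bar 0}^+$. -/

import Mathlib

open scoped TensorProduct

/-- The type I basic classical Lie superalgebras `gl(m|n)`, `sl(m|n)`, `osp(2|2n)`. -/
inductive TypeI
  | gl (m n : ℕ)
  | sl (m n : ℕ)
  | osp (n : ℕ)

namespace TypeI

/-- Dimension of the natural module `V`, with its ordered homogeneous basis `e_0, e_1, …`.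
For `gl(m|n)`, `sl(m|n)` the first `m` vectors are even and the last `n` are odd.
For `osp(2|2n)` the vectors `e_0`, `e_{2n+1}` are even and `e_1, …, e_{2n}` are odd. -/
def size : TypeI → ℕ
  | gl m n => m + n
  | sl m n => m + n
  | osp n => 2 * n + 2

/-- Parity of the basis vectors of the natural module. -/
def par : (T : TypeI) → Fin T.size → ZMod 2
  | gl m _, i => if (i : ℕ) < m then 0 else 1
  | sl m _, i => if (i : ℕ) < m then 0 else 1
  | osp n, i => if (i : ℕ) = 0 ∨ (i : ℕ) = 2 * n + 1 then 0 else 1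

/-- The sign `(-1)^{|e_i|}`. -/
def sgn (K : Type*) [Field K] (T : TypeI) (i : Fin T.size) : K :=
  if T.par i = 0 then 1 else -1

/-- The matrices over `K` of the size of the natural module. -/
abbrev Mat (T : TypeI) (K : Type*) : Type _ := Matrix (Fin T.size) (Fin T.size) K

section Algebras

variable (K : Type*) [Field K]

/-- The Gram matrix `J i j = B(e_i, e_j)` of the even nondegenerate supersymmetric form on
`V = K^{2|2n}`: antidiagonal, symmetric on the even part, alternating on the odd part. -/
def ospForm (n : ℕ) : (osp n).Mat K := fun i j =>
  if (i : ℕ) + j = 2 * n + 1 then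
    (if n < (i : ℕ) ∧ (i : ℕ) < 2 * n + 1 then -1 else 1)
  else 0

/-- The sign `(-1)^{(|e_i|+|e_j|)|e_i|}`. -/
def ospSign (n : ℕ) (i j : Fin (osp n).size) : K :=
  if (osp n).par i = 1 ∧ (osp n).par j = 0 then -1 else 1

/-- The supertrace. -/
def str (T : TypeI) : T.Mat K →ₗ[K] K where
  toFun x := ∑ i, sgn K T i * x i i
  map_add' x y := by simp [mul_add, Finset.sum_add_distrib]
  map_smul' c x := by simp [Finset.mul_sum, mul_left_comm]

/-- The Lie superalgebra `𝔤` as a space of matrices.  For `osp(2|2n)` the condition is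
`B(x e_i, e_j) + (-1)^{|x||e_i|} B(e_i, x e_j) = 0` for the homogeneous components of `x`. -/
def algebra : (T : TypeI) → Submodule K (T.Mat K)
  | gl _ _ => ⊤
  | sl m n => LinearMap.ker (str K (sl m n))
  | osp n =>
    { carrier := {x | ∀ i j : Fin (osp n).size,
        (x.transpose * ospForm K n) i j + ospSign K n i j * (ospForm K n * x) i j = 0}
      add_mem' := by
        intro a b ha hb i j
        have h1 := ha i j
        have h2 := hb i j
        rw [Matrix.transpose_add, add_mul, mul_add, Matrix.add_apply, Matrix.add_apply]
        linear_combination h1 + h2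
      zero_mem' := by
        intro i j
        rw [Matrix.transpose_zero, zero_mul, mul_zero, Matrix.zero_apply, mul_zero, add_zero]
      smul_mem' := by
        intro c a ha i j
        have h1 := ha i j
        rw [Matrix.transpose_smul, smul_mul_assoc, mul_smul_comm, Matrix.smul_apply,
          Matrix.smul_apply, smul_eq_mul, smul_eq_mul]
        linear_combination c * h1 }

variable (T : TypeI)

/-- The matrices whose entries vanish outside of the positions satisfying `P`. -/
def supported {K : Type*} [Field K] {N : ℕ} (P : Fin N → Fin N → Prop) :
    Submodule K (Matrix (Fin N) (Fin N) K) where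
  carrier := {x | ∀ i j, ¬ P i j → x i j = 0}
  add_mem' := by
    intro a b ha hb i j h
    rw [Matrix.add_apply, ha i j h, hb i j h, add_zero]
  zero_mem' := by intro i j _; rfl
  smul_mem' := by
    intro c a ha i j h
    rw [Matrix.smul_apply, ha i j h, smul_zero]

/-- The even part `𝔤_0̄`. -/
def even : Submodule K (T.Mat K) := T.algebra K ⊓ supported fun i j => T.par i = T.par j

/-- The odd part `𝔤_1̄`. -/
def odd : Submodule K (T.Mat K) := T.algebra K ⊓ supported fun i j => T.par i ≠ T.par j

/-- The component `𝔤_1` of the `ℤ`-grading `𝔤 = 𝔤_{-1} ⊕ 𝔤_0̄ ⊕ 𝔤_1`: the span of the root vectors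
of the positive odd roots, i.e. the strictly upper triangular odd matrices in `𝔤`. -/
def gOne : Submodule K (T.Mat K) := T.odd K ⊓ supported fun i j => i < j

/-- The subalgebra `𝔤_+ = 𝔤_0̄ ⊕ 𝔤_1`. -/
def plus : Submodule K (T.Mat K) := T.even K ⊔ T.gOne K

/-- The Cartan subalgebra `𝔥`: the diagonal matrices in `𝔤`. -/
def cartan : Submodule K (T.Mat K) := T.algebra K ⊓ supported fun i j => i = j

/-- `𝔫_0̄^+`: the strictly upper triangular matrices in `𝔤_0̄`. -/
def nilEven : Submodule K (T.Mat K) := T.even K ⊓ supported fun i j => i < j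


/-! Closure properties. -/

theorem even_apply {x : T.Mat K} (hx : x ∈ T.even K) {i j : Fin T.size}
    (h : x i j ≠ 0) : T.par i = T.par j := by
  by_contra hc
  exact h (hx.2 i j hc)

theorem par_cases (i : Fin T.size) : T.par i = 0 ∨ T.par i = 1 := by
  cases T <;> simp only [par] <;> split_ifs <;> simp

theorem sgn_even (i : Fin T.size) (j : Fin T.size) (h : T.par i = T.par j) :
    sgn K T i = sgn K T j := by simp [sgn, h]

theorem sgn_odd (i : Fin T.size) (j : Fin T.size) (h : T.par i ≠ T.par j) :
    sgn K T i = - sgn K T j := by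
  rcases T.par_cases i with hi | hi <;> rcases T.par_cases j with hj | hj <;> simp_all [sgn]

theorem str_bracket_even {x y : T.Mat K} (hx : x ∈ T.even K) :
    str K T (x * y - y * x) = 0 := by
  simp only [str, LinearMap.coe_mk, AddHom.coe_mk, Matrix.sub_apply, mul_sub,
    Finset.sum_sub_distrib, Matrix.mul_apply, Finset.mul_sum]
  rw [sub_eq_zero, Finset.sum_comm]
  refine Finset.sum_congr rfl fun i _ => Finset.sum_congr rfl fun j _ => ?_
  by_cases h : x j i = 0
  · simp [h]
  · rw [sgn_even K T j i (even_apply K T hx h)]; ring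

theorem str_bracket_odd {x y : T.Mat K} (hx : x ∈ T.odd K) :
    str K T (x * y + y * x) = 0 := by
  simp only [str, LinearMap.coe_mk, AddHom.coe_mk, Matrix.add_apply, mul_add,
    Finset.sum_add_distrib, Matrix.mul_apply, Finset.mul_sum]
  rw [add_eq_zero_iff_eq_neg, Finset.sum_comm, ← Finset.sum_neg_distrib]
  refine Finset.sum_congr rfl fun i _ => ?_
  rw [← Finset.sum_neg_distrib]
  refine Finset.sum_congr rfl fun j _ => ?_
  by_cases h : x j i = 0
  · simp [h]
  · have h1 : T.par j ≠ T.par i := fun hc => h (hx.2 j i (fun h2 => h2 hc))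
    rw [sgn_odd K T j i h1]; ring

theorem ospForm_apply {n : ℕ} {i j : Fin (osp n).size} (h : ospForm K n i j ≠ 0) :
    (osp n).par i = (osp n).par j := by
  have h1 : (i : ℕ) + j = 2 * n + 1 := by
    by_contra hc
    exact h (by simp [ospForm, hc])
  have hi := i.2
  have hj := j.2
  simp only [size] at hi hj
  simp only [par]
  congr 1
  apply propext
  omega

theorem ospSign_mul (n : ℕ) (i j k : Fin (osp n).size) (h : (osp n).par i = (osp n).par j) :
    (ospSign K n i k = ospSign K n j k) ∧ (ospSign K n k i = ospSign K n k j) := by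
  simp [ospSign, h]

theorem par_eq_of_ne {i j k : Fin T.size} (h : T.par k ≠ T.par i) (h' : T.par k ≠ T.par j) :
    T.par i = T.par j := by
  rcases T.par_cases i with hi | hi <;> rcases T.par_cases j with hj | hj <;>
    rcases T.par_cases k with hk | hk <;> simp_all

theorem ospSign_of_ne (n : ℕ) (k j : Fin (osp n).size) (h : (osp n).par k ≠ (osp n).par j) :
    ospSign K n k j = (if (osp n).par j = 0 then -1 else 1) ∧
    ospSign K n j k = (if (osp n).par j = 0 then 1 else -1) := by
  rcases (osp n).par_cases j with hj | hj <;>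
    rcases (osp n).par_cases k with hk | hk <;> simp_all [ospSign]

theorem osp_iff {n : ℕ} {x : (osp n).Mat K} : x ∈ (osp n).algebra K ↔
    ∀ i j, (x.transpose * ospForm K n) i j = - (ospSign K n i j * (ospForm K n * x) i j) :=
  forall₂_congr fun _ _ => add_eq_zero_iff_eq_neg

theorem ospSign_self {n : ℕ} {i j : Fin (osp n).size} (h : (osp n).par i = (osp n).par j) :
    ospSign K n i j = 1 := by
  simp only [ospSign, h]
  rw [if_neg]
  rintro ⟨h1, h2⟩
  rw [h1] at h2
  exact one_ne_zero h2

theorem osp_even_iff {n : ℕ} {x : (osp n).Mat K}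
    (hx : x ∈ supported fun i j => (osp n).par i = (osp n).par j) :
    x ∈ (osp n).algebra K ↔ x.transpose * ospForm K n = - (ospForm K n * x) := by
  have hx' : ∀ i j, (osp n).par i ≠ (osp n).par j → x i j = 0 := fun i j h => hx i j h
  have key : ∀ i j, ospSign K n i j * (ospForm K n * x) i j = (ospForm K n * x) i j := by
    intro i j
    by_cases h : (osp n).par i = (osp n).par j
    · rw [ospSign_self K h, one_mul]
    · have : (ospForm K n * x) i j = 0 := by
        rw [Matrix.mul_apply]
        refine Finset.sum_eq_zero fun k _ => ?_
        by_cases hk : ospForm K n i k = 0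
        · simp [hk]
        · rw [hx' k j (by rw [← ospForm_apply K hk]; exact h), mul_zero]
      rw [this, mul_zero]
  rw [osp_iff, ← Matrix.ext_iff]
  simp only [key, Matrix.neg_apply]

/-- `[𝔤_0̄, 𝔤] ⊆ 𝔤`. -/
theorem bracket_even_mem {x y : T.Mat K} (hx : x ∈ T.even K) (hy : y ∈ T.algebra K) :
    x * y - y * x ∈ T.algebra K := by
  cases T with
  | gl m n => trivial
  | sl m n => exact str_bracket_even K _ hx
  | osp n =>
    have hx1 := (osp_even_iff K hx.2).1 hx.1
    rw [osp_iff] at hy ⊢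
    intro i j
    have e1 : (y.transpose * ospForm K n * x) i j
        = - (ospSign K n i j * (ospForm K n * y * x) i j) := by
      rw [Matrix.mul_apply, Matrix.mul_apply, Finset.mul_sum, ← Finset.sum_neg_distrib]
      refine Finset.sum_congr rfl fun k _ => ?_
      by_cases h : x k j = 0
      · simp [h]
      · rw [hy i k, (ospSign_mul K n k j i (even_apply K _ hx h)).2]; ring
    have e2 : (x.transpose * (y.transpose * ospForm K n)) i j
        = - (ospSign K n i j * (x.transpose * (ospForm K n * y)) i j) := by
      rw [Matrix.mul_apply, Matrix.mul_apply, Finset.mul_sum, ← Finset.sum_neg_distrib]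
      refine Finset.sum_congr rfl fun k _ => ?_
      rw [Matrix.transpose_apply]
      by_cases h : x k i = 0
      · simp [h]
      · rw [hy k j, (ospSign_mul K n k i j (even_apply K _ hx h)).1]; ring
    rw [← Matrix.mul_assoc x.transpose (ospForm K n), hx1] at e2
    rw [Matrix.transpose_sub, Matrix.transpose_mul, Matrix.transpose_mul, sub_mul, mul_sub,
      Matrix.mul_assoc, hx1, Matrix.mul_assoc x.transpose, Matrix.sub_apply, Matrix.sub_apply, e2,
      mul_neg, ← Matrix.mul_assoc, Matrix.neg_apply, e1, neg_mul, Matrix.neg_apply,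
      ← Matrix.mul_assoc, ← Matrix.mul_assoc]
    ring

/-- `[𝔤_1̄, 𝔤_1̄] ⊆ 𝔤`. -/
theorem bracket_odd_mem {x y : T.Mat K} (hx : x ∈ T.odd K) (hy : y ∈ T.odd K) :
    x * y + y * x ∈ T.algebra K := by
  cases T with
  | gl m n => trivial
  | sl m n => exact str_bracket_odd K _ hx
  | osp n =>
    have key : ∀ x y : (osp n).Mat K, x ∈ (osp n).odd K → y ∈ (osp n).odd K → ∀ i j,
        ((x * y).transpose * ospForm K n) i j =
          - (ospSign K n i j * (ospForm K n * (y * x)) i j) := by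
      intro x y hx hy i j
      have hx1 := (osp_iff K).1 hx.1
      have hy1 := (osp_iff K).1 hy.1
      have hx2 : ∀ i j, (osp n).par i = (osp n).par j → x i j = 0 :=
        fun i j h => hx.2 i j (fun h2 => h2 h)
      have hy2 : ∀ i j, (osp n).par i = (osp n).par j → y i j = 0 :=
        fun i j h => hy.2 i j (fun h2 => h2 h)
      have hJx : ∀ k j, (osp n).par k = (osp n).par j → (ospForm K n * x) k j = 0 := by
        intro k j h
        rw [Matrix.mul_apply]
        refine Finset.sum_eq_zero fun l _ => ?_
        by_cases hl : ospForm K n k l = 0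
        · simp [hl]
        · rw [hx2 l j (by rw [← ospForm_apply K hl, h]), mul_zero]
      have hz : ∀ i k j, y k i * (ospForm K n * x) k j ≠ 0 →
          (osp n).par i = (osp n).par j ∧ (osp n).par k ≠ (osp n).par j := by
        intro i k j h
        have h1 : (osp n).par k ≠ (osp n).par i := fun hc => h (by rw [hy2 k i hc, zero_mul])
        have h2 : (osp n).par k ≠ (osp n).par j := fun hc => h (by rw [hJx k j hc, mul_zero])
        exact ⟨par_eq_of_ne _ h1 h2, h2⟩
      have e1 : ((x * y).transpose * ospForm K n) i j
          = - ∑ k, ospSign K n k j * (y k i * (ospForm K n * x) k j) := by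
        rw [Matrix.transpose_mul, Matrix.mul_assoc, Matrix.mul_apply, ← Finset.sum_neg_distrib]
        refine Finset.sum_congr rfl fun k _ => ?_
        rw [hx1 k j, Matrix.transpose_apply]; ring
      have e2 : ospSign K n i j * (ospForm K n * (y * x)) i j
          = ∑ k, ospSign K n i j * ((ospForm K n * y) i k * x k j) := by
        rw [← Matrix.mul_assoc, Matrix.mul_apply, Finset.mul_sum]
      have e3 : ∑ k, ospSign K n k j * (y k i * (ospForm K n * x) k j)
          = ∑ k, ospSign K n i j * ((ospForm K n * y) i k * x k j) := by
        by_cases hij : (osp n).par i = (osp n).par j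
        · -- the common sign of all nonzero terms
          have hs : ∀ k, ospSign K n k j * (y k i * (ospForm K n * x) k j) =
              (if (osp n).par j = 0 then -1 else 1) * (y k i * (ospForm K n * x) k j) := by
            intro k
            by_cases h0 : y k i * (ospForm K n * x) k j = 0
            · rw [h0, mul_zero, mul_zero]
            · rw [(ospSign_of_ne K n k j (hz i k j h0).2).1]
          have hs' : ∀ k, (ospForm K n * y) i k * x k j =
              (if (osp n).par j = 0 then -1 else 1) *
                ((y.transpose * ospForm K n) i k * x k j) := by
            intro k
            by_cases h0 : x k j = 0
            · rw [h0, mul_zero, mul_zero, mul_zero]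
            · have hk' : (osp n).par k ≠ (osp n).par j := fun hc => h0 (hx2 k j hc)
              rw [hy1 i k, (ospSign_mul K n i j k hij).1, (ospSign_of_ne K n k j hk').2]
              split_ifs <;> ring
          rw [ospSign_self K hij]
          simp only [one_mul, hs, hs', ← Finset.mul_sum]
          congr 1
          have := congrFun (congrFun (Matrix.mul_assoc y.transpose (ospForm K n) x) i) j
          rw [Matrix.mul_apply, Matrix.mul_apply] at this
          exact this.symm
        · rw [Finset.sum_eq_zero, Finset.sum_eq_zero]
          · intro k _
            by_cases h0 : x k j = 0
            · rw [h0, mul_zero, mul_zero]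
            · have h1 : (osp n).par k ≠ (osp n).par j := fun hc => h0 (hx2 k j hc)
              have h2 : (osp n).par i = (osp n).par k :=
                par_eq_of_ne _ (fun hc => hij hc.symm) (fun hc => h1 hc.symm)
              have h3 : (ospForm K n * y) i k = 0 := by
                rw [Matrix.mul_apply]
                refine Finset.sum_eq_zero fun l _ => ?_
                by_cases hl : ospForm K n i l = 0
                · simp [hl]
                · rw [hy2 l k (by rw [← ospForm_apply K hl, h2]), mul_zero]
              rw [h3, zero_mul, mul_zero]
          · intro k _
            by_contra h0
            exact hij (hz i k j (fun hc => h0 (by rw [hc, mul_zero]))).1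
      rw [e1, e2, e3]
    rw [osp_iff]
    intro i j
    rw [Matrix.transpose_add, add_mul, mul_add, Matrix.add_apply, Matrix.add_apply,
      key x y hx hy, key y x hy hx]
    ring


theorem trace_pow_char (p : ℕ) [Fact p.Prime] [CharP K p] {ι : Type*} [DecidableEq ι] [Fintype ι]
    (M : Matrix ι ι K) : (M ^ p).trace = M.trace ^ p := by
  have hp : 0 < p := (Fact.out : p.Prime).pos
  cases isEmpty_or_nonempty ι
  · simp [Matrix.trace, hp.ne']
  have h1 : Polynomial.expand K p (M ^ p).charpoly = M.charpoly ^ p := by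
    unfold Matrix.charpoly
    rw [AlgHom.map_det, ← Matrix.coe_detMonoidHom,
      ← (Matrix.detMonoidHom : Matrix ι ι (Polynomial K) →* Polynomial K).map_pow]
    apply congr_arg Matrix.det
    refine matPolyEquiv.injective ?_
    rw [map_pow, Matrix.matPolyEquiv_charmatrix, sub_pow_char_of_commute, ← Polynomial.C_pow]
    · exact (id (matPolyEquiv_eq_X_pow_sub_C p M) :)
    · exact (Polynomial.C M).commute_X
  have h2 : (M ^ p).charpoly = M.charpoly.map (frobenius K p) := by
    apply Polynomial.expand_injective hp
    rw [h1, ← Polynomial.map_expand, Polynomial.map_frobenius_expand]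
  rw [Matrix.trace_eq_neg_charpoly_coeff, Matrix.trace_eq_neg_charpoly_coeff, h2,
    Polynomial.coeff_map, frobenius_def, neg_pow (M.charpoly.coeff _)]
  rcases (Fact.out : p.Prime).eq_two_or_odd' with h | h
  · subst h
    have : (2 : K) = 0 := CharTwo.two_eq_zero
    linear_combination (-(M.charpoly.coeff (Fintype.card ι - 1) ^ 2)) * this
  · rw [h.neg_one_pow]; ring

theorem mul_par_mem {x y : T.Mat K}
    (hx : x ∈ supported fun i j => T.par i = T.par j)
    (hy : y ∈ supported fun i j => T.par i = T.par j) :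
    x * y ∈ supported fun i j => T.par i = T.par j := by
  intro i j h
  rw [Matrix.mul_apply]
  refine Finset.sum_eq_zero fun k _ => ?_
  by_cases h1 : T.par i = T.par k
  · rw [hy k j (fun hc => h (h1.trans hc)), mul_zero]
  · rw [hx i k h1, zero_mul]

theorem pow_par_mem {x : T.Mat K} (hx : x ∈ supported fun i j => T.par i = T.par j) (k : ℕ) :
    x ^ k ∈ supported fun i j => T.par i = T.par j := by
  induction k with
  | zero =>
    intro i j h
    rw [pow_zero, Matrix.one_apply_ne (fun hc => h (by rw [hc]))]
  | succ k ih => rw [pow_succ]; exact mul_par_mem K T ih hx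

theorem str_eq_trace (x : T.Mat K) :
    str K T x = (Matrix.diagonal (sgn K T) * x).trace := by
  simp [str, Matrix.trace]

theorem sgn_commute {x : T.Mat K} (hx : x ∈ supported fun i j => T.par i = T.par j) :
    Matrix.diagonal (sgn K T) * x = x * Matrix.diagonal (sgn K T) := by
  ext i j
  rw [Matrix.diagonal_mul, Matrix.mul_diagonal]
  by_cases h : T.par i = T.par j
  · rw [sgn_even K T i j h, mul_comm]
  · rw [hx i j h]; simp

/-- `𝔤_0̄` is closed under the `p`-th power map `x ↦ x^p` of matrices, so `𝔤` is restricted. -/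
theorem pow_mem_even (p : ℕ) [Fact p.Prime] [CharP K p] (hp : 2 < p) {x : T.Mat K}
    (hx : x ∈ T.even K) : x ^ p ∈ T.even K := by
  have hodd : Odd p := (Fact.out : p.Prime).odd_of_ne_two (by omega)
  refine ⟨?_, pow_par_mem K T hx.2 p⟩
  cases T with
  | gl m n => trivial
  | sl m n =>
    have h0 : str K (sl m n) x = 0 := hx.1
    change str K (sl m n) (x ^ p) = 0
    rw [str_eq_trace] at h0 ⊢
    have hD : Matrix.diagonal (sgn K (sl m n)) ^ p = Matrix.diagonal (sgn K (sl m n)) := by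
      rw [Matrix.diagonal_pow]
      congr 1
      funext i
      simp only [sgn, Pi.pow_apply]
      split_ifs
      · exact one_pow p
      · exact hodd.neg_one_pow
    have h1 := (show Commute _ _ from sgn_commute K (sl m n) hx.2).mul_pow p
    rw [hD] at h1
    rw [← h1, trace_pow_char, h0, zero_pow (by omega)]
  | osp n =>
    refine (osp_even_iff K (pow_par_mem K _ hx.2 p)).2 ?_
    have h1 := (osp_even_iff K hx.2).1 hx.1
    have h2 : ∀ k : ℕ, (x ^ k).transpose * ospForm K n = (-1 : K) ^ k • (ospForm K n * x ^ k) := by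
      intro k
      induction k with
      | zero => simp
      | succ k ih =>
        rw [pow_succ, Matrix.transpose_mul, Matrix.mul_assoc, ih, mul_smul_comm,
          ← Matrix.mul_assoc, h1, neg_mul, Matrix.mul_assoc, ← pow_succ' x, smul_neg,
          pow_succ (-1 : K), mul_neg_one, neg_smul, pow_succ x]
    rw [h2, hodd.neg_one_pow, neg_one_smul]

/-- The degrees of the basis vectors for the compatible `ℤ`-grading of the natural module. -/
def deg : (T : TypeI) → Fin T.size → ℤ
  | gl m _, i => if (i : ℕ) < m then 1 else 0
  | sl m _, i => if (i : ℕ) < m then 1 else 0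
  | osp n, i => if (i : ℕ) = 0 then 1 else if (i : ℕ) = 2 * n + 1 then -1 else 0

theorem osp_corner [NeZero (2 : K)] {n : ℕ} {x : (osp n).Mat K} (hx : x ∈ (osp n).algebra K)
    {i j : Fin (osp n).size} (hij : (i : ℕ) + j = 2 * n + 1) (h : (osp n).par i = 0) :
    x i j = 0 := by
  have h1 := (osp_iff K).1 hx j j
  have hf : ∀ k, k ≠ i → ospForm K n k j = 0 := by
    intro k hk
    rw [ospForm, if_neg]
    intro hc
    exact hk (Fin.ext (by omega))
  have hf' : ∀ k, k ≠ i → ospForm K n j k = 0 := by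
    intro k hk
    rw [ospForm, if_neg]
    intro hc
    exact hk (Fin.ext (by omega))
  have hi2 := i.2
  have hj2 := j.2
  simp only [size] at hi2 hj2
  have hi : (i : ℕ) = 0 ∨ (i : ℕ) = 2 * n + 1 := by
    by_contra hc
    simp [par, hc] at h
  have e1 : ospForm K n i j = 1 := by
    rw [ospForm, if_pos hij, if_neg (by omega)]
  have e2 : ospForm K n j i = 1 := by
    rw [ospForm, if_pos (by omega), if_neg (by omega)]
  rw [Matrix.mul_apply, Matrix.mul_apply,
    Finset.sum_eq_single i (fun k _ hk => by rw [hf k hk, mul_zero]) (by simp),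
    Finset.sum_eq_single i (fun k _ hk => by rw [hf' k hk, zero_mul]) (by simp),
    ospSign_self K rfl, e1, e2, Matrix.transpose_apply] at h1
  have h3 : (2 : K) * x i j = 0 := by linear_combination h1
  exact (mul_eq_zero.1 h3).resolve_left (NeZero.ne _)

theorem even_deg [NeZero (2 : K)] {x : T.Mat K} (hx : x ∈ T.even K) {i j : Fin T.size}
    (h : x i j ≠ 0) : T.deg i = T.deg j := by
  have hp := even_apply K T hx h
  cases T with
  | gl m n => simp only [par] at hp; simp only [deg]; split_ifs at hp ⊢ <;> simp_all
  | sl m n => simp only [par] at hp; simp only [deg]; split_ifs at hp ⊢ <;> simp_all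
  | osp n =>
    by_cases h0 : (osp n).par i = 0
    · by_cases hij : (i : ℕ) + j = 2 * n + 1
      · exact absurd (osp_corner K hx.1 hij h0) h
      · have h0' := hp.symm.trans h0
        have hi : (i : ℕ) = 0 ∨ (i : ℕ) = 2 * n + 1 := by
          by_contra hc
          simp [par, hc] at h0
        have hj : (j : ℕ) = 0 ∨ (j : ℕ) = 2 * n + 1 := by
          by_contra hc
          simp [par, hc] at h0'
        rw [show i = j from Fin.ext (by omega)]
    · have hi : ¬ ((i : ℕ) = 0 ∨ (i : ℕ) = 2 * n + 1) := by
        intro hc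
        simp [par, hc] at h0
      rw [hp] at h0
      have hj : ¬ ((j : ℕ) = 0 ∨ (j : ℕ) = 2 * n + 1) := by
        intro hc
        simp [par, hc] at h0
      simp only [deg]
      split_ifs <;> first | rfl | omega

theorem deg_succ_iff (i j : Fin T.size) :
    T.deg i = T.deg j + 1 ↔ T.par i ≠ T.par j ∧ i < j := by
  have hi := i.2
  have hj := j.2
  rw [Fin.lt_def]
  cases T <;> simp only [deg, par, size] at * <;> split_ifs <;> simp <;> omega

theorem gOne_deg {x : T.Mat K} (hx : x ∈ T.gOne K) {i j : Fin T.size} (h : x i j ≠ 0) :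
    T.deg i = T.deg j + 1 := by
  rw [deg_succ_iff]
  constructor
  · intro hc
    exact h (hx.1.2 i j (fun h2 => h2 hc))
  · by_contra hc
    exact h (hx.2 i j hc)

theorem mul_deg {x y : T.Mat K} {a b : ℤ} (hx : ∀ i j, x i j ≠ 0 → T.deg i = T.deg j + a)
    (hy : ∀ i j, y i j ≠ 0 → T.deg i = T.deg j + b) (i j : Fin T.size)
    (h : T.deg i ≠ T.deg j + (a + b)) : (x * y) i j = 0 := by
  rw [Matrix.mul_apply]
  refine Finset.sum_eq_zero fun k _ => ?_
  by_contra hc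
  have h1 := hx i k (left_ne_zero_of_mul hc)
  have h2 := hy k j (right_ne_zero_of_mul hc)
  omega

/-- `[𝔤_0̄, 𝔤_1] ⊆ 𝔤_1`. -/
theorem bracket_gOne_mem [NeZero (2 : K)] {x y : T.Mat K} (hx : x ∈ T.even K)
    (hy : y ∈ T.gOne K) : x * y - y * x ∈ T.gOne K := by
  have hx' : ∀ i j, x i j ≠ 0 → T.deg i = T.deg j + 0 := fun i j h => by
    rw [add_zero]; exact even_deg K T hx h
  have hy' : ∀ i j, y i j ≠ 0 → T.deg i = T.deg j + 1 := fun i j h => gOne_deg K T hy h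
  have key : ∀ i j, T.deg i ≠ T.deg j + 1 → (x * y - y * x) i j = 0 := by
    intro i j h
    rw [Matrix.sub_apply, mul_deg K T hx' hy' i j (by simpa using h),
      mul_deg K T hy' hx' i j (by simpa using h), sub_zero]
  refine ⟨⟨bracket_even_mem K T hx hy.1.1, fun i j h => key i j fun hc => ?_⟩,
    fun i j h => key i j fun hc => ?_⟩
  · exact h ((T.deg_succ_iff i j).1 hc).1
  · exact h ((T.deg_succ_iff i j).1 hc).2

/-- `[𝔤_1, 𝔤_1] = 0`. -/
theorem gOne_anticomm [NeZero (2 : K)] {x y : T.Mat K} (hx : x ∈ T.gOne K) (hy : y ∈ T.gOne K) :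
    x * y + y * x = 0 := by
  have hx' : ∀ i j, x i j ≠ 0 → T.deg i = T.deg j + 1 := fun i j h => gOne_deg K T hx h
  have hy' : ∀ i j, y i j ≠ 0 → T.deg i = T.deg j + 1 := fun i j h => gOne_deg K T hy h
  have hz := bracket_odd_mem K T hx.1 hy.1
  ext i j
  by_cases h : T.deg i = T.deg j + (1 + 1)
  · cases T with
    | gl m n => simp only [deg] at h; split_ifs at h <;> omega
    | sl m n => simp only [deg] at h; split_ifs at h <;> omega
    | osp n =>
      have h1 : (i : ℕ) = 0 ∧ (j : ℕ) = 2 * n + 1 := by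
        simp only [deg] at h
        split_ifs at h <;> omega
      exact osp_corner K hz (by omega) (by simp [par, h1.1])
  · rw [Matrix.add_apply, mul_deg K T hx' hy' i j h, mul_deg K T hy' hx' i j h]
    simp

/-! Roots, weights and the group of `𝔤_0̄`. -/

theorem cartan_le_even : T.cartan K ≤ T.even K :=
  fun _ hx => ⟨hx.1, fun i j h => hx.2 i j (fun hc => h (congrArg _ hc))⟩

theorem nilEven_le_even : T.nilEven K ≤ T.even K := fun _ hx => hx.1

end Algebras

/-- The positive roots, with the pair `(i, j)` standing for the root `ε_i - ε_j`, where
`ε_i(h) = h i i`.  For `osp(2|2n)` one has `ε_{2n+1-i} = -ε_i`, so that `(i, j)` and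
`(2n+1-j, 2n+1-i)` give the same root and exactly one of the two pairs is listed; the pair
`(0, 2n+1)` gives no root. -/
def posRoots : (T : TypeI) → Finset (Fin T.size × Fin T.size)
  | gl _ _ => Finset.univ.filter fun β => β.1 < β.2
  | sl _ _ => Finset.univ.filter fun β => β.1 < β.2
  | osp n => Finset.univ.filter fun β => β.1 < β.2 ∧ (β.1 : ℕ) + β.2 ≤ 2 * n + 1 ∧
      ¬ ((β.1 : ℕ) = 0 ∧ (β.2 : ℕ) = 2 * n + 1)

/-- The positive even roots. -/
def posEven (T : TypeI) : Finset (Fin T.size × Fin T.size) :=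
  T.posRoots.filter fun β => T.par β.1 = T.par β.2

/-- The positive odd roots. -/
def posOdd (T : TypeI) : Finset (Fin T.size × Fin T.size) :=
  T.posRoots.filter fun β => T.par β.1 ≠ T.par β.2

section Weights

variable (K : Type*) [Field K] (T : TypeI)

/-- The root `ε_i - ε_j` as a linear form on `𝔥`. -/
def root (β : Fin T.size × Fin T.size) : Module.Dual K (T.cartan K) where
  toFun h := (h : T.Mat K) β.1 β.1 - (h : T.Mat K) β.2 β.2
  map_add' x y := by simp only [Submodule.coe_add, Matrix.add_apply]; ring
  map_smul' c x := by
    simp only [Submodule.coe_smul, Matrix.smul_apply, smul_eq_mul, RingHom.id_apply]; ring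

/-- `ρ`: half the sum of the positive even roots minus half the sum of the positive odd roots. -/
def rho : Module.Dual K (T.cartan K) :=
  (2 : K)⁻¹ • (∑ β ∈ T.posEven, T.root K β - ∑ β ∈ T.posOdd, T.root K β)

/-- The element of `𝔥` dual to `ε_i` up to the sign `(-1)^{|e_i|}`. -/
def dualMat : (T : TypeI) → Fin T.size → T.Mat K
  | gl _ _, i => Matrix.single i i 1
  | sl _ _, i => Matrix.single i i 1
  | osp _, i => Matrix.single i i 1 - Matrix.single i.rev i.rev 1

/-- The matrix `t_β`, see `dualElt`. -/
def dualEltMat (β : Fin T.size × Fin T.size) : T.Mat K :=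
  sgn K T β.1 • dualMat K T β.1 - sgn K T β.2 • dualMat K T β.2

theorem dualMat_diag (i k l : Fin T.size) (h : k ≠ l) : dualMat K T i k l = 0 := by
  have h1 : ∀ i : Fin T.size, (Matrix.single i i (1 : K)) k l = 0 := fun i =>
    Matrix.single_apply_of_ne _ _ _ _ _ (fun hc => h (hc.1.symm.trans hc.2))
  cases T with
  | gl m n => exact h1 i
  | sl m n => exact h1 i
  | osp n =>
    simp only [dualMat]
    rw [Matrix.sub_apply, h1, sub_eq_zero]
    exact (h1 i.rev).symm

theorem str_single (i : Fin T.size) : str K T (Matrix.single i i 1) = sgn K T i := by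
  simp only [str, LinearMap.coe_mk, AddHom.coe_mk]
  rw [Finset.sum_eq_single i]
  · simp
  · intro b _ hb
    rw [Matrix.single_apply_of_ne _ _ _ _ _ (fun hc => hb hc.1.symm), mul_zero]
  · simp

theorem dualEltMat_mem (β : Fin T.size × Fin T.size) : T.dualEltMat K β ∈ T.cartan K := by
  have hd : ∀ k l, k ≠ l → T.dualEltMat K β k l = 0 := by
    intro k l h
    simp [dualEltMat, dualMat_diag K T _ k l h]
  refine ⟨?_, fun i j h => hd i j h⟩
  cases T with
  | gl m n => trivial
  | sl m n =>
    change str K (sl m n) _ = 0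
    have hs : ∀ i, sgn K (sl m n) i * sgn K (sl m n) i = 1 := by
      intro i; simp only [sgn]; split_ifs <;> ring
    rw [dualEltMat, map_sub, map_smul, map_smul]
    simp only [dualMat, str_single, smul_eq_mul, hs, sub_self]
  | osp n =>
    refine (osp_even_iff K (fun i j h => hd i j (fun hc => h (congrArg _ hc)))).2 ?_
    have hrev : ∀ i k l : Fin (osp n).size, (k : ℕ) + l = 2 * n + 1 →
        dualMat K (osp n) i k k = - dualMat K (osp n) i l l := by
      intro i k l hkl
      have hi := i.2
      have hk := k.2
      have hl := l.2
      simp only [size] at hi hk hl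
      have h1 : (i = k) ↔ (i.rev = l) := by
        rw [Fin.ext_iff, Fin.ext_iff, Fin.val_rev]; simp only [size]; omega
      have h2 : (i.rev = k) ↔ (i = l) := by
        rw [Fin.ext_iff, Fin.ext_iff, Fin.val_rev]; simp only [size]; omega
      simp only [dualMat]
      erw [Matrix.sub_apply, Matrix.sub_apply]
      simp only [Matrix.single_apply, and_self]
      simp only [h1]
      by_cases h3 : i.rev = l <;> by_cases h4 : i = l <;> simp_all
    have ht : (osp n).dualEltMat K β = Matrix.diagonal fun k => (osp n).dualEltMat K β k k := by
      ext k l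
      by_cases h : k = l
      · subst h; simp
      · rw [hd k l h, Matrix.diagonal_apply_ne _ h]
    rw [ht]
    ext k l
    rw [Matrix.diagonal_transpose, Matrix.diagonal_mul, Matrix.neg_apply, Matrix.mul_diagonal]
    by_cases h : (k : ℕ) + l = 2 * n + 1
    · have : (osp n).dualEltMat K β k k = - (osp n).dualEltMat K β l l := by
        simp only [dualEltMat, Matrix.sub_apply, Matrix.smul_apply, smul_eq_mul]
        rw [hrev _ k l h, hrev _ k l h]; ring
      rw [this]; ring
    · have : ospForm K n k l = 0 := by simp [ospForm, h]
      rw [this]; ring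

/-- The element `t_β ∈ 𝔥` dual to the root `β` under the invariant form on `𝔤` (the supertrace form
`str (x y)`, or half of it for `osp(2|2n)`), i.e. `(t_β, h) = β(h)` for `h ∈ 𝔥`. -/
def dualElt (β : Fin T.size × Fin T.size) : T.cartan K :=
  ⟨T.dualEltMat K β, T.dualEltMat_mem K β⟩

theorem str_single_mul (i : Fin T.size) (h : T.Mat K) :
    str K T (Matrix.single i i 1 * h) = sgn K T i * h i i := by
  simp only [str, LinearMap.coe_mk, AddHom.coe_mk]
  rw [Finset.sum_eq_single i]
  · simp
  · intro b _ hb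
    rw [Matrix.single_mul_apply_of_ne (h := hb), mul_zero]
  · simp

/-- The defining property of `t_β`. -/
theorem str_dualElt_mul (β : Fin T.size × Fin T.size) (h : T.cartan K) :
    str K T ((T.dualElt K β : T.Mat K) * (h : T.Mat K)) =
      (match T with | gl _ _ => 1 | sl _ _ => 1 | osp _ => 2) * T.root K β h := by
  have hs : ∀ i, sgn K T i * sgn K T i = 1 := by
    intro i; simp only [sgn]; split_ifs <;> ring
  obtain ⟨h, hh⟩ := h
  simp only [dualElt, dualEltMat, sub_mul, smul_mul_assoc, map_sub, map_smul, root,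
    LinearMap.coe_mk, AddHom.coe_mk, smul_eq_mul]
  cases T with
  | gl m n => simp only [dualMat, str_single_mul, ← mul_assoc, hs]; ring
  | sl m n => simp only [dualMat, str_single_mul, ← mul_assoc, hs]; ring
  | osp n =>
    have hrev : ∀ i : Fin (osp n).size, h i.rev i.rev = - h i i ∧
        sgn K (osp n) i.rev = sgn K (osp n) i := by
      intro i
      have hi : (i : ℕ) + (i.rev : ℕ) = 2 * n + 1 := by
        have := i.2
        rw [Fin.val_rev]; simp only [size] at *; omega
      have hJ : ospForm K n i i.rev ≠ 0 := by
        rw [ospForm, if_pos hi]; split_ifs <;> simp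
      have hz : ∀ k, k ≠ i.rev → ospForm K n i k = 0 := by
        intro k hk
        rw [ospForm, if_neg]
        intro hc
        exact hk (Fin.ext (by omega))
      refine ⟨?_, (sgn_even K _ _ _ (ospForm_apply K hJ)).symm⟩
      have h1 := (osp_iff K).1 hh.1 i i.rev
      have hd : ∀ k l, k ≠ l → h k l = 0 := fun k l hkl => hh.2 k l hkl
      rw [Matrix.mul_apply, Matrix.mul_apply, ospSign_self K (ospForm_apply K hJ),
        Finset.sum_eq_single i (fun k _ hk => by
          rw [Matrix.transpose_apply, hd k i hk, zero_mul]) (by simp),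
        Finset.sum_eq_single i.rev (fun k _ hk => by rw [hz k hk, zero_mul]) (by simp),
        Matrix.transpose_apply] at h1
      have h2 : ospForm K n i i.rev * (h i.rev i.rev + h i i) = 0 := by linear_combination h1
      exact eq_neg_of_add_eq_zero_left ((mul_eq_zero.1 h2).resolve_left hJ)
    have hm : ∀ i : Fin (osp n).size, str K (osp n) (dualMat K (osp n) i * h) =
        2 * (sgn K (osp n) i * h i i) := by
      intro i
      have e : dualMat K (osp n) i * h =
          (Matrix.single i i 1 : (osp n).Mat K) * h - (Matrix.single i.rev i.rev 1 : (osp n).Mat K) * h :=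
        sub_mul _ _ _
      rw [e, map_sub, str_single_mul, str_single_mul, (hrev i).1, (hrev i).2]
      ring
    have hm1 := hm β.1
    have hm2 := hm β.2
    have hs1 := hs β.1
    have hs2 := hs β.2
    rw [hm1, hm2]
    linear_combination (2 * h β.1 β.1) * hs1 - (2 * h β.2 β.2) * hs2

/-- The number `(λ|β) = λ(t_β)` for a weight `λ` and a root `β`. -/
def pairing (l : Module.Dual K (T.cartan K)) (β : Fin T.size × Fin T.size) : K :=
  l (T.dualElt K β)

/-- A weight `λ` is typical if `(λ + ρ|β) ≠ 0` for all positive odd roots `β`. -/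
def IsTypicalWeight (l : Module.Dual K (T.cartan K)) : Prop :=
  ∀ β ∈ T.posOdd, T.pairing K (l + T.rho K) β ≠ 0

/-- The conditions on a block diagonal matrix that define the group of `𝔤_0̄`: none for `gl` and
`sl`; for `osp(2|2n)`, to be an isometry which is the identity on `V_0̄`. -/
def IsIsometry : (T : TypeI) → T.Mat K → Prop
  | gl _ _, _ => True
  | sl _ _, _ => True
  | osp n, g => g.transpose * ospForm K n * g = ospForm K n ∧
      ∀ i j, (osp n).par i = 0 → g i j = (1 : (osp n).Mat K) i j

/-- The group `GL_m × GL_n` for `gl(m|n)` and `sl(m|n)`, and `Sp_{2n}` for `osp(2|2n)`.  It acts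
on `𝔤` by conjugation and its image in the automorphisms of `𝔤_0̄` is the adjoint group. -/
structure IsGroupElt (g : (T.Mat K)ˣ) : Prop where
  even : (g : T.Mat K) ∈ supported fun i j => T.par i = T.par j
  even_inv : ((g⁻¹ : (T.Mat K)ˣ) : T.Mat K) ∈ supported fun i j => T.par i = T.par j
  isometry : IsIsometry K T g

variable {K T} in
theorem IsGroupElt.conj_mem {g : (T.Mat K)ˣ} (hg : IsGroupElt K T g) {x : T.Mat K}
    (hx : x ∈ T.even K) : (g : T.Mat K) * x * ((g⁻¹ : (T.Mat K)ˣ) : T.Mat K) ∈ T.even K := by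
  have hpar := mul_par_mem K T (mul_par_mem K T hg.even hx.2) hg.even_inv
  refine ⟨?_, hpar⟩
  have hiso := hg.isometry
  cases T with
  | gl m n => trivial
  | sl m n =>
    have h0 : str K (sl m n) x = 0 := hx.1
    change str K (sl m n) _ = 0
    rw [str_eq_trace] at h0 ⊢
    rw [← Matrix.mul_assoc, ← Matrix.mul_assoc, sgn_commute K _ hg.even, Matrix.trace_mul_comm,
      ← Matrix.mul_assoc, ← Matrix.mul_assoc, Units.inv_mul, Matrix.one_mul, h0]
  | osp n =>
    refine (osp_even_iff K hpar).2 ?_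
    have h1 := (osp_even_iff K hx.2).1 hx.1
    have h2 : (g : (osp n).Mat K).transpose * ospForm K n
        = ospForm K n * ((g⁻¹ : ((osp n).Mat K)ˣ) : (osp n).Mat K) := by
      rw [← hiso.1, Matrix.mul_assoc _ (g : (osp n).Mat K), Units.mul_inv, Matrix.mul_one, hiso.1]
    have h3 : ((g⁻¹ : ((osp n).Mat K)ˣ) : (osp n).Mat K).transpose * ospForm K n
        = ospForm K n * (g : (osp n).Mat K) := by
      have h4 := congrArg (fun z => ((g⁻¹ : ((osp n).Mat K)ˣ) : (osp n).Mat K).transpose * z *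
        (g : (osp n).Mat K)) h2
      rw [← Matrix.mul_assoc, ← Matrix.transpose_mul, Units.mul_inv, Matrix.transpose_one,
        Matrix.one_mul, Matrix.mul_assoc, Matrix.mul_assoc, Units.inv_mul, Matrix.mul_one] at h4
      exact h4.symm
    rw [Matrix.transpose_mul, Matrix.transpose_mul, Matrix.mul_assoc, Matrix.mul_assoc, h2,
      ← Matrix.mul_assoc x.transpose, h1, ← Matrix.mul_assoc, mul_neg, ← Matrix.mul_assoc, h3]
    simp only [neg_mul, Matrix.mul_assoc]

variable {K T} in
/-- The adjoint action of the group on `𝔤_0̄`. -/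
def IsGroupElt.Ad {g : (T.Mat K)ˣ} (hg : IsGroupElt K T g) : T.even K →ₗ[K] T.even K where
  toFun x := ⟨(g : T.Mat K) * (x : T.Mat K) * ((g⁻¹ : (T.Mat K)ˣ) : T.Mat K), hg.conj_mem x.2⟩
  map_add' x y := by
    apply Subtype.ext; simp [Matrix.mul_add, Matrix.add_mul]
  map_smul' c x := by
    apply Subtype.ext; simp

end Weights
/-! Reduced enveloping superalgebras. -/

section Enveloping

variable {K : Type*} [Field K] {T : TypeI}

/-- The relations of the reduced enveloping superalgebra `U_χ(𝔰)` on the tensor algebra of `𝔰`, for a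
subalgebra `𝔰` of `𝔤`: the supercommutator relations, and `x^p - x^{[p]} = χ(x)^p` for even `x`, where
`x^{[p]}` is the `p`-th power of the matrix `x`. -/
inductive Rel (p : ℕ) (χ : Module.Dual K (T.even K)) (s : Submodule K (T.Mat K)) :
    TensorAlgebra K s → TensorAlgebra K s → Prop
  | even (x y z : s) (hx : (x : T.Mat K) ∈ T.even K)
      (hz : (z : T.Mat K) = (x : T.Mat K) * y - (y : T.Mat K) * x) :
      Rel p χ s (TensorAlgebra.ι K x * TensorAlgebra.ι K y - TensorAlgebra.ι K y * TensorAlgebra.ι K x)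
        (TensorAlgebra.ι K z)
  | odd (x y z : s) (hx : (x : T.Mat K) ∈ T.odd K) (hy : (y : T.Mat K) ∈ T.odd K)
      (hz : (z : T.Mat K) = (x : T.Mat K) * y + (y : T.Mat K) * x) :
      Rel p χ s (TensorAlgebra.ι K x * TensorAlgebra.ι K y + TensorAlgebra.ι K y * TensorAlgebra.ι K x)
        (TensorAlgebra.ι K z)
  | pow (x z : s) (hx : (x : T.Mat K) ∈ T.even K) (hz : (z : T.Mat K) = (x : T.Mat K) ^ p) :
      Rel p χ s (TensorAlgebra.ι K x ^ p - TensorAlgebra.ι K z)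
        (algebraMap K _ (χ ⟨x, hx⟩ ^ p))

/-- The reduced enveloping superalgebra `U_χ(𝔰)`. -/
def U (p : ℕ) (χ : Module.Dual K (T.even K)) (s : Submodule K (T.Mat K)) : Type _ :=
  RingQuot (Rel p χ s)

variable (p : ℕ) (χ : Module.Dual K (T.even K)) (s : Submodule K (T.Mat K))

instance : Ring (U p χ s) := inferInstanceAs (Ring (RingQuot (Rel p χ s)))

instance : Algebra K (U p χ s) := inferInstanceAs (Algebra K (RingQuot (Rel p χ s)))

namespace U

/-- The canonical map `𝔰 → U_χ(𝔰)`. -/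
def of : s →ₗ[K] U p χ s :=
  (RingQuot.mkAlgHom K (Rel p χ s)).toLinearMap ∘ₗ TensorAlgebra.ι K

theorem of_even (x y z : s) (hx : (x : T.Mat K) ∈ T.even K)
    (hz : (z : T.Mat K) = (x : T.Mat K) * y - (y : T.Mat K) * x) :
    of p χ s x * of p χ s y - of p χ s y * of p χ s x = of p χ s z := by
  have h := RingQuot.mkAlgHom_rel K (Rel.even (p := p) (χ := χ) x y z hx hz)
  rw [map_sub, map_mul, map_mul] at h
  exact h

theorem of_odd (x y z : s) (hx : (x : T.Mat K) ∈ T.odd K) (hy : (y : T.Mat K) ∈ T.odd K)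
    (hz : (z : T.Mat K) = (x : T.Mat K) * y + (y : T.Mat K) * x) :
    of p χ s x * of p χ s y + of p χ s y * of p χ s x = of p χ s z := by
  have h := RingQuot.mkAlgHom_rel K (Rel.odd (p := p) (χ := χ) x y z hx hy hz)
  rw [map_add, map_mul, map_mul] at h
  exact h

theorem of_pow (x z : s) (hx : (x : T.Mat K) ∈ T.even K)
    (hz : (z : T.Mat K) = (x : T.Mat K) ^ p) :
    of p χ s x ^ p - of p χ s z = algebraMap K _ (χ ⟨x, hx⟩ ^ p) := by
  have h := RingQuot.mkAlgHom_rel K (Rel.pow (p := p) (χ := χ) x z hx hz)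
  rw [map_sub, map_pow, AlgHom.commutes] at h
  exact h

variable {p χ s} in
/-- The universal property of `U_χ(𝔰)`. -/
def lift {A : Type*} [Ring A] [Algebra K A] (f : s →ₗ[K] A)
    (h1 : ∀ x y z : s, (x : T.Mat K) ∈ T.even K →
      (z : T.Mat K) = (x : T.Mat K) * y - (y : T.Mat K) * x → f x * f y - f y * f x = f z)
    (h2 : ∀ x y z : s, (x : T.Mat K) ∈ T.odd K → (y : T.Mat K) ∈ T.odd K →
      (z : T.Mat K) = (x : T.Mat K) * y + (y : T.Mat K) * x → f x * f y + f y * f x = f z)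
    (h3 : ∀ (x z : s) (hx : (x : T.Mat K) ∈ T.even K), (z : T.Mat K) = (x : T.Mat K) ^ p →
      f x ^ p - f z = algebraMap K A (χ ⟨x, hx⟩ ^ p)) : U p χ s →ₐ[K] A :=
  RingQuot.liftAlgHom K ⟨TensorAlgebra.lift K f, by
    rintro _ _ (⟨x, y, z, hx, hz⟩ | ⟨x, y, z, hx, hy, hz⟩ | ⟨x, z, hx, hz⟩)
    · simp only [map_sub, map_mul, TensorAlgebra.lift_ι_apply]; exact h1 x y z hx hz
    · simp only [map_add, map_mul, TensorAlgebra.lift_ι_apply]; exact h2 x y z hx hy hz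
    · simp only [map_sub, map_pow, TensorAlgebra.lift_ι_apply, AlgHom.commutes]
      rw [h3 x z hx hz, map_pow]⟩

theorem lift_of {A : Type*} [Ring A] [Algebra K A] (f : s →ₗ[K] A) (h1) (h2) (h3) (x : s) :
    lift (p := p) (χ := χ) f h1 h2 h3 (of p χ s x) = f x :=
  (RingQuot.liftAlgHom_mkAlgHom_apply K _ _ _).trans (TensorAlgebra.lift_ι_apply _ _)

theorem induction {C : U p χ s → Prop} (h0 : ∀ r, C (algebraMap K _ r))
    (h1 : ∀ x, C (of p χ s x)) (h2 : ∀ a b, C a → C b → C (a * b))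
    (h3 : ∀ a b, C a → C b → C (a + b)) (a : U p χ s) : C a := by
  obtain ⟨a, rfl⟩ := RingQuot.mkAlgHom_surjective K (Rel p χ s) a
  induction a using TensorAlgebra.induction with
  | algebraMap r => rw [AlgHom.commutes]; exact h0 r
  | ι x => exact h1 x
  | mul a b ha hb => rw [map_mul]; exact h2 _ _ ha hb
  | add a b ha hb => rw [map_add]; exact h3 _ _ ha hb

variable {s} in
/-- The map `U_χ(𝔰) → U_χ(𝔱)` for subalgebras `𝔰 ⊆ 𝔱`. -/
def incl {t : Submodule K (T.Mat K)} (h : s ≤ t) : U p χ s →ₐ[K] U p χ t :=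
  lift (of p χ t ∘ₗ Submodule.inclusion h)
    (fun x y z hx hz => of_even p χ t (Submodule.inclusion h x) (Submodule.inclusion h y)
      (Submodule.inclusion h z) hx hz)
    (fun x y z hx hy hz => of_odd p χ t (Submodule.inclusion h x) (Submodule.inclusion h y)
      (Submodule.inclusion h z) hx hy hz)
    (fun x z hx hz => of_pow p χ t (Submodule.inclusion h x) (Submodule.inclusion h z) hx hz)

variable {s} in
theorem incl_of {t : Submodule K (T.Mat K)} (h : s ≤ t) (x : s) :
    incl p χ h (of p χ s x) = of p χ t (Submodule.inclusion h x) :=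
  lift_of ..

end U

theorem even_le : T.even K ≤ T.algebra K := fun _ hx => hx.1

theorem odd_le : T.odd K ≤ T.algebra K := fun _ hx => hx.1

theorem gOne_le : T.gOne K ≤ T.algebra K := fun _ hx => hx.1.1

theorem plus_le : T.plus K ≤ T.algebra K := sup_le even_le gOne_le

/-- The even component of a matrix. -/
def evenPart : T.Mat K →ₗ[K] T.Mat K where
  toFun x := Matrix.of fun i j => if T.par i = T.par j then x i j else 0
  map_add' x y := by ext i j; simp only [Matrix.of_apply, Matrix.add_apply]; split_ifs <;> simp
  map_smul' c x := by ext i j; simp only [Matrix.of_apply, Matrix.smul_apply]; split_ifs <;> simp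

theorem evenPart_even {x : T.Mat K} (hx : x ∈ T.even K) : evenPart x = x := by
  ext i j
  by_cases h : T.par i = T.par j
  · simp [evenPart, h]
  · simp only [evenPart, LinearMap.coe_mk, AddHom.coe_mk, Matrix.of_apply, if_neg h]
    exact (hx.2 i j h).symm

theorem evenPart_odd {x : T.Mat K} (hx : x ∈ T.odd K) : evenPart x = 0 := by
  ext i j
  by_cases h : T.par i = T.par j
  · simp only [evenPart, LinearMap.coe_mk, AddHom.coe_mk, Matrix.of_apply, if_pos h]
    exact hx.2 i j (fun h2 => h2 h)
  · simp [evenPart, h]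

theorem evenPart_plus {x : T.Mat K} (hx : x ∈ T.plus K) :
    evenPart x ∈ T.even K ∧ x - evenPart x ∈ T.gOne K := by
  obtain ⟨a, ha, b, hb, rfl⟩ := Submodule.mem_sup.1 hx
  rw [map_add, evenPart_even ha, evenPart_odd hb.1, add_zero, add_sub_cancel_left]
  exact ⟨ha, hb⟩

/-- The projection `𝔤_+ → 𝔤_0̄` with kernel `𝔤_1`. -/
def plusProj : T.plus K →ₗ[K] T.even K :=
  (evenPart ∘ₗ (T.plus K).subtype).codRestrict _ fun x => (evenPart_plus x.2).1

theorem plusProj_even (x : T.plus K) (hx : (x : T.Mat K) ∈ T.even K) :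
    plusProj x = ⟨x, hx⟩ := Subtype.ext (evenPart_even hx)

theorem plusProj_odd (x : T.plus K) (hx : (x : T.Mat K) ∈ T.odd K) : plusProj x = 0 :=
  Subtype.ext (evenPart_odd hx)

/-- The map `U_χ(𝔤_+) → U_χ(𝔤_0̄)` that kills `𝔤_1`. -/
def plusToEven [NeZero (2 : K)] : U p χ (T.plus K) →ₐ[K] U p χ (T.even K) :=
  U.lift (U.of p χ (T.even K) ∘ₗ plusProj)
    (fun x y z hx hz => by
      refine U.of_even p χ (T.even K) _ _ _ (plusProj x).2 ?_
      have h1 := evenPart_plus y.2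
      have h2 : (y : T.Mat K) = evenPart (y : T.Mat K) + (y - evenPart (y : T.Mat K)) := by abel
      have h3 : (x : T.Mat K) * evenPart (y : T.Mat K) - evenPart (y : T.Mat K) * x ∈ T.even K := by
        refine ⟨bracket_even_mem K T hx h1.1.1, ?_⟩
        exact Submodule.sub_mem _ (mul_par_mem K T hx.2 h1.1.2) (mul_par_mem K T h1.1.2 hx.2)
      have h4 := bracket_gOne_mem K T hx h1.2
      have h5 : (z : T.Mat K) = ((x : T.Mat K) * evenPart (y : T.Mat K)
          - evenPart (y : T.Mat K) * x) + ((x : T.Mat K) * (y - evenPart (y : T.Mat K))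
          - (y - evenPart (y : T.Mat K)) * (x : T.Mat K)) := by
        rw [hz]; noncomm_ring
      change evenPart (z : T.Mat K) = evenPart (x : T.Mat K) * evenPart (y : T.Mat K)
        - evenPart (y : T.Mat K) * evenPart (x : T.Mat K)
      rw [evenPart_even hx, h5, map_add, evenPart_even h3, evenPart_odd h4.1, add_zero])
    (fun x y z hx hy hz => by
      have hg : ∀ w : T.plus K, (w : T.Mat K) ∈ T.odd K → (w : T.Mat K) ∈ T.gOne K := by
        intro w hw
        have := (evenPart_plus w.2).2
        rwa [evenPart_odd hw, sub_zero] at this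
      have hz0 : z = 0 := Subtype.ext (hz.trans (gOne_anticomm K T (hg x hx) (hg y hy)))
      simp [LinearMap.comp_apply, plusProj_odd x hx, hz0])
    (fun x z hx hz => by
      have h : (plusProj z : T.even K).1 = (plusProj x : T.even K).1 ^ p := by
        change evenPart (z : T.Mat K) = evenPart (x : T.Mat K) ^ p
        have hpow : ((x : T.Mat K) ^ p) ∈ supported fun i j => T.par i = T.par j :=
          pow_par_mem K T hx.2 p
        rw [evenPart_even hx, hz]
        have hz2 : (z : T.Mat K) ∈ T.even K := ⟨plus_le z.2, by rw [hz]; exact hpow⟩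
        rw [← hz, evenPart_even hz2]
      have := U.of_pow p χ (T.even K) (plusProj x) (plusProj z) (plusProj x).2 h
      rw [LinearMap.comp_apply, LinearMap.comp_apply, this]
      congr 3
      exact plusProj_even x hx)

theorem plusToEven_of [NeZero (2 : K)] (x : T.plus K) :
    plusToEven p χ (U.of p χ (T.plus K) x) = U.of p χ (T.even K) (plusProj x) :=
  U.lift_of ..

/-! Supermodules. -/

/-- The decomposition `M = 𝓜 0 ⊕ 𝓜 1` makes the `U_χ(𝔰)`-module `M` a supermodule. -/
structure IsSupermodule (M : Type*) [AddCommGroup M] [Module K M] [Module (U p χ s) M]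
    (𝓜 : ZMod 2 → Submodule K M) : Prop where
  isCompl : IsCompl (𝓜 0) (𝓜 1)
  even_smul_mem : ∀ x : s, (x : T.Mat K) ∈ T.even K → ∀ i, ∀ m ∈ 𝓜 i, U.of p χ s x • m ∈ 𝓜 i
  odd_smul_mem : ∀ x : s, (x : T.Mat K) ∈ T.odd K → ∀ i, ∀ m ∈ 𝓜 i, U.of p χ s x • m ∈ 𝓜 (i + 1)

/-- A submodule in the super sense: one that contains the homogeneous components of its elements. -/
def IsHomogeneousSubmodule {M : Type*} [AddCommGroup M] [Module K M] {A : Type*} [Ring A]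
    [Module A M] (𝓜 : ZMod 2 → Submodule K M) (N : Submodule A M) : Prop :=
  ∀ m ∈ N, ∃ a ∈ 𝓜 0, ∃ b ∈ 𝓜 1, a ∈ N ∧ b ∈ N ∧ a + b = m

/-- An irreducible `U_χ(𝔰)`-supermodule: nonzero, with no proper nonzero subsupermodule. -/
structure IsIrreducibleSupermodule (M : Type*) [AddCommGroup M] [Module K M] [Module (U p χ s) M]
    (𝓜 : ZMod 2 → Submodule K M) : Prop extends IsSupermodule p χ s M 𝓜 where
  nontrivial : Nontrivial M
  eq_bot_or_eq_top : ∀ N : Submodule (U p χ s) M, IsHomogeneousSubmodule 𝓜 N → N = ⊥ ∨ N = ⊤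

section Invariants

variable (M : Type*) [AddCommGroup M] [Module K M] [Module (U p χ (T.algebra K)) M]
  [IsScalarTower K (U p χ (T.algebra K)) M]

/-- The invariants `M^{𝔤_1} = {m | 𝔤_1 m = 0}`. -/
def invariants : Submodule K M where
  carrier := {m | ∀ y : T.gOne K, U.of p χ (T.algebra K) (Submodule.inclusion gOne_le y) • m = 0}
  add_mem' ha hb y := by rw [smul_add, ha y, hb y, add_zero]
  zero_mem' y := smul_zero _
  smul_mem' c m hm y := by rw [smul_algebra_smul_comm, hm y, smul_zero]

variable {M} in
theorem invariants_smul_mem [NeZero (2 : K)] (u : U p χ (T.even K)) {m : M}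
    (hm : m ∈ invariants p χ M) : U.incl p χ even_le u • m ∈ invariants p χ M := by
  induction u using U.induction generalizing m with
  | h0 r =>
    rw [AlgHom.commutes, algebraMap_smul]
    exact Submodule.smul_mem _ _ hm
  | h1 x =>
    intro y
    have hy : ((x : T.Mat K) * y - (y : T.Mat K) * x) ∈ T.gOne K := bracket_gOne_mem K T x.2 y.2
    have h := U.of_even p χ (T.algebra K) (Submodule.inclusion even_le x)
      (Submodule.inclusion gOne_le y) (Submodule.inclusion gOne_le ⟨_, hy⟩) x.2 rfl
    have h2 : U.of p χ (T.algebra K) (Submodule.inclusion gOne_le y) *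
        U.of p χ (T.algebra K) (Submodule.inclusion even_le x) =
        U.of p χ (T.algebra K) (Submodule.inclusion even_le x) *
        U.of p χ (T.algebra K) (Submodule.inclusion gOne_le y) -
        U.of p χ (T.algebra K) (Submodule.inclusion gOne_le ⟨_, hy⟩) := by
      rw [← h]; abel
    rw [U.incl_of, smul_smul, h2, sub_smul, mul_smul, hm y, hm ⟨_, hy⟩,
      smul_zero, sub_zero]
  | h2 a b ha hb => rw [map_mul, mul_smul]; exact ha (hb hm)
  | h3 a b ha hb => rw [map_add, add_smul]; exact Submodule.add_mem _ (ha hm) (hb hm)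

/-- `M^{𝔤_1}` is a `U_χ(𝔤_0̄)`-module, by restriction of the action of `U_χ(𝔤)`. -/
instance [NeZero (2 : K)] : Module (U p χ (T.even K)) (invariants p χ M) where
  smul u m := ⟨U.incl p χ even_le u • (m : M), invariants_smul_mem p χ u m.2⟩
  one_smul m := Subtype.ext (by
    change U.incl p χ even_le 1 • (m : M) = m
    rw [map_one, one_smul])
  mul_smul a b m := Subtype.ext (by
    change U.incl p χ even_le (a * b) • (m : M) = U.incl p χ even_le a • U.incl p χ even_le b • (m : M)
    rw [map_mul, mul_smul])
  smul_zero a := Subtype.ext (smul_zero (U.incl p χ even_le a))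
  smul_add a m n := Subtype.ext (smul_add (U.incl p χ even_le a) (m : M) n)
  add_smul a b m := Subtype.ext (by
    change U.incl p χ even_le (a + b) • (m : M)
      = U.incl p χ even_le a • (m : M) + U.incl p χ even_le b • (m : M)
    rw [map_add, add_smul])
  zero_smul m := Subtype.ext (by
    change U.incl p χ even_le 0 • (m : M) = 0
    rw [map_zero, zero_smul])

variable {M} in
/-- The parity decomposition of `M^{𝔤_1}` inherited from `M`. -/
def invariantsGrading (𝓜 : ZMod 2 → Submodule K M) (i : ZMod 2) :
    Submodule K (invariants p χ M) :=
  (𝓜 i).comap (invariants p χ M).subtype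

end Invariants

section Induction

variable [NeZero (2 : K)] (L : Type*) [AddCommGroup L] [Module K L] [Module (U p χ (T.even K)) L]

/-- The relations `(u a) ⊗ l = u ⊗ (a l)`, for `a ∈ U_χ(𝔤_+)`, of the tensor product over
`U_χ(𝔤_+)`; here `U_χ(𝔤_+)` acts on `L` through `U_χ(𝔤_0̄)`, i.e. with trivial action of `𝔤_1`. -/
def psiRel : Submodule (U p χ (T.algebra K)) (U p χ (T.algebra K) ⊗[K] L) :=
  Submodule.span _ {z | ∃ (u : U p χ (T.algebra K)) (a : U p χ (T.plus K)) (l : L),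
    z = (u * U.incl p χ plus_le a) ⊗ₜ[K] l - u ⊗ₜ[K] (plusToEven p χ a • l)}

/-- The induced module `ψ(L) = U_χ(𝔤) ⊗_{U_χ(𝔤_+)} L`. -/
def Psi : Type _ := (U p χ (T.algebra K) ⊗[K] L) ⧸ psiRel p χ L

instance : AddCommGroup (Psi p χ L) :=
  inferInstanceAs (AddCommGroup ((U p χ (T.algebra K) ⊗[K] L) ⧸ psiRel p χ L))

instance : Module (U p χ (T.algebra K)) (Psi p χ L) :=
  inferInstanceAs (Module (U p χ (T.algebra K)) ((U p χ (T.algebra K) ⊗[K] L) ⧸ psiRel p χ L))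

instance : Module K (Psi p χ L) :=
  inferInstanceAs (Module K ((U p χ (T.algebra K) ⊗[K] L) ⧸ psiRel p χ L))

instance : IsScalarTower K (U p χ (T.algebra K)) (Psi p χ L) :=
  inferInstanceAs (IsScalarTower K (U p χ (T.algebra K))
    ((U p χ (T.algebra K) ⊗[K] L) ⧸ psiRel p χ L))

variable {L} in
/-- The class of `u ⊗ l` in `ψ(L)`. -/
def Psi.tmul (u : U p χ (T.algebra K)) (l : L) : Psi p χ L :=
  Submodule.Quotient.mk (p := psiRel p χ L) (u ⊗ₜ[K] l)

/-- `u ∈ U_χ(𝔰)` is a product of homogeneous elements of `𝔰` whose parities add up to `i`. -/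
inductive IsMonomial : ZMod 2 → U p χ s → Prop
  | one : IsMonomial 0 1
  | even (x : s) (hx : (x : T.Mat K) ∈ T.even K) (i : ZMod 2) (u : U p χ s) (hu : IsMonomial i u) :
      IsMonomial i (U.of p χ s x * u)
  | odd (x : s) (hx : (x : T.Mat K) ∈ T.odd K) (i : ZMod 2) (u : U p χ s) (hu : IsMonomial i u) :
      IsMonomial (i + 1) (U.of p χ s x * u)

variable {L} in
/-- The parity decomposition of `ψ(L)`: `ψ(L)_k` is spanned by the `u ⊗ l` with `u` and `l`
homogeneous and `|u| + |l| = k`. -/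
def psiGrading (𝓛 : ZMod 2 → Submodule K L) (k : ZMod 2) : Submodule K (Psi p χ L) :=
  Submodule.span K {z | ∃ i j, ∃ u l, IsMonomial p χ (T.algebra K) i u ∧ l ∈ 𝓛 j ∧ i + j = k ∧
    z = Psi.tmul p χ u l}

end Induction

/-- A `U_χ(𝔤_0̄)`-module `L` is typical (a notion used for simple `L`) if, after conjugating by an
element `g` of the group of `𝔤_0̄` so that `χ` vanishes on `𝔫_0̄^+`, it has a nonzero vector which is
annihilated by `𝔫_0̄^+` and on which `𝔥` acts by a typical weight.  The conjugation replaces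
`𝔫_0̄^+` and `𝔥` by `Ad(g) 𝔫_0̄^+` and `Ad(g) 𝔥`; one can take `g = 1` if `χ(𝔫_0̄^+) = 0`. -/
def IsTypical (L : Type*) [AddCommGroup L] [Module K L] [Module (U p χ (T.even K)) L] : Prop :=
  ∃ (g : (T.Mat K)ˣ) (hg : IsGroupElt K T g),
    (∀ x : T.nilEven K, χ (hg.Ad (Submodule.inclusion (T.nilEven_le_even K) x)) = 0) ∧
    ∃ (v : L) (l : Module.Dual K (T.cartan K)), v ≠ 0 ∧
      (∀ x : T.nilEven K,
        U.of p χ (T.even K) (hg.Ad (Submodule.inclusion (T.nilEven_le_even K) x)) • v = 0) ∧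
      (∀ h : T.cartan K,
        U.of p χ (T.even K) (hg.Ad (Submodule.inclusion (T.cartan_le_even K) h)) • v = l h • v) ∧
      IsTypicalWeight K T l

end Enveloping

end TypeI

/-! Since `[𝔤_1, 𝔤_1] = 0 = [𝔤_{-1}, 𝔤_{-1}]` and `2` is invertible, `𝔤_1` and `𝔤_{-1}` act on every
module through finite-dimensional spaces of pairwise anticommuting operators of square zero.

Part (1). Let `M` be irreducible and `R = 𝔤_{-1} M`. Anticommuting operators of square zero have a
common nonzero kernel vector and do not generate everything by their images, so `M^{𝔤_1} ≠ 0` and `R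
≠ M`. A nonzero homogeneous `𝔤_0̄`-stable space `L` of invariants generates `M` already under
`𝔤_{-1}`, whence `M = L + R`. The invariants inside `R` form another space of this kind, but what
they generate stays in `R`; so there are none except zero. An invariant `m = l + r` then has `r = m
- l` invariant and in `R`, hence `m = l`. Thus `L` is the space of all invariants
(`IsGradedAction.mem_of_invariant`).

Part (2). Suppose that `ψ(L)` is irreducible. By part (1) its invariants are irreducible, and `L`
maps to them; the map is onto as soon as it is nonzero. Its injectivity (`Psi.one_tmul_injective`)
replaces the PBW theorem: an action of `U_χ(𝔤)` on `Λ(𝔤_{-1}) ⊗ L` is written down explicitly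
(`kacHom`), and `ψ(L)` maps to it with `1 ⊗ l` going to `1 ⊗ l`.

For the irreducibility of `ψ(L)`, the positive odd roots are ordered as `β_0, β_1, …`, with root
vectors `e_k` of `β_k` and `f_k` of `-β_k`. Let `F = f_{d-1} ⋯ f_0`, and let `N` be a nonzero
subsupermodule. Multiplying an element of `N` by suitable `f_k` gives some `F l ∈ N` with `l ≠ 0`
(`exists_prod_apply_mem`). The commutator of `𝔤_0̄` with `F` consists of multiples of `F`
(`commutator_prod_mem_span`), so `{l | F l ∈ N}` is a subsupermodule of `L`, hence all of `L`
(`comap_prod_eq_bot_or_top`). For a highest weight vector `v` of weight `λ`, the vector `e_k f_k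
f_{k-1} ⋯ f_0 v` is `f_{k-1} ⋯ f_0 v` times `(λ - ∑_{j<k} β_j)(t_{β_k})`. The order is chosen so
that `ρ(t_{β_k}) = - ∑_{j<k} β_j(t_{β_k})`; the factor is therefore `(λ + ρ | β_k)`, nonzero by
typicality. Removing the `f_k` one at a time leads from `F v` to `v ∈ N` (`mem_of_prod_apply_mem`),
and then `N` contains `L` and is everything. The group element in the definition of typicality is
absorbed by letting `𝔤` act through its conjugate. -/

namespace TypeI

/-! ### Pairwise anticommuting operators -/

section Operators

variable {K : Type*} [Field K] {M : Type*} [AddCommGroup M] [Module K M]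

theorem mul_self_eq_zero_of_anticomm [NeZero (2 : K)] {f : Module.End K M} (h : f * f + f * f = 0) :
    f * f = 0 := by
  have h2 : (2 : K) • (f * f) = 0 := by rw [two_smul, h]
  exact (smul_eq_zero.1 h2).resolve_left (NeZero.ne _)

theorem apply_eq_neg_of_anticomm {f g : Module.End K M} (h : f * g + g * f = 0) (m : M) :
    f (g m) = - g (f m) :=
  eq_neg_of_add_eq_zero_left (LinearMap.congr_fun h m)

theorem apply_apply_eq_zero [NeZero (2 : K)] {f : Module.End K M} (h : f * f + f * f = 0) (m : M) :
    f (f m) = 0 :=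
  LinearMap.congr_fun (mul_self_eq_zero_of_anticomm h) m

/-- Finitely many pairwise anticommuting operators have a common nonzero kernel vector in every
nonzero subspace which they preserve. -/
theorem exists_ne_zero_apply_eq_zero [NeZero (2 : K)] (fs : List (Module.End K M))
    (h : ∀ f ∈ fs, ∀ g ∈ fs, f * g + g * f = 0) (A : Submodule K M) (hA : A ≠ ⊥)
    (hs : ∀ f ∈ fs, ∀ m ∈ A, f m ∈ A) : ∃ m ∈ A, m ≠ 0 ∧ ∀ f ∈ fs, f m = 0 := by
  induction fs generalizing A with
  | nil =>
    obtain ⟨m, hm, h0⟩ := A.ne_bot_iff.1 hA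
    exact ⟨m, hm, h0, by simp⟩
  | cons f fs ih =>
    have hff := h f (by simp) f (by simp)
    -- The induction continues in `A ⊓ ker f`. It is nonzero: for `0 ≠ a ∈ A` it contains `a` or `f
    -- a`, because `f² = 0`.
    obtain ⟨m, hm, h0⟩ := ih (fun f hf g hg => h f (by simp [hf]) g (by simp [hg]))
      (A ⊓ LinearMap.ker f) (by
        obtain ⟨a, ha, ha0⟩ := A.ne_bot_iff.1 hA
        rw [Submodule.ne_bot_iff]
        by_cases hfa : f a = 0
        · exact ⟨a, ⟨ha, hfa⟩, ha0⟩
        · exact ⟨f a, ⟨hs f (by simp) a ha, apply_apply_eq_zero hff a⟩, hfa⟩)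
      (fun g hg m hm => ⟨hs g (by simp [hg]) m hm.1, by
        have := apply_eq_neg_of_anticomm (h f (by simp) g (by simp [hg])) m
        change f (g m) = 0
        rw [this, LinearMap.mem_ker.1 hm.2, map_zero, neg_zero]⟩)
    refine ⟨m, hm.1, h0.1, ?_⟩
    intro g hg
    rcases List.mem_cons.1 hg with rfl | hg
    · exact hm.2
    · exact h0.2 g hg

/-- The sum of the images of finitely many pairwise anticommuting operators and of a proper subspace
which they preserve is proper. -/
theorem sup_range_ne_top [NeZero (2 : K)] (fs : List (Module.End K M))
    (h : ∀ f ∈ fs, ∀ g ∈ fs, f * g + g * f = 0) (A : Submodule K M) (hA : A ≠ ⊤)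
    (hs : ∀ f ∈ fs, ∀ m ∈ A, f m ∈ A) :
    ∃ B : Submodule K M, A ≤ B ∧ B ≠ ⊤ ∧ ∀ f ∈ fs, ∀ m, f m ∈ B := by
  induction fs generalizing A with
  | nil => exact ⟨A, le_rfl, hA, by simp⟩
  | cons f fs ih =>
    have hff := h f (by simp) f (by simp)
    -- Dually, the induction continues with `A + f M`. It is proper: substituting `M = A + f M` into
    -- itself gives `M = A + f A + f² M ⊆ A`.
    obtain ⟨B, hB, h1, h2⟩ := ih (fun f hf g hg => h f (by simp [hf]) g (by simp [hg]))
      (A ⊔ LinearMap.range f) (by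
        intro hc
        refine hA (eq_top_iff.2 fun m _ => ?_)
        have hm : ∀ m, ∃ a ∈ A, ∃ n, a + f n = m := by
          intro m
          obtain ⟨a, ha, _, ⟨n, rfl⟩, rfl⟩ := Submodule.mem_sup.1 (hc ▸ Submodule.mem_top (x := m))
          exact ⟨a, ha, n, rfl⟩
        obtain ⟨a, ha, n, rfl⟩ := hm m
        obtain ⟨b, hb, k, rfl⟩ := hm n
        rw [map_add, apply_apply_eq_zero hff, add_zero]
        exact A.add_mem ha (hs f (by simp) b hb))
      (fun g hg m hm => by
        obtain ⟨a, ha, _, ⟨n, rfl⟩, rfl⟩ := Submodule.mem_sup.1 hm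
        rw [map_add, apply_eq_neg_of_anticomm (h g (by simp [hg]) f (by simp)) n, ← map_neg]
        exact Submodule.add_mem_sup (hs g (by simp [hg]) a ha) ⟨_, rfl⟩)
    refine ⟨B, le_sup_left.trans hB, h1, ?_⟩
    intro g hg m
    rcases List.mem_cons.1 hg with rfl | hg
    · exact hB (Submodule.mem_sup_right ⟨m, rfl⟩)
    · exact h2 g hg m

/-- The closure of `L` under the operators `f ∈ fs`, if these pairwise anticommute. -/
def wedgeSpan : List (Module.End K M) → Submodule K M → Submodule K M
  | [], L => L
  | f :: fs, L => wedgeSpan fs L ⊔ wedgeSpan fs (L.map f)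

theorem le_wedgeSpan (fs : List (Module.End K M)) (L : Submodule K M) : L ≤ wedgeSpan fs L := by
  induction fs with
  | nil => exact le_rfl
  | cons f fs ih => exact ih.trans le_sup_left

theorem wedgeSpan_mono (fs : List (Module.End K M)) {L L' : Submodule K M} (h : L ≤ L') :
    wedgeSpan fs L ≤ wedgeSpan fs L' := by
  induction fs generalizing L L' with
  | nil => exact h
  | cons f fs ih => exact sup_le_sup (ih h) (ih (Submodule.map_mono h))

/-- The operator `f` passes through every monomial in the anticommuting operators at the cost of a
sign, until it hits the vector of `L`. -/
theorem apply_mem_wedgeSpan_map (fs : List (Module.End K M)) (f : Module.End K M)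
    (h : ∀ g ∈ fs, f * g + g * f = 0) (L : Submodule K M) {m : M} (hm : m ∈ wedgeSpan fs L) :
    f m ∈ wedgeSpan fs (L.map f) := by
  induction fs generalizing L m with
  | nil => exact Submodule.mem_map_of_mem hm
  | cons g fs ih =>
    obtain ⟨a, ha, b, hb, rfl⟩ := Submodule.mem_sup.1 hm
    rw [map_add]
    have h' : ∀ g ∈ fs, f * g + g * f = 0 := fun g hg => h g (by simp [hg])
    refine Submodule.add_mem_sup (ih h' L ha) (wedgeSpan_mono fs ?_ (ih h' _ hb))
    rintro _ ⟨_, ⟨l, hl, rfl⟩, rfl⟩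
    refine ⟨- f l, Submodule.neg_mem _ ⟨l, hl, rfl⟩, ?_⟩
    rw [map_neg, apply_eq_neg_of_anticomm (h g (by simp))]

/-- The head operator `f` carries the first summand of the span to the second, and the second to the
span over `f f L`, which is zero. The other operators preserve both summands by induction. -/
theorem apply_mem_wedgeSpan [NeZero (2 : K)] (fs : List (Module.End K M))
    (h : ∀ f ∈ fs, ∀ g ∈ fs, f * g + g * f = 0) (L : Submodule K M) {f : Module.End K M}
    (hf : f ∈ fs) {m : M} (hm : m ∈ wedgeSpan fs L) : f m ∈ wedgeSpan fs L := by
  induction fs generalizing L m with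
  | nil => simp at hf
  | cons g fs ih =>
    obtain ⟨a, ha, b, hb, rfl⟩ := Submodule.mem_sup.1 hm
    rw [map_add]
    have h' : ∀ f ∈ fs, ∀ g ∈ fs, f * g + g * f = 0 :=
      fun f hf g hg => h f (by simp [hf]) g (by simp [hg])
    rcases List.mem_cons.1 hf with rfl | hf
    · have h1 : ∀ g ∈ fs, f * g + g * f = 0 := fun g hg => h f (by simp) g (by simp [hg])
      refine Submodule.add_mem _
        (Submodule.mem_sup_right (apply_mem_wedgeSpan_map fs f h1 L ha)) ?_
      have h3 : (L.map f).map f ≤ L := by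
        rintro _ ⟨_, ⟨l, hl, rfl⟩, rfl⟩
        rw [apply_apply_eq_zero (h f (by simp) f (by simp))]
        exact zero_mem _
      exact Submodule.mem_sup_left (wedgeSpan_mono fs h3 (apply_mem_wedgeSpan_map fs f h1 _ hb))
    · exact Submodule.add_mem_sup (ih h' L hf ha) (ih h' _ hf hb)

/-- If the product of anticommuting operators is injective on `L`, then every subspace which they
preserve and which meets the closure of `L` contains a nonzero vector of its last layer. -/
theorem exists_prod_apply_mem [NeZero (2 : K)] (fs : List (Module.End K M))
    (h : ∀ f ∈ fs, ∀ g ∈ fs, f * g + g * f = 0) (L : Submodule K M)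
    (hL : ∀ l ∈ L, fs.reverse.prod l = 0 → l = 0) (N : Submodule K M)
    (hN : ∀ f ∈ fs, ∀ m ∈ N, f m ∈ N) {m : M} (hm : m ∈ wedgeSpan fs L) (hmN : m ∈ N)
    (h0 : m ≠ 0) : ∃ l ∈ L, l ≠ 0 ∧ fs.reverse.prod l ∈ N := by
  induction fs generalizing L N m with
  | nil => exact ⟨m, hm, h0, hmN⟩
  | cons f fs ih =>
    have h' : ∀ f ∈ fs, ∀ g ∈ fs, f * g + g * f = 0 :=
      fun f hf g hg => h f (by simp [hf]) g (by simp [hg])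
    have h1 : ∀ g ∈ fs, f * g + g * f = 0 := fun g hg => h f (by simp) g (by simp [hg])
    have hff := h f (by simp) f (by simp)
    have hprod : ∀ l, (f :: fs).reverse.prod l = fs.reverse.prod (f l) := by
      intro l; rw [List.reverse_cons, List.prod_append, List.prod_singleton]; rfl
    have hN' : ∀ f ∈ fs, ∀ m ∈ N, f m ∈ N := fun g hg => hN g (by simp [hg])
    -- In the second summand the induction applies to `f L`: the shorter product at `f l` is the
    -- full product at `l`, so injectivity is inherited.
    have key : ∀ m ∈ wedgeSpan fs (L.map f), m ∈ N → m ≠ 0 →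
        ∃ l ∈ L, l ≠ 0 ∧ (f :: fs).reverse.prod l ∈ N := by
      intro m hm hmN h0
      obtain ⟨_, ⟨l, hl, rfl⟩, hl0, hlN⟩ := ih h' (L.map f) (by
        rintro _ ⟨l, hl, rfl⟩ h2
        rw [hL l hl (by rw [hprod, h2]), map_zero]) N hN' hm hmN h0
      exact ⟨l, hl, fun hc => hl0 (by rw [hc, map_zero]), by rwa [hprod]⟩
    have hcomm : ∀ l, f (fs.reverse.prod l) = 0 → fs.reverse.prod (f l) = 0 := by
      have : ∀ gs : List (Module.End K M), (∀ g ∈ gs, f * g + g * f = 0) → ∀ l,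
          gs.prod (f l) = f (gs.prod l) ∨ gs.prod (f l) = - f (gs.prod l) := by
        intro gs
        induction gs with
        | nil => intro _ l; exact Or.inl rfl
        | cons g gs ih =>
          intro hg l
          have e := apply_eq_neg_of_anticomm (hg g (by simp)) (gs.prod l)
          rw [List.prod_cons, Module.End.mul_apply, Module.End.mul_apply, e]
          rcases ih (fun g h => hg g (by simp [h])) l with e2 | e2
          · right; rw [e2, neg_neg]
          · left; rw [e2, map_neg]
      intro l hl
      rcases this fs.reverse (by simpa using h1) l with e | e <;> rw [e, hl]
      exact neg_zero
    -- `f` is injective on the first summand: a nonzero kernel vector there would, by induction with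
    -- `ker f` as the stable subspace, give a nonzero `l` that the full product kills.
    have hinj : ∀ a ∈ wedgeSpan fs L, f a = 0 → a = 0 := by
      intro a ha hfa
      by_contra hc
      obtain ⟨l, hl, hl0, hlN⟩ := ih h' L (by
        intro l hl h2
        refine hL l hl ?_
        rw [hprod]
        exact hcomm l (by rw [h2, map_zero])) (LinearMap.ker f) (by
          intro g hg m hm
          rw [LinearMap.mem_ker, apply_eq_neg_of_anticomm (h1 g hg), LinearMap.mem_ker.1 hm,
            map_zero, neg_zero]) ha hfa hc
      exact hl0 (hL l hl (by rw [hprod]; exact hcomm l hlN))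
    obtain ⟨a, ha, b, hb, rfl⟩ := Submodule.mem_sup.1 hm
    have hfb : f b = 0 := by
      have := apply_mem_wedgeSpan_map fs f h1 _ hb
      have h3 : (L.map f).map f ≤ ⊥ := by
        rintro _ ⟨_, ⟨l, hl, rfl⟩, rfl⟩
        rw [apply_apply_eq_zero hff]
        exact zero_mem _
      have h4 : ∀ gs : List (Module.End K M), wedgeSpan gs (⊥ : Submodule K M) = ⊥ := by
        intro gs
        induction gs with
        | nil => rfl
        | cons g gs ih => rw [wedgeSpan, Submodule.map_bot, ih, sup_idem]
      have := wedgeSpan_mono fs h3 this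
      rwa [h4, Submodule.mem_bot] at this
    -- If `f a = 0` then `a = 0` and the vector already lies in the second summand; otherwise `f (a
    -- + b) = f a` is a nonzero vector of `N` in the second summand.
    by_cases hfa : f a = 0
    · have ha0 := hinj a ha hfa
      subst ha0
      rw [zero_add] at hmN h0
      exact key b hb hmN h0
    · refine key (f a) (apply_mem_wedgeSpan_map fs f h1 L ha) ?_ hfa
      have := hN f (by simp) _ hmN
      rwa [map_add, hfb, add_zero] at this

/-- Up to sign, `f` can be moved next to its own occurrence in the product, where `f² = 0` applies.
-/
theorem mul_prod_eq_zero_of_mem [NeZero (2 : K)] (fs : List (Module.End K M))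
    (h : ∀ f ∈ fs, ∀ g ∈ fs, f * g + g * f = 0) {f : Module.End K M} (hf : f ∈ fs) :
    f * fs.prod = 0 := by
  induction fs with
  | nil => simp at hf
  | cons g fs ih =>
    rw [List.prod_cons, ← mul_assoc]
    rcases List.mem_cons.1 hf with rfl | hf'
    · rw [mul_self_eq_zero_of_anticomm (h f (by simp) f (by simp)), zero_mul]
    · rw [eq_neg_of_add_eq_zero_left (h f hf g (by simp)), neg_mul, mul_assoc,
        ih (fun f hf g hg => h f (by simp [hf]) g (by simp [hg])) hf', mul_zero, neg_zero]

theorem prod_mul_eq_zero_of_mem [NeZero (2 : K)] (fs : List (Module.End K M))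
    (h : ∀ f ∈ fs, ∀ g ∈ fs, f * g + g * f = 0) {f : Module.End K M} (hf : f ∈ fs) :
    fs.prod * f = 0 := by
  induction fs with
  | nil => simp at hf
  | cons g fs ih =>
    have h' : ∀ f ∈ fs, ∀ g ∈ fs, f * g + g * f = 0 :=
      fun f hf g hg => h f (by simp [hf]) g (by simp [hg])
    rw [List.prod_cons]
    -- If `f` occurs in the tail, induction applies. Otherwise it is the head, and it is carried
    -- rightwards through the tail until it meets the last factor.
    by_cases hf' : f ∈ fs
    · rw [mul_assoc, ih h' hf', mul_zero]
    · obtain rfl := (List.mem_cons.1 hf).resolve_right hf'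
      have : ∀ gs : List (Module.End K M), (∀ g ∈ gs, f * g + g * f = 0) →
          f * gs.prod * f = 0 := by
        intro gs
        induction gs with
        | nil => intro _; rw [List.prod_nil, mul_one, mul_self_eq_zero_of_anticomm (h f hf f hf)]
        | cons g gs ih =>
          intro hg
          rw [List.prod_cons, ← mul_assoc, eq_neg_of_add_eq_zero_left (hg g (by simp)), neg_mul,
            neg_mul, mul_assoc, mul_assoc, ← mul_assoc f, ih (fun g h => hg g (by simp [h])),
            mul_zero, neg_zero]
      exact this fs (fun g hg => h f hf g (by simp [hg]))

/-- An operator which normalizes the span of anticommuting operators commutes with their product up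
to a scalar multiple of this product. -/
theorem commutator_prod_mem_span [NeZero (2 : K)] (fs : List (Module.End K M))
    (h : ∀ f ∈ fs, ∀ g ∈ fs, f * g + g * f = 0) (x : Module.End K M)
    (hx : ∀ f ∈ fs, x * f - f * x ∈ Submodule.span K {g | g ∈ fs}) :
    x * fs.prod - fs.prod * x ∈ Submodule.span K {fs.prod} := by
  -- Leibniz rule, with `pre` the factors already passed. At the factor `f` the commutator `[x, f]`
  -- is a combination of the operators in the list; those in `pre` or `post` create a repeated
  -- factor and contribute zero, so only the multiple of `f` itself survives.
  have key : ∀ (post pre : List (Module.End K M)), pre ++ post = fs →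
      pre.prod * (x * post.prod - post.prod * x) ∈ Submodule.span K {fs.prod} := by
    intro post
    induction post with
    | nil => intro pre _; simp
    | cons f post ih =>
      intro pre he
      have e : pre.prod * (x * (f :: post).prod - (f :: post).prod * x) =
          pre.prod * (x * f - f * x) * post.prod +
          (pre ++ [f]).prod * (x * post.prod - post.prod * x) := by
        rw [List.prod_append, List.prod_singleton, List.prod_cons]; noncomm_ring
      rw [e]
      refine Submodule.add_mem _ ?_ (ih (pre ++ [f]) (by simpa using he))
      have hf : f ∈ fs := by rw [← he]; simp
      have hxf := hx f hf
      generalize x * f - f * x = w at hxf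
      induction hxf using Submodule.span_induction with
      | mem g hg =>
        have hg' : g ∈ fs := hg
        rw [← he, List.mem_append, List.mem_cons] at hg'
        have h1 : ∀ a ∈ pre, ∀ b ∈ pre, a * b + b * a = 0 := fun a ha b hb =>
          h a (by rw [← he]; simp [ha]) b (by rw [← he]; simp [hb])
        have h2 : ∀ a ∈ post, ∀ b ∈ post, a * b + b * a = 0 := fun a ha b hb =>
          h a (by rw [← he]; simp [ha]) b (by rw [← he]; simp [hb])
        rcases hg' with hg' | rfl | hg'
        · rw [prod_mul_eq_zero_of_mem pre h1 hg', zero_mul]; exact zero_mem _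
        · rw [mul_assoc, ← List.prod_cons, ← List.prod_append, he]
          exact Submodule.mem_span_singleton_self _
        · rw [mul_assoc, mul_prod_eq_zero_of_mem post h2 hg', mul_zero]; exact zero_mem _
      | zero => simp
      | add a b _ _ ha hb => rw [mul_add, add_mul]; exact Submodule.add_mem _ ha hb
      | smul c a _ ha =>
        rw [mul_smul_comm, smul_mul_assoc]; exact Submodule.smul_mem _ _ ha
  simpa using key fs [] rfl

end Operators

/-! ### Part (1) in terms of operators: graded actions and their invariants -/

section GradedOperators

variable {K : Type*} [Field K] {M : Type*} [AddCommGroup M] [Module K M]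

/-- Spaces of operators which satisfy the commutation relations of `𝔤_0̄`, `𝔤_1` and `𝔤_{-1}`. -/
structure IsGradedAction (Z P N : Submodule K (Module.End K M)) : Prop where
  zero_pos : ∀ x ∈ Z, ∀ z ∈ P, x * z - z * x ∈ P
  zero_neg : ∀ x ∈ Z, ∀ y ∈ N, x * y - y * x ∈ N
  pos_neg : ∀ z ∈ P, ∀ y ∈ N, z * y + y * z ∈ Z
  pos_pos : ∀ z ∈ P, ∀ z' ∈ P, z * z' + z' * z = 0
  neg_neg : ∀ y ∈ N, ∀ y' ∈ N, y * y' + y' * y = 0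
  pos_fg : P.FG
  neg_fg : N.FG

/-- A subspace that contains the homogeneous components of its elements. -/
def IsHomogeneousSubspace (𝓜 : ZMod 2 → Submodule K M) (W : Submodule K M) : Prop :=
  ∀ m ∈ W, ∃ a ∈ 𝓜 0, ∃ b ∈ 𝓜 1, a ∈ W ∧ b ∈ W ∧ a + b = m

/-- The smallest subspace that contains `L` and is stable under the operators in `N`. -/
def opClosure (N : Submodule K (Module.End K M)) (L : Submodule K M) : Submodule K M :=
  sInf {W | L ≤ W ∧ ∀ y ∈ N, ∀ m ∈ W, y m ∈ W}

variable {Z P N : Submodule K (Module.End K M)} {L : Submodule K M}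

theorem le_opClosure : L ≤ opClosure N L := le_sInf fun _ hW => hW.1

theorem opClosure_le {W : Submodule K M} (h : L ≤ W) (hW : ∀ y ∈ N, ∀ m ∈ W, y m ∈ W) :
    opClosure N L ≤ W := sInf_le ⟨h, hW⟩

theorem opClosure_stable {y : Module.End K M} (hy : y ∈ N) {m : M} (hm : m ∈ opClosure N L) :
    y m ∈ opClosure N L :=
  Submodule.mem_sInf.2 fun W hW => hW.2 y hy m (Submodule.mem_sInf.1 hm W hW)

/-- By `x y = [x, y] + y x` with `[x, y] ∈ N`, the vectors of the closure that `Z` keeps in the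
closure form a space containing `L` and stable under `N`. -/
theorem opClosure_stable_zero (h : IsGradedAction Z P N) (hL : ∀ x ∈ Z, ∀ m ∈ L, x m ∈ L)
    {x : Module.End K M} (hx : x ∈ Z) {m : M} (hm : m ∈ opClosure N L) :
    x m ∈ opClosure N L := by
  let W : Submodule K M :=
    { carrier := {m | m ∈ opClosure N L ∧ ∀ x ∈ Z, x m ∈ opClosure N L}
      add_mem' := fun ha hb => ⟨add_mem ha.1 hb.1, fun x hx => by
        rw [map_add]; exact add_mem (ha.2 x hx) (hb.2 x hx)⟩
      zero_mem' := ⟨zero_mem _, fun x _ => by rw [map_zero]; exact zero_mem _⟩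
      smul_mem' := fun c m hm => ⟨Submodule.smul_mem _ _ hm.1, fun x hx => by
        rw [map_smul]; exact Submodule.smul_mem _ _ (hm.2 x hx)⟩ }
  refine (opClosure_le (W := W) (fun l hl => ⟨le_opClosure hl, fun x hx =>
    le_opClosure (hL x hx l hl)⟩) (fun y hy m hm => ⟨opClosure_stable hy hm.1, fun x hx => ?_⟩)
    hm).2 x hx
  have e : x (y m) = (x * y - y * x) m + y (x m) := by
    simp [Module.End.mul_apply]
  rw [e]
  exact add_mem (opClosure_stable (h.zero_neg x hx y hy) hm.1) (opClosure_stable hy (hm.2 x hx))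

/-- The same argument with `z y = [z, y] - y z`, where `[z, y] ∈ Z` is covered by the previous
lemma. It starts because `P` kills `L`. -/
theorem opClosure_stable_pos (h : IsGradedAction Z P N) (hL : ∀ x ∈ Z, ∀ m ∈ L, x m ∈ L)
    (hP : ∀ z ∈ P, ∀ m ∈ L, z m = 0) {z : Module.End K M} (hz : z ∈ P) {m : M}
    (hm : m ∈ opClosure N L) : z m ∈ opClosure N L := by
  let W : Submodule K M :=
    { carrier := {m | m ∈ opClosure N L ∧ ∀ x ∈ P, x m ∈ opClosure N L}
      add_mem' := fun ha hb => ⟨add_mem ha.1 hb.1, fun x hx => by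
        rw [map_add]; exact add_mem (ha.2 x hx) (hb.2 x hx)⟩
      zero_mem' := ⟨zero_mem _, fun x _ => by rw [map_zero]; exact zero_mem _⟩
      smul_mem' := fun c m hm => ⟨Submodule.smul_mem _ _ hm.1, fun x hx => by
        rw [map_smul]; exact Submodule.smul_mem _ _ (hm.2 x hx)⟩ }
  refine (opClosure_le (W := W) (fun l hl => ⟨le_opClosure hl, fun x hx => ?_⟩)
    (fun y hy m hm => ⟨opClosure_stable hy hm.1, fun x hx => ?_⟩) hm).2 z hz
  · rw [hP x hx l hl]; exact zero_mem _
  have e : x (y m) = (x * y + y * x) m - y (x m) := by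
    simp [Module.End.mul_apply]
  rw [e]
  exact sub_mem (opClosure_stable_zero h hL (h.pos_neg x hx y hy) hm.1)
    (opClosure_stable hy (hm.2 x hx))

theorem opClosure_homogeneous {𝓜 : ZMod 2 → Submodule K M}
    (hN : ∀ y ∈ N, ∀ i, ∀ m ∈ 𝓜 i, y m ∈ 𝓜 (i + 1)) (hL : IsHomogeneousSubspace 𝓜 L) :
    IsHomogeneousSubspace 𝓜 (opClosure N L) := by
  let W : Submodule K M :=
    { carrier := {m | ∃ a ∈ 𝓜 0, ∃ b ∈ 𝓜 1, a ∈ opClosure N L ∧ b ∈ opClosure N L ∧ a + b = m}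
      add_mem' := by
        rintro _ _ ⟨a, ha, b, hb, h1, h2, rfl⟩ ⟨a', ha', b', hb', h1', h2', rfl⟩
        exact ⟨a + a', add_mem ha ha', b + b', add_mem hb hb', add_mem h1 h1', add_mem h2 h2',
          by abel⟩
      zero_mem' := ⟨0, zero_mem _, 0, zero_mem _, zero_mem _, zero_mem _, add_zero 0⟩
      smul_mem' := by
        rintro c _ ⟨a, ha, b, hb, h1, h2, rfl⟩
        exact ⟨c • a, Submodule.smul_mem _ _ ha, c • b, Submodule.smul_mem _ _ hb,
          Submodule.smul_mem _ _ h1, Submodule.smul_mem _ _ h2, (smul_add _ _ _).symm⟩ }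
  refine opClosure_le (W := W) (fun l hl => ?_) ?_
  · obtain ⟨a, ha, b, hb, h1, h2, h3⟩ := hL l hl
    exact ⟨a, ha, b, hb, le_opClosure h1, le_opClosure h2, h3⟩
  · rintro y hy _ ⟨a, ha, b, hb, h1, h2, rfl⟩
    exact ⟨y b, hN y hy 1 b hb, y a, by simpa using hN y hy 0 a ha, opClosure_stable hy h2,
      opClosure_stable hy h1, by rw [map_add, add_comm]⟩

theorem fg_exists_list {G : Submodule K (Module.End K M)} (hG : G.FG) :
    ∃ fs : List (Module.End K M), (∀ f ∈ fs, f ∈ G) ∧ ∀ g ∈ G, g ∈ Submodule.span K {f | f ∈ fs} := by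
  obtain ⟨S, hS⟩ := hG
  refine ⟨S.toList, fun f hf => ?_, fun g hg => ?_⟩
  · rw [← hS]; exact Submodule.subset_span (by simpa using hf)
  · simpa [hS] using hg

/-- Operators from the span of `fs` map into every subspace that the operators in `fs` map into. -/
theorem apply_mem_of_mem_span {fs : Set (Module.End K M)} {g : Module.End K M}
    (hg : g ∈ Submodule.span K fs) {m : M} {B : Submodule K M} (h : ∀ f ∈ fs, f m ∈ B) :
    g m ∈ B := by
  induction hg using Submodule.span_induction with
  | mem f hf => exact h f hf
  | zero => exact zero_mem _
  | add a b _ _ ha hb => exact add_mem ha hb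
  | smul c a _ ha => exact Submodule.smul_mem _ _ ha

theorem IsGradedAction.exists_invariant [NeZero (2 : K)] (h : IsGradedAction Z P N) [Nontrivial M] :
    ∃ m : M, m ≠ 0 ∧ ∀ z ∈ P, z m = 0 := by
  obtain ⟨fs, h1, h2⟩ := fg_exists_list h.pos_fg
  obtain ⟨m, -, hm, hm0⟩ := exists_ne_zero_apply_eq_zero fs
    (fun f hf g hg => h.pos_pos f (h1 f hf) g (h1 g hg)) ⊤ top_ne_bot (fun _ _ _ _ => trivial)
  exact ⟨m, hm, fun z hz => (Submodule.mem_bot K).1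
    (apply_mem_of_mem_span (h2 z hz) fun f hf => (Submodule.mem_bot K).2 (hm0 f hf))⟩

theorem IsGradedAction.exists_ne_top [NeZero (2 : K)] (h : IsGradedAction Z P N) [Nontrivial M] :
    ∃ B : Submodule K M, B ≠ ⊤ ∧ ∀ y ∈ N, ∀ m, y m ∈ B := by
  obtain ⟨fs, h1, h2⟩ := fg_exists_list h.neg_fg
  obtain ⟨B, -, hB, hB0⟩ := sup_range_ne_top fs
    (fun f hf g hg => h.neg_neg f (h1 f hf) g (h1 g hg)) ⊥ bot_ne_top
    (fun f _ m hm => by rw [(Submodule.mem_bot K).1 hm, map_zero]; exact zero_mem _)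
  exact ⟨B, hB, fun y hy m => apply_mem_of_mem_span (h2 y hy) fun f hf => hB0 f hf m⟩

/-- In an irreducible module, a nonzero `𝔤_0̄`-stable homogeneous space of `𝔤_1`-invariants consists
of all invariants. -/
theorem IsGradedAction.mem_of_invariant [NeZero (2 : K)] (h : IsGradedAction Z P N) [Nontrivial M]
    (𝓜 : ZMod 2 → Submodule K M) (h𝓜 : IsCompl (𝓜 0) (𝓜 1))
    (hP : ∀ z ∈ P, ∀ i, ∀ m ∈ 𝓜 i, z m ∈ 𝓜 (i + 1))
    (hN : ∀ y ∈ N, ∀ i, ∀ m ∈ 𝓜 i, y m ∈ 𝓜 (i + 1))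
    (hirr : ∀ W : Submodule K M, IsHomogeneousSubspace 𝓜 W → (∀ x ∈ Z, ∀ m ∈ W, x m ∈ W) →
      (∀ z ∈ P, ∀ m ∈ W, z m ∈ W) → (∀ y ∈ N, ∀ m ∈ W, y m ∈ W) → W = ⊥ ∨ W = ⊤)
    (hL : IsHomogeneousSubspace 𝓜 L) (hLZ : ∀ x ∈ Z, ∀ m ∈ L, x m ∈ L)
    (hLP : ∀ z ∈ P, ∀ m ∈ L, z m = 0) (hL0 : L ≠ ⊥) {m : M} (hm : ∀ z ∈ P, z m = 0) : m ∈ L := by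
  -- Any nonzero homogeneous `Z`-stable space of invariants generates `M` under `N`. This is used
  -- both for the given `L` and for the invariants in `R`.
  have hcl : ∀ L : Submodule K M, IsHomogeneousSubspace 𝓜 L → (∀ x ∈ Z, ∀ m ∈ L, x m ∈ L) →
      (∀ z ∈ P, ∀ m ∈ L, z m = 0) → L ≠ ⊥ → opClosure N L = ⊤ := by
    intro L hL hLZ hLP hL0
    refine (hirr _ (opClosure_homogeneous hN hL) (fun x hx m hm => opClosure_stable_zero h hLZ hx hm)
      (fun z hz m hm => opClosure_stable_pos h hLZ hLP hz hm)
      (fun y hy m hm => opClosure_stable hy hm)).resolve_left fun hc => hL0 ?_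
    rw [eq_bot_iff, ← hc]
    exact le_opClosure
  -- `R` is the span of the image of `𝔤_{-1}`
  let R : Submodule K M := Submodule.span K {r | ∃ y ∈ N, ∃ m, r = y m}
  have hRN : ∀ y ∈ N, ∀ m, y m ∈ R := fun y hy m => Submodule.subset_span ⟨y, hy, m, rfl⟩
  -- Here the square-zero property of `𝔤_{-1}` enters.
  have hRtop : R ≠ ⊤ := by
    obtain ⟨B, hB, hB0⟩ := h.exists_ne_top
    intro hc
    refine hB (eq_top_iff.2 (hc ▸ Submodule.span_le.2 ?_))
    rintro _ ⟨y, hy, m, rfl⟩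
    exact hB0 y hy m
  have hRZ : ∀ x ∈ Z, ∀ m ∈ R, x m ∈ R := by
    intro x hx m hm
    induction hm using Submodule.span_induction with
    | mem _ hr =>
      obtain ⟨y, hy, n, rfl⟩ := hr
      have e : x (y n) = (x * y - y * x) n + y (x n) := by simp [Module.End.mul_apply]
      rw [e]
      exact add_mem (hRN _ (h.zero_neg x hx y hy) n) (hRN y hy _)
    | zero => rw [map_zero]; exact zero_mem _
    | add a b _ _ ha hb => rw [map_add]; exact add_mem ha hb
    | smul c a _ ha => rw [map_smul]; exact Submodule.smul_mem _ _ ha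
  have hsplit : ∀ m : M, ∃ a ∈ 𝓜 0, ∃ b ∈ 𝓜 1, a + b = m := fun m => by
    simpa using Submodule.mem_sup.1 (h𝓜.sup_eq_top ▸ Submodule.mem_top (x := m))
  have hRh : IsHomogeneousSubspace 𝓜 R := by
    intro m hm
    induction hm using Submodule.span_induction with
    | mem _ hr =>
      obtain ⟨y, hy, n, rfl⟩ := hr
      obtain ⟨a, ha, b, hb, rfl⟩ := hsplit n
      exact ⟨y b, hN y hy 1 b hb, y a, by simpa using hN y hy 0 a ha, hRN y hy b, hRN y hy a,
        by rw [map_add, add_comm]⟩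
    | zero => exact ⟨0, zero_mem _, 0, zero_mem _, zero_mem _, zero_mem _, add_zero 0⟩
    | add _ _ _ _ hm hm' =>
      obtain ⟨a, ha, b, hb, h1, h2, rfl⟩ := hm
      obtain ⟨a', ha', b', hb', h1', h2', rfl⟩ := hm'
      exact ⟨a + a', add_mem ha ha', b + b', add_mem hb hb', add_mem h1 h1', add_mem h2 h2',
        by abel⟩
    | smul c _ _ h1 =>
      obtain ⟨a, ha, b, hb, h1, h2, rfl⟩ := h1
      exact ⟨c • a, Submodule.smul_mem _ _ ha, c • b, Submodule.smul_mem _ _ hb,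
        Submodule.smul_mem _ _ h1, Submodule.smul_mem _ _ h2, (smul_add _ _ _).symm⟩
  -- the invariants in `R`
  let I : Submodule K M :=
    { carrier := {m | m ∈ R ∧ ∀ z ∈ P, z m = 0}
      add_mem' := fun ha hb => ⟨add_mem ha.1 hb.1, fun z hz => by
        rw [map_add, ha.2 z hz, hb.2 z hz, add_zero]⟩
      zero_mem' := ⟨zero_mem _, fun z _ => map_zero z⟩
      smul_mem' := fun c m hm => ⟨Submodule.smul_mem _ _ hm.1, fun z hz => by
        rw [map_smul, hm.2 z hz, smul_zero]⟩ }
  -- If `I` were nonzero it would generate `M`; but `R` contains `I` and is stable under `N`, so `R`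
  -- would be `M`.
  have hI : I = ⊥ := by
    by_contra hc
    refine hRtop (eq_top_iff.2 ?_)
    rw [← hcl I ?_ ?_ (fun z hz m hm => hm.2 z hz) hc]
    · exact opClosure_le (fun m hm => hm.1) (fun y hy m _ => hRN y hy m)
    · rintro m ⟨hm, hmz⟩
      obtain ⟨a, ha, b, hb, h1, h2, rfl⟩ := hRh m hm
      -- `z a` is odd, `z b` is even and their sum is zero, so both vanish.
      have hab : ∀ z ∈ P, z a = 0 ∧ z b = 0 := by
        intro z hz
        have h3 := hmz z hz
        rw [map_add] at h3
        have h4 : z a ∈ 𝓜 1 := by simpa using hP z hz 0 a ha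
        have h5 : z b ∈ 𝓜 0 := hP z hz 1 b hb
        have h6 : z b = 0 := by
          refine Submodule.disjoint_def.1 h𝓜.disjoint _ h5 ?_
          rw [eq_neg_of_add_eq_zero_right h3]
          exact neg_mem h4
        exact ⟨by rwa [h6, add_zero] at h3, h6⟩
      exact ⟨a, ha, b, hb, ⟨h1, fun z hz => (hab z hz).1⟩, ⟨h2, fun z hz => (hab z hz).2⟩, rfl⟩
    · rintro x hx m ⟨hm, hmz⟩
      refine ⟨hRZ x hx m hm, fun z hz => ?_⟩
      have e : z (x m) = x (z m) - (x * z - z * x) m := by simp [Module.End.mul_apply]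
      rw [e, hmz z hz, hmz _ (h.zero_pos x hx z hz), map_zero, sub_zero]
  have hsum : m ∈ L ⊔ R := by
    have h1 : opClosure N L ≤ L ⊔ R :=
      opClosure_le le_sup_left (fun y hy m _ => Submodule.mem_sup_right (hRN y hy m))
    rw [hcl L hL hLZ hLP hL0] at h1
    exact h1 trivial
  obtain ⟨l, hl, r, hr, rfl⟩ := Submodule.mem_sup.1 hsum
  -- `r` is the difference of the invariants `l + r` and `l`.
  have hrI : r ∈ I := ⟨hr, fun z hz => by
    have := hm z hz
    rwa [map_add, hLP z hz l hl, zero_add] at this⟩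
  rw [hI, Submodule.mem_bot] at hrI
  rw [hrI, add_zero]
  exact hl

end GradedOperators

/-! ### The component `𝔤_{-1}` and the projections of the `ℤ`-grading -/

section NegativePart

variable (K : Type*) [Field K] (T : TypeI)

/-- The component `𝔤_{-1}` of the `ℤ`-grading. -/
def gNeg : Submodule K (T.Mat K) := T.odd K ⊓ supported fun i j => j < i

theorem gNeg_le : T.gNeg K ≤ T.algebra K := fun _ hx => hx.1.1

/-- The matrices of degree `k` with respect to the `ℤ`-grading of the natural module. -/
def HasDeg {K : Type*} [Field K] {T : TypeI} (k : ℤ) (x : T.Mat K) : Prop :=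
  ∀ i j, x i j ≠ 0 → T.deg i = T.deg j + k

variable {K T}

theorem hasDeg_of_gOne {x : T.Mat K} (hx : x ∈ T.gOne K) : HasDeg 1 x :=
  fun _ _ h => gOne_deg K T hx h

theorem hasDeg_of_gNeg {x : T.Mat K} (hx : x ∈ T.gNeg K) : HasDeg (-1) x := by
  intro i j h
  have : T.deg j = T.deg i + 1 := by
    rw [deg_succ_iff]
    constructor
    · intro hc
      exact h (hx.1.2 i j (fun h2 => h2 hc.symm))
    · by_contra hc
      exact h (hx.2 i j hc)
  omega

theorem hasDeg_of_even [NeZero (2 : K)] {x : T.Mat K} (hx : x ∈ T.even K) : HasDeg 0 x :=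
  fun i j h => by rw [add_zero]; exact even_deg K T hx h

theorem HasDeg.mul {x y : T.Mat K} {a b : ℤ} (hx : HasDeg a x) (hy : HasDeg b y) :
    HasDeg (a + b) (x * y) := fun i j h => by
  by_contra hc
  exact h (mul_deg K T hx hy i j hc)

theorem HasDeg.add {x y : T.Mat K} {a : ℤ} (hx : HasDeg a x) (hy : HasDeg a y) :
    HasDeg a (x + y) := fun i j h => by
  by_cases h1 : x i j = 0
  · exact hy i j fun h2 => h (by rw [Matrix.add_apply, h1, h2, add_zero])
  · exact hx i j h1

theorem HasDeg.sub {x y : T.Mat K} {a : ℤ} (hx : HasDeg a x) (hy : HasDeg a y) :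
    HasDeg a (x - y) := fun i j h => by
  by_cases h1 : x i j = 0
  · exact hy i j fun h2 => h (by rw [Matrix.sub_apply, h1, h2, sub_zero])
  · exact hx i j h1

theorem par_eq_of_deg_eq {i j : Fin T.size} (h : T.deg i = T.deg j) : T.par i = T.par j := by
  have hi := i.2
  have hj := j.2
  cases T <;> simp only [deg, par, size] at * <;> split_ifs at h ⊢ <;> first | rfl | omega

theorem mem_gOne_of_hasDeg {x : T.Mat K} (hx : x ∈ T.algebra K) (h : HasDeg 1 x) :
    x ∈ T.gOne K := by
  refine ⟨⟨hx, fun i j hij => ?_⟩, fun i j hij => ?_⟩ <;> by_contra hc <;>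
    have := (T.deg_succ_iff i j).1 (h i j hc)
  · exact hij this.1
  · exact hij this.2

theorem mem_gNeg_of_hasDeg {x : T.Mat K} (hx : x ∈ T.algebra K) (h : HasDeg (-1) x) :
    x ∈ T.gNeg K := by
  refine ⟨⟨hx, fun i j hij => ?_⟩, fun i j hij => ?_⟩ <;> by_contra hc <;>
    have := (T.deg_succ_iff j i).1 (by have := h i j hc; omega)
  · exact hij this.1.symm
  · exact hij this.2

theorem mem_even_of_hasDeg {x : T.Mat K} (hx : x ∈ T.algebra K) (h : HasDeg 0 x) :
    x ∈ T.even K := by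
  refine ⟨hx, fun i j hij => ?_⟩
  by_contra hc
  exact hij (par_eq_of_deg_eq (by simpa using h i j hc))

theorem bracket_even_even_mem {x y : T.Mat K} (hx : x ∈ T.even K) (hy : y ∈ T.even K) :
    x * y - y * x ∈ T.even K :=
  ⟨bracket_even_mem K T hx hy.1,
    Submodule.sub_mem _ (mul_par_mem K T hx.2 hy.2) (mul_par_mem K T hy.2 hx.2)⟩

theorem bracket_gNeg_mem [NeZero (2 : K)] {x y : T.Mat K} (hx : x ∈ T.even K)
    (hy : y ∈ T.gNeg K) : x * y - y * x ∈ T.gNeg K := by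
  refine mem_gNeg_of_hasDeg (bracket_even_mem K T hx hy.1.1) ?_
  have h1 := (hasDeg_of_even hx).mul (hasDeg_of_gNeg hy)
  have h2 := (hasDeg_of_gNeg hy).mul (hasDeg_of_even hx)
  simp only [zero_add, add_zero] at h1 h2
  exact h1.sub h2

theorem bracket_gOne_gNeg_mem {x y : T.Mat K} (hx : x ∈ T.gOne K)
    (hy : y ∈ T.gNeg K) : x * y + y * x ∈ T.even K := by
  refine mem_even_of_hasDeg (bracket_odd_mem K T hx.1 hy.1) ?_
  have h1 := (hasDeg_of_gOne hx).mul (hasDeg_of_gNeg hy)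
  have h2 := (hasDeg_of_gNeg hy).mul (hasDeg_of_gOne hx)
  exact h1.add h2

/-- The anticommutator lies in `𝔤` and has degree `-2`. There are no such matrix entries for `gl`
and `sl`, and for `osp(2|2n)` only the lower left corner, which is zero on `𝔤` by `osp_corner`. -/
theorem gNeg_anticomm [NeZero (2 : K)] {x y : T.Mat K} (hx : x ∈ T.gNeg K) (hy : y ∈ T.gNeg K) :
    x * y + y * x = 0 := by
  have hz := bracket_odd_mem K T hx.1 hy.1
  have hd := ((hasDeg_of_gNeg hx).mul (hasDeg_of_gNeg hy)).add
    ((hasDeg_of_gNeg hy).mul (hasDeg_of_gNeg hx))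
  ext i j
  by_contra hc
  have h := hd i j hc
  cases T with
  | gl m n => simp only [deg] at h; split_ifs at h <;> omega
  | sl m n => simp only [deg] at h; split_ifs at h <;> omega
  | osp n =>
    have h1 : (j : ℕ) = 0 ∧ (i : ℕ) = 2 * n + 1 := by
      simp only [deg] at h
      split_ifs at h <;> omega
    exact hc (osp_corner K hz (by omega) (by simp [par, h1.2]))

/-! The projections to the components of the `ℤ`-grading. -/

/-- The component of degree `k` of a matrix. -/
def degPart (k : ℤ) : T.Mat K →ₗ[K] T.Mat K where
  toFun x := Matrix.of fun i j => if T.deg i = T.deg j + k then x i j else 0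
  map_add' x y := by ext i j; simp only [Matrix.of_apply, Matrix.add_apply]; split_ifs <;> simp
  map_smul' c x := by ext i j; simp only [Matrix.of_apply, Matrix.smul_apply]; split_ifs <;> simp

theorem degPart_apply (k : ℤ) (x : T.Mat K) (i j : Fin T.size) :
    degPart k x i j = if T.deg i = T.deg j + k then x i j else 0 := rfl

theorem hasDeg_degPart (k : ℤ) (x : T.Mat K) : HasDeg k (degPart k x) := by
  intro i j h
  by_contra hc
  exact h (if_neg hc)

theorem degPart_of_hasDeg {k : ℤ} {x : T.Mat K} (h : HasDeg k x) : degPart k x = x := by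
  ext i j
  rw [degPart_apply]
  split_ifs with h1
  · rfl
  · by_contra hc
    exact h1 (h i j (Ne.symm hc))

theorem degPart_of_hasDeg_ne {k l : ℤ} {x : T.Mat K} (h : HasDeg k x) (hl : l ≠ k) :
    degPart l x = 0 := by
  ext i j
  rw [degPart_apply]
  split_ifs with h1
  · by_contra hc
    have := h i j hc
    omega
  · rfl

theorem ospForm_eq_zero {n : ℕ} {i j : Fin (osp n).size} (h : j ≠ i.rev) :
    ospForm K n i j = 0 := by
  rw [ospForm, if_neg]
  intro hc
  refine h (Fin.ext ?_)
  rw [Fin.val_rev]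
  simp only [size]
  omega

theorem transpose_mul_ospForm_apply {n : ℕ} (x : (osp n).Mat K) (i j : Fin (osp n).size) :
    (x.transpose * ospForm K n) i j = x j.rev i * ospForm K n j.rev j := by
  rw [Matrix.mul_apply, Finset.sum_eq_single j.rev]
  · rfl
  · intro b _ hb
    rw [ospForm_eq_zero (fun hc => hb (by rw [hc, Fin.rev_rev])), mul_zero]
  · simp

theorem ospForm_mul_apply {n : ℕ} (x : (osp n).Mat K) (i j : Fin (osp n).size) :
    (ospForm K n * x) i j = ospForm K n i i.rev * x i.rev j := by
  rw [Matrix.mul_apply, Finset.sum_eq_single i.rev]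
  · intro b _ hb
    rw [ospForm_eq_zero hb, zero_mul]
  · simp

theorem deg_rev {n : ℕ} (i : Fin (osp n).size) : (osp n).deg i.rev = - (osp n).deg i := by
  have := i.2
  simp only [deg, Fin.val_rev]
  simp only [size] at *
  split_ifs <;> omega

/-- The equations defining `𝔤` are homogeneous for the degree: the supertrace sees only degree `0`,
and each equation of `osp` links two entries of the same degree, since reversing an index negates
its degree. -/
theorem degPart_mem (k : ℤ) {x : T.Mat K} (hx : x ∈ T.algebra K) : degPart k x ∈ T.algebra K := by
  cases T with
  | gl m n => trivial
  | sl m n =>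
    have hx : str K (sl m n) x = 0 := hx
    change str K (sl m n) _ = 0
    simp only [str, LinearMap.coe_mk, AddHom.coe_mk] at hx ⊢
    by_cases hk : k = 0
    · subst hk
      rw [← hx]
      exact Finset.sum_congr rfl fun i _ => by rw [degPart_apply, if_pos (by simp)]
    · exact Finset.sum_eq_zero fun i _ => by
        rw [degPart_apply, if_neg (by simpa using fun h => hk h), mul_zero]
  | osp n =>
    intro i j
    have h := hx i j
    rw [transpose_mul_ospForm_apply, ospForm_mul_apply] at h ⊢
    rw [degPart_apply, degPart_apply]
    have e : ((osp n).deg j.rev = (osp n).deg i + k) ↔ ((osp n).deg i.rev = (osp n).deg j + k) := by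
      rw [deg_rev, deg_rev]; omega
    by_cases h1 : (osp n).deg i.rev = (osp n).deg j + k
    · rw [if_pos (e.2 h1), if_pos h1]; exact h
    · rw [if_neg (fun h2 => h1 (e.1 h2)), if_neg h1]; simp

/-- Only the two corners for `osp(2|2n)` have a degree outside `{-1, 0, 1}`, and these entries
vanish on `𝔤`. -/
theorem sum_degPart [NeZero (2 : K)] {x : T.Mat K} (hx : x ∈ T.algebra K) :
    degPart (-1) x + degPart 0 x + degPart 1 x = x := by
  ext i j
  rw [Matrix.add_apply, Matrix.add_apply, degPart_apply, degPart_apply, degPart_apply]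
  by_cases h : T.deg i = T.deg j + (-1) ∨ T.deg i = T.deg j + 0 ∨ T.deg i = T.deg j + 1
  · rcases h with h | h | h
    · rw [if_pos h, if_neg (by omega), if_neg (by omega), add_zero, add_zero]
    · rw [if_neg (by omega), if_pos h, if_neg (by omega), zero_add, add_zero]
    · rw [if_neg (by omega), if_neg (by omega), if_pos h, zero_add, zero_add]
  · push Not at h
    rw [if_neg h.1, if_neg h.2.1, if_neg h.2.2, add_zero, add_zero]
    have hi := i.2
    have hj := j.2
    cases T with
    | gl m n => simp only [deg] at h; split_ifs at h <;> omega
    | sl m n => simp only [deg] at h; split_ifs at h <;> omega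
    | osp n =>
      have h1 : (i : ℕ) + j = 2 * n + 1 ∧ (osp n).par i = 0 := by
        simp only [deg, par, size] at *
        split_ifs at h ⊢ <;> first | omega | (refine ⟨?_, rfl⟩; omega)
      exact (osp_corner K hx h1.1 h1.2).symm

/-- The projection `𝔤 → 𝔤_{-1}`. -/
def projNeg : T.algebra K →ₗ[K] T.gNeg K :=
  (degPart (-1) ∘ₗ (T.algebra K).subtype).codRestrict _ fun x =>
    mem_gNeg_of_hasDeg (degPart_mem _ x.2) (hasDeg_degPart _ _)

/-- The projection `𝔤 → 𝔤_0̄`. -/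
def projEven : T.algebra K →ₗ[K] T.even K :=
  (degPart 0 ∘ₗ (T.algebra K).subtype).codRestrict _ fun x =>
    mem_even_of_hasDeg (degPart_mem _ x.2) (hasDeg_degPart _ _)

/-- The projection `𝔤 → 𝔤_1`. -/
def projPos : T.algebra K →ₗ[K] T.gOne K :=
  (degPart 1 ∘ₗ (T.algebra K).subtype).codRestrict _ fun x =>
    mem_gOne_of_hasDeg (degPart_mem _ x.2) (hasDeg_degPart _ _)

theorem exists_parts [NeZero (2 : K)] (x : T.algebra K) :
    (x : T.Mat K) = (projNeg x : T.Mat K) + (projEven x : T.Mat K) + (projPos x : T.Mat K) :=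
  (sum_degPart x.2).symm

/-- Uniqueness of the decomposition; it identifies the components of a bracket once the bracket is
written as a sum of homogeneous terms. -/
theorem proj_eq [NeZero (2 : K)] {x : T.algebra K} {a : T.gNeg K} {b : T.even K} {c : T.gOne K}
    (h : (x : T.Mat K) = a + b + c) : projNeg x = a ∧ projEven x = b ∧ projPos x = c := by
  have ha := hasDeg_of_gNeg a.2
  have hb := hasDeg_of_even b.2
  have hc := hasDeg_of_gOne c.2
  refine ⟨Subtype.ext ?_, Subtype.ext ?_, Subtype.ext ?_⟩
  · change degPart (-1) (x : T.Mat K) = a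
    rw [h, map_add, map_add, degPart_of_hasDeg ha, degPart_of_hasDeg_ne hb (by decide),
      degPart_of_hasDeg_ne hc (by decide), add_zero, add_zero]
  · change degPart 0 (x : T.Mat K) = b
    rw [h, map_add, map_add, degPart_of_hasDeg hb, degPart_of_hasDeg_ne ha (by decide),
      degPart_of_hasDeg_ne hc (by decide), add_zero, zero_add]
  · change degPart 1 (x : T.Mat K) = c
    rw [h, map_add, map_add, degPart_of_hasDeg hc, degPart_of_hasDeg_ne ha (by decide),
      degPart_of_hasDeg_ne hb (by decide), zero_add, zero_add]

theorem proj_of_even [NeZero (2 : K)] {x : T.algebra K} (hx : (x : T.Mat K) ∈ T.even K) :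
    projNeg x = 0 ∧ projEven x = ⟨x, hx⟩ ∧ projPos x = 0 :=
  proj_eq (by simp)

theorem projEven_of_odd {x : T.algebra K} (hx : (x : T.Mat K) ∈ T.odd K) :
    projEven x = 0 := by
  refine Subtype.ext ?_
  ext i j
  change degPart 0 (x : T.Mat K) i j = 0
  rw [degPart_apply]
  split_ifs with h
  · exact hx.2 i j fun h2 => h2 (par_eq_of_deg_eq (by simpa using h))
  · rfl

end NegativePart

/-! ### The brackets between the homogeneous components -/

section Brackets

variable {K : Type*} [Field K] {T : TypeI} [NeZero (2 : K)]

/-- The bracket `𝔤_0̄ × 𝔤_{-1} → 𝔤_{-1}`. -/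
def brEvenNeg : T.even K →ₗ[K] T.gNeg K →ₗ[K] T.gNeg K :=
  LinearMap.mk₂ K (fun x y => ⟨(x : T.Mat K) * y - (y : T.Mat K) * x, bracket_gNeg_mem x.2 y.2⟩)
    (fun x x' y => Subtype.ext (by simp; noncomm_ring))
    (fun c x y => Subtype.ext (by simp [smul_sub]))
    (fun x y y' => Subtype.ext (by simp; noncomm_ring))
    (fun c x y => Subtype.ext (by simp [smul_sub]))

/-- The bracket `𝔤_0̄ × 𝔤_1 → 𝔤_1`. -/
def brEvenPos : T.even K →ₗ[K] T.gOne K →ₗ[K] T.gOne K :=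
  LinearMap.mk₂ K (fun x y => ⟨(x : T.Mat K) * y - (y : T.Mat K) * x, bracket_gOne_mem K T x.2 y.2⟩)
    (fun x x' y => Subtype.ext (by simp; noncomm_ring))
    (fun c x y => Subtype.ext (by simp [smul_sub]))
    (fun x y y' => Subtype.ext (by simp; noncomm_ring))
    (fun c x y => Subtype.ext (by simp [smul_sub]))

/-- The bracket `𝔤_1 × 𝔤_{-1} → 𝔤_0̄`. -/
def brPosNeg : T.gOne K →ₗ[K] T.gNeg K →ₗ[K] T.even K :=
  LinearMap.mk₂ K (fun x y => ⟨(x : T.Mat K) * y + (y : T.Mat K) * x, bracket_gOne_gNeg_mem x.2 y.2⟩)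
    (fun x x' y => Subtype.ext (by simp; noncomm_ring))
    (fun c x y => Subtype.ext (by simp [smul_add]))
    (fun x y y' => Subtype.ext (by simp; noncomm_ring))
    (fun c x y => Subtype.ext (by simp [smul_add]))

theorem coe_brEvenNeg (x : T.even K) (y : T.gNeg K) :
    (brEvenNeg x y : T.Mat K) = (x : T.Mat K) * y - (y : T.Mat K) * x := rfl

theorem coe_brEvenPos (x : T.even K) (y : T.gOne K) :
    (brEvenPos x y : T.Mat K) = (x : T.Mat K) * y - (y : T.Mat K) * x := rfl

theorem coe_brPosNeg (x : T.gOne K) (y : T.gNeg K) :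
    (brPosNeg x y : T.Mat K) = (x : T.Mat K) * y + (y : T.Mat K) * x := rfl

/-- `[[z, y], y'] = - [[z, y'], y]` for `z ∈ 𝔤_1` and `y, y' ∈ 𝔤_{-1}`. -/
theorem brPosNeg_antisymm (z : T.gOne K) (y y' : T.gNeg K) :
    brEvenNeg (brPosNeg z y) y' = - brEvenNeg (brPosNeg z y') y := by
  refine Subtype.ext ?_
  simp only [coe_brEvenNeg, coe_brPosNeg, Submodule.coe_neg]
  have h := gNeg_anticomm y.2 y'.2
  -- By the Jacobi identity the sum of the two iterated brackets is `[z, [y, y']]`, and `[y, y'] =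
  -- 0`.
  have e : (z : T.Mat K) * (y * y' + y' * y : T.Mat K) - (y * y' + y' * y : T.Mat K) * z = 0 := by
    rw [h]; simp
  rw [eq_neg_iff_add_eq_zero, ← e]
  noncomm_ring

end Brackets

/-! ### Modules as spaces of operators; proof of part (1) -/

section Action

variable {K : Type*} [Field K] {T : TypeI}
variable (p : ℕ) (χ : Module.Dual K (T.even K))

/-- The action of `𝔰` on a `U_χ(𝔰)`-module. -/
def act (s : Submodule K (T.Mat K)) (M : Type*) [AddCommGroup M] [Module K M] [Module (U p χ s) M]
    [IsScalarTower K (U p χ s) M] : s →ₗ[K] Module.End K M :=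
  (Algebra.lsmul K K M).toLinearMap ∘ₗ U.of p χ s

variable {s : Submodule K (T.Mat K)} {M : Type*} [AddCommGroup M] [Module K M] [Module (U p χ s) M]

theorem act_apply [IsScalarTower K (U p χ s) M] (x : s) (m : M) :
    act p χ s M x m = U.of p χ s x • m := rfl

variable {p χ} in
/-- A subspace which is stable under `𝔰` is a submodule. -/
def submoduleOfStable [IsScalarTower K (U p χ s) M] (W : Submodule K M)
    (h : ∀ x : s, ∀ m ∈ W, U.of p χ s x • m ∈ W) : Submodule (U p χ s) M where
  carrier := W
  add_mem' := W.add_mem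
  zero_mem' := W.zero_mem
  smul_mem' u m hm := by
    change u • m ∈ W
    induction u using U.induction generalizing m with
    | h0 r => rw [algebraMap_smul]; exact W.smul_mem _ hm
    | h1 x => exact h x m hm
    | h2 a b ha hb => rw [mul_smul]; exact ha _ (hb _ hm)
    | h3 a b ha hb => rw [add_smul]; exact W.add_mem (ha _ hm) (hb _ hm)

variable {p χ} in
/-- The irreducibility of a supermodule in terms of subspaces. -/
theorem IsIrreducibleSupermodule.eq_bot_or_top [IsScalarTower K (U p χ s) M]
    {𝓜 : ZMod 2 → Submodule K M} (h : IsIrreducibleSupermodule p χ s M 𝓜) (W : Submodule K M)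
    (hW : IsHomogeneousSubspace 𝓜 W) (hs : ∀ x : s, ∀ m ∈ W, U.of p χ s x • m ∈ W) :
    W = ⊥ ∨ W = ⊤ := by
  rcases h.eq_bot_or_eq_top (submoduleOfStable W hs) hW with h1 | h1
  · left
    rw [eq_bot_iff]
    intro m hm
    have : m ∈ submoduleOfStable W hs := hm
    rwa [h1, Submodule.mem_bot] at this
  · right
    rw [eq_top_iff]
    intro m _
    have : m ∈ submoduleOfStable W hs := h1 ▸ Submodule.mem_top
    exact this

section Algebra

variable {M : Type*} [AddCommGroup M] [Module K M] [Module (U p χ (T.algebra K)) M]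
  [IsScalarTower K (U p χ (T.algebra K)) M]

variable (M) in
/-- The operators on `M` given by a subspace of `𝔤`. -/
def opSpace {s : Submodule K (T.Mat K)} (h : s ≤ T.algebra K) : Submodule K (Module.End K M) :=
  LinearMap.range (act p χ (T.algebra K) M ∘ₗ Submodule.inclusion h)

theorem act_mem_opSpace {s : Submodule K (T.Mat K)} (h : s ≤ T.algebra K) {x : T.algebra K}
    (hx : (x : T.Mat K) ∈ s) : act p χ (T.algebra K) M x ∈ opSpace p χ M h := ⟨⟨x, hx⟩, rfl⟩

theorem act_even (x y z : T.algebra K) (hx : (x : T.Mat K) ∈ T.even K)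
    (hz : (z : T.Mat K) = (x : T.Mat K) * y - (y : T.Mat K) * x) :
    act p χ (T.algebra K) M x * act p χ (T.algebra K) M y -
      act p χ (T.algebra K) M y * act p χ (T.algebra K) M x = act p χ (T.algebra K) M z := by
  simp only [act, LinearMap.comp_apply, AlgHom.toLinearMap_apply, ← map_mul, ← map_sub]
  rw [U.of_even p χ _ x y z hx hz]

theorem act_odd (x y z : T.algebra K) (hx : (x : T.Mat K) ∈ T.odd K) (hy : (y : T.Mat K) ∈ T.odd K)
    (hz : (z : T.Mat K) = (x : T.Mat K) * y + (y : T.Mat K) * x) :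
    act p χ (T.algebra K) M x * act p χ (T.algebra K) M y +
      act p χ (T.algebra K) M y * act p χ (T.algebra K) M x = act p χ (T.algebra K) M z := by
  simp only [act, LinearMap.comp_apply, AlgHom.toLinearMap_apply, ← map_mul, ← map_add]
  rw [U.of_odd p χ _ x y z hx hy hz]

theorem isGradedAction [NeZero (2 : K)] :
    IsGradedAction (opSpace p χ M even_le) (opSpace p χ M gOne_le) (opSpace p χ M (gNeg_le K T)) where
  zero_pos := by
    rintro _ ⟨x, rfl⟩ _ ⟨z, rfl⟩
    have h := bracket_gOne_mem K T x.2 z.2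
    exact ⟨⟨_, h⟩, (act_even p χ _ _ (Submodule.inclusion gOne_le ⟨_, h⟩) x.2 rfl).symm⟩
  zero_neg := by
    rintro _ ⟨x, rfl⟩ _ ⟨z, rfl⟩
    have h := bracket_gNeg_mem x.2 z.2
    exact ⟨⟨_, h⟩, (act_even p χ _ _ (Submodule.inclusion (gNeg_le K T) ⟨_, h⟩) x.2 rfl).symm⟩
  pos_neg := by
    rintro _ ⟨x, rfl⟩ _ ⟨z, rfl⟩
    have h := bracket_gOne_gNeg_mem x.2 z.2
    exact ⟨⟨_, h⟩, (act_odd p χ _ _ (Submodule.inclusion even_le ⟨_, h⟩) x.2.1 z.2.1 rfl).symm⟩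
  pos_pos := by
    rintro _ ⟨x, rfl⟩ _ ⟨z, rfl⟩
    rw [LinearMap.comp_apply, LinearMap.comp_apply, act_odd p χ _ _ 0 x.2.1 z.2.1
      (gOne_anticomm K T x.2 z.2).symm, map_zero]
  neg_neg := by
    rintro _ ⟨x, rfl⟩ _ ⟨z, rfl⟩
    rw [LinearMap.comp_apply, LinearMap.comp_apply, act_odd p χ _ _ 0 x.2.1 z.2.1
      (gNeg_anticomm x.2 z.2).symm, map_zero]
  pos_fg := by
    rw [opSpace, LinearMap.range_eq_map]
    exact (Module.Finite.fg_top).map _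
  neg_fg := by
    rw [opSpace, LinearMap.range_eq_map]
    exact (Module.Finite.fg_top).map _

theorem of_smul_mem_of_stable [NeZero (2 : K)] {W : Submodule K M}
    (hZ : ∀ x ∈ opSpace p χ M even_le, ∀ m ∈ W, x m ∈ W)
    (hP : ∀ x ∈ opSpace p χ M gOne_le, ∀ m ∈ W, x m ∈ W)
    (hN : ∀ x ∈ opSpace p χ M (gNeg_le K T), ∀ m ∈ W, x m ∈ W) (x : T.algebra K) {m : M}
    (hm : m ∈ W) : U.of p χ (T.algebra K) x • m ∈ W := by
  have e : x = Submodule.inclusion (gNeg_le K T) (projNeg x) +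
      Submodule.inclusion even_le (projEven x) + Submodule.inclusion gOne_le (projPos x) :=
    Subtype.ext (exists_parts x)
  rw [e, map_add, map_add, add_smul, add_smul]
  exact add_mem (add_mem (hN _ ⟨_, rfl⟩ m hm) (hZ _ ⟨_, rfl⟩ m hm)) (hP _ ⟨_, rfl⟩ m hm)

theorem coe_smul_invariants [NeZero (2 : K)] (x : T.even K) (m : invariants p χ M) :
    ((U.of p χ (T.even K) x • m : invariants p χ M) : M) =
      U.of p χ (T.algebra K) (Submodule.inclusion even_le x) • (m : M) := by
  change U.incl p χ even_le (U.of p χ (T.even K) x) • (m : M) = _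
  rw [U.incl_of]

instance [NeZero (2 : K)] : IsScalarTower K (U p χ (T.even K)) (invariants p χ M) where
  smul_assoc c u m := Subtype.ext (by
    change U.incl p χ even_le (c • u) • (m : M) = c • (U.incl p χ even_le u • (m : M))
    rw [map_smul, smul_assoc])

variable {p χ} in
theorem IsSupermodule.exists_add {𝓜 : ZMod 2 → Submodule K M}
    (h : IsSupermodule p χ (T.algebra K) M 𝓜) (m : M) : ∃ a ∈ 𝓜 0, ∃ b ∈ 𝓜 1, a + b = m := by
  simpa using Submodule.mem_sup.1 (h.isCompl.sup_eq_top ▸ Submodule.mem_top (x := m))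

/-- The invariants of an irreducible `U_χ(𝔤)`-supermodule form an irreducible
`U_χ(𝔤_0̄)`-supermodule. -/
theorem isIrreducibleSupermodule_invariants [NeZero (2 : K)] {𝓜 : ZMod 2 → Submodule K M}
    (h : IsIrreducibleSupermodule p χ (T.algebra K) M 𝓜) :
    IsIrreducibleSupermodule p χ (T.even K) (invariants p χ M) (invariantsGrading p χ 𝓜) := by
  have := h.nontrivial
  have hdisj := Submodule.disjoint_def.1 h.isCompl.disjoint
  refine { isCompl := ⟨?_, ?_⟩, even_smul_mem := ?_, odd_smul_mem := ?_, nontrivial := ?_,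
           eq_bot_or_eq_top := ?_ }
  · rw [Submodule.disjoint_def]
    exact fun m h0 h1 => Subtype.ext (hdisj _ h0 h1)
  · rw [codisjoint_iff, eq_top_iff]
    rintro ⟨m, hm⟩ -
    obtain ⟨a, ha, b, hb, rfl⟩ := h.exists_add m
    have hab : ∀ y : T.gOne K,
        U.of p χ (T.algebra K) (Submodule.inclusion gOne_le y) • a = 0 ∧
        U.of p χ (T.algebra K) (Submodule.inclusion gOne_le y) • b = 0 := by
      intro y
      have h1 := hm y
      rw [smul_add] at h1
      have h2 : U.of p χ (T.algebra K) (Submodule.inclusion gOne_le y) • a ∈ 𝓜 1 := by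
        simpa using h.odd_smul_mem (Submodule.inclusion gOne_le y) y.2.1 0 a ha
      have h3 : U.of p χ (T.algebra K) (Submodule.inclusion gOne_le y) • b ∈ 𝓜 0 :=
        h.odd_smul_mem (Submodule.inclusion gOne_le y) y.2.1 1 b hb
      have h4 := hdisj _ h3 (by rw [eq_neg_of_add_eq_zero_right h1]; exact neg_mem h2)
      exact ⟨by rwa [h4, add_zero] at h1, h4⟩
    exact Submodule.mem_sup.2 ⟨⟨a, fun y => (hab y).1⟩, ha, ⟨b, fun y => (hab y).2⟩, hb, rfl⟩
  · intro x hx i m hm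
    change ((U.of p χ (T.even K) x • m : invariants p χ M) : M) ∈ 𝓜 i
    rw [coe_smul_invariants]
    exact h.even_smul_mem (Submodule.inclusion even_le x) x.2 i m hm
  · intro x hx i m _
    -- `𝔤_0̄` contains no nonzero odd element, so oddness imposes no condition.
    have hx0 : x = 0 := by
      refine Subtype.ext ?_
      have h1 := evenPart_even x.2
      rw [evenPart_odd hx] at h1
      exact h1.symm
    rw [hx0, map_zero, zero_smul]
    exact zero_mem _
  · obtain ⟨m, hm, hm0⟩ := (isGradedAction (M := M) p χ).exists_invariant
    exact ⟨⟨⟨m, fun y => hm0 _ ⟨y, rfl⟩⟩, 0, fun hc => hm (congrArg Subtype.val hc)⟩⟩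
  · intro N hN
    by_cases hN0 : N = ⊥
    · exact Or.inl hN0
    right
    -- `N` seen inside `M`: a nonzero homogeneous `𝔤_0̄`-stable space of invariants, which must
    -- therefore contain all of them.
    let W : Submodule K M :=
      { carrier := {m | ∃ n ∈ N, (n : M) = m}
        add_mem' := by
          rintro _ _ ⟨a, ha, rfl⟩ ⟨b, hb, rfl⟩
          exact ⟨a + b, add_mem ha hb, rfl⟩
        zero_mem' := ⟨0, zero_mem _, rfl⟩
        smul_mem' := by
          rintro c _ ⟨a, ha, rfl⟩
          refine ⟨c • a, ?_, rfl⟩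
          rw [← algebraMap_smul (U p χ (T.even K)) c a]
          exact N.smul_mem _ ha }
    rw [eq_top_iff]
    intro m _
    have hmW : (m : M) ∈ W := by
      refine (isGradedAction (M := M) p χ).mem_of_invariant 𝓜 h.isCompl ?_ ?_ ?_ (L := W) ?_ ?_ ?_ ?_ ?_
      · rintro _ ⟨z, rfl⟩ i n hn
        exact h.odd_smul_mem (Submodule.inclusion gOne_le z) z.2.1 i n hn
      · rintro _ ⟨z, rfl⟩ i n hn
        exact h.odd_smul_mem (Submodule.inclusion (gNeg_le K T) z) z.2.1 i n hn
      · exact fun V hV h1 h2 h3 => h.eq_bot_or_top V hV fun x n hn =>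
          of_smul_mem_of_stable p χ h1 h2 h3 x hn
      · rintro _ ⟨n, hn, rfl⟩
        obtain ⟨a, ha, b, hb, h1, h2, rfl⟩ := hN n hn
        exact ⟨a, ha, b, hb, ⟨a, h1, rfl⟩, ⟨b, h2, rfl⟩, rfl⟩
      · rintro _ ⟨x, rfl⟩ _ ⟨n, hn, rfl⟩
        exact ⟨U.of p χ (T.even K) x • n, N.smul_mem _ hn, coe_smul_invariants p χ x n⟩
      · rintro _ ⟨z, rfl⟩ _ ⟨n, hn, rfl⟩
        exact n.2 z
      · obtain ⟨n, hn, hn0⟩ := N.ne_bot_iff.1 hN0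
        exact W.ne_bot_iff.2 ⟨n, ⟨n, hn, rfl⟩, fun hc => hn0 (Subtype.ext hc)⟩
      · rintro _ ⟨z, rfl⟩
        exact m.2 z
    obtain ⟨n, hn, hnm⟩ := hmW
    rwa [← Subtype.ext hnm]

end Algebra

end Action

/-! ### Multiplication and contraction operators on `Λ(V) ⊗ L` -/

section WedgeOperators

variable (K : Type*) [Field K] (V : Type*) [AddCommGroup V] [Module K V]
  (L : Type*) [AddCommGroup L] [Module K L]

/-- The space `Λ(V) ⊗ L`. -/
abbrev WedgeTensor : Type _ := ExteriorAlgebra K V ⊗[K] L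

variable {K V}

/-- Left multiplication by `v ∈ V` on `Λ(V) ⊗ L`. -/
def wedgeMul : V →ₗ[K] Module.End K (WedgeTensor K V L) :=
  LinearMap.rTensorHom L ∘ₗ (LinearMap.mul K (ExteriorAlgebra K V)) ∘ₗ ExteriorAlgebra.ι K

/-- Contraction by a linear form on `Λ(V) ⊗ L`. -/
def wedgeContract (d : Module.Dual K V) : Module.End K (WedgeTensor K V L) :=
  (CliffordAlgebra.contractLeft (Q := (0 : QuadraticForm K V)) d).rTensor L

variable (V) {L} in
/-- The action of an operator on `L` on `Λ(V) ⊗ L`. -/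
def wedgeRight : Module.End K L →ₗ[K] Module.End K (WedgeTensor K V L) :=
  LinearMap.lTensorHom (ExteriorAlgebra K V)

variable {L}

theorem wedgeMul_tmul (v : V) (a : ExteriorAlgebra K V) (l : L) :
    wedgeMul L v (a ⊗ₜ l) = (ExteriorAlgebra.ι K v * a) ⊗ₜ l := rfl

theorem wedgeContract_tmul (d : Module.Dual K V) (a : ExteriorAlgebra K V) (l : L) :
    wedgeContract L d (a ⊗ₜ l) =
      (CliffordAlgebra.contractLeft (Q := (0 : QuadraticForm K V)) d a) ⊗ₜ l := rfl

/-- Contraction is an antiderivation: `d ⌋ (v ∧ a) = d(v) a - v ∧ (d ⌋ a)`. -/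
theorem wedgeContract_mul_wedgeMul (d : Module.Dual K V) (v : V) :
    wedgeContract L d * wedgeMul L v + wedgeMul L v * wedgeContract L d =
      d v • (1 : Module.End K (WedgeTensor K V L)) := by
  refine TensorProduct.ext' fun a l => ?_
  rw [LinearMap.add_apply, Module.End.mul_apply, Module.End.mul_apply, wedgeMul_tmul,
    wedgeContract_tmul, wedgeContract_tmul, wedgeMul_tmul, LinearMap.smul_apply,
    Module.End.one_apply]
  have h := CliffordAlgebra.contractLeft_ι_mul (Q := (0 : QuadraticForm K V)) d v a
  have h' : CliffordAlgebra.contractLeft (Q := (0 : QuadraticForm K V)) d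
      (ExteriorAlgebra.ι K v * a) = d v • a - ExteriorAlgebra.ι K v *
        CliffordAlgebra.contractLeft (Q := (0 : QuadraticForm K V)) d a := h
  rw [h', TensorProduct.sub_tmul, TensorProduct.smul_tmul']
  abel

theorem wedgeMul_mul_wedgeMul (v w : V) :
    wedgeMul L v * wedgeMul L w + wedgeMul L w * wedgeMul L v =
      (0 : Module.End K (WedgeTensor K V L)) := by
  refine TensorProduct.ext' fun a l => ?_
  rw [LinearMap.add_apply, Module.End.mul_apply, Module.End.mul_apply, wedgeMul_tmul,
    wedgeMul_tmul, wedgeMul_tmul, wedgeMul_tmul, ← TensorProduct.add_tmul, ← mul_assoc, ← mul_assoc,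
    ← add_mul, ExteriorAlgebra.ι_add_mul_swap, zero_mul]
  exact TensorProduct.zero_tmul _ _

theorem wedgeRight_mul_wedgeMul (g : Module.End K L) (v : V) :
    wedgeRight V g * wedgeMul L v = wedgeMul L v * wedgeRight V g :=
  TensorProduct.ext' fun _ _ => rfl

/-- An operator on `Λ(V) ⊗ L` whose kernel contains `1 ⊗ L` and is stable under multiplication by
elements of `V` is zero. -/
theorem eq_zero_of_wedgeMul (D : Module.End K (WedgeTensor K V L)) (h1 : ∀ l, D (1 ⊗ₜ l) = 0)
    (h2 : ∀ v e, D e = 0 → D (wedgeMul L v e) = 0) : D = 0 := by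
  -- The elements whose left multiplication preserves `ker D` form a subalgebra containing `V`,
  -- hence all of `Λ(V)`; applied to `1 ⊗ l` they give every pure tensor.
  have key : ∀ (a : ExteriorAlgebra K V) (e : WedgeTensor K V L), D e = 0 →
      D ((LinearMap.mulLeft K a).rTensor L e) = 0 := by
    intro a
    induction a using ExteriorAlgebra.induction with
    | algebraMap r =>
      intro e he
      have : (LinearMap.mulLeft K (algebraMap K (ExteriorAlgebra K V) r)).rTensor L = r • 1 := by
        refine TensorProduct.ext' fun a l => ?_
        rw [LinearMap.rTensor_tmul, LinearMap.mulLeft_apply, ← Algebra.smul_def,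
          ← TensorProduct.smul_tmul']
        rfl
      rw [this, LinearMap.smul_apply, map_smul, Module.End.one_apply, he, smul_zero]
    | ι v => exact h2 v
    | mul a b ha hb =>
      intro e he
      have : (LinearMap.mulLeft K (a * b)).rTensor L =
          (LinearMap.mulLeft K a).rTensor L ∘ₗ (LinearMap.mulLeft K b).rTensor L := by
        rw [← LinearMap.rTensor_comp, LinearMap.mulLeft_mul]
      rw [this]
      exact ha _ (hb e he)
    | add a b ha hb =>
      intro e he
      have : (LinearMap.mulLeft K (a + b)).rTensor L =
          (LinearMap.mulLeft K a).rTensor L + (LinearMap.mulLeft K b).rTensor L := by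
        rw [← LinearMap.rTensor_add]
        congr 1
        ext; simp [add_mul]
      rw [this, LinearMap.add_apply, map_add, ha e he, hb e he, add_zero]
  refine TensorProduct.ext' fun a l => ?_
  have := key a (1 ⊗ₜ l) (h1 l)
  rwa [LinearMap.rTensor_tmul, LinearMap.mulLeft_apply, mul_one] at this

theorem wedgeContract_one_tmul (d : Module.Dual K V) (l : L) :
    wedgeContract L d ((1 : ExteriorAlgebra K V) ⊗ₜ l) = 0 := by
  rw [wedgeContract_tmul]
  have : CliffordAlgebra.contractLeft (Q := (0 : QuadraticForm K V)) d 1 = 0 :=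
    CliffordAlgebra.contractLeft_one (Q := (0 : QuadraticForm K V)) d
  erw [this]
  exact TensorProduct.zero_tmul _ _

/-- The augmentation `Λ(V) → K` gives a left inverse of `l ↦ 1 ⊗ l`. -/
theorem one_tmul_eq_zero {l : L} (h : (1 : ExteriorAlgebra K V) ⊗ₜ[K] l = 0) : l = 0 := by
  have := congrArg (TensorProduct.lid K L ∘
    (ExteriorAlgebra.algebraMapInv (R := K) (M := V)).toLinearMap.rTensor L) h
  simpa using this

end WedgeOperators

/-- A space `E` with operators which satisfy the commutation relations of the operators on
`Λ(V) ⊗ L`. -/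
structure WedgeModel (K V L E : Type*) [Field K] [AddCommGroup V] [Module K V] [AddCommGroup L]
    [Module K L] [AddCommGroup E] [Module K E] where
  mul : V →ₗ[K] Module.End K E
  contract : Module.Dual K V → Module.End K E
  right : Module.End K L →ₗ[K] Module.End K E
  one : L →ₗ[K] E
  contract_mul : ∀ d v, contract d * mul v + mul v * contract d = d v • 1
  mul_mul : ∀ v w, mul v * mul w + mul w * mul v = 0
  right_mul : ∀ g v, right g * mul v = mul v * right g
  right_one : ∀ g l, right g (one l) = one (g l)
  contract_one : ∀ d l, contract d (one l) = 0
  one_injective : ∀ l, one l = 0 → l = 0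
  eq_zero : ∀ D : Module.End K E, (∀ l, D (one l) = 0) →
    (∀ v e, D e = 0 → D (mul v e) = 0) → D = 0

namespace WedgeModel

variable {K V L E : Type*} [Field K] [AddCommGroup V] [Module K V] [AddCommGroup L]
  [Module K L] [AddCommGroup E] [Module K E] (W : WedgeModel K V L E)

/-- The principle behind all relations of the Kac module: `Λ(V) ⊗ L` is generated by `1 ⊗ L` under
multiplications, so a relation between operators can be checked on `1 ⊗ L` and on commutators or
anticommutators with multiplications. -/
theorem eq_zero_of_commute (D : Module.End K E) (h1 : ∀ l, D (W.one l) = 0)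
    (h2 : ∀ v, D * W.mul v = W.mul v * D) : D = 0 :=
  W.eq_zero D h1 fun v e he => by
    have := LinearMap.congr_fun (h2 v) e
    rw [Module.End.mul_apply, Module.End.mul_apply, he, map_zero] at this
    exact this

theorem eq_zero_of_anticommute (D : Module.End K E) (h1 : ∀ l, D (W.one l) = 0)
    (h2 : ∀ v, D * W.mul v = - (W.mul v * D)) : D = 0 :=
  W.eq_zero D h1 fun v e he => by
    have := LinearMap.congr_fun (h2 v) e
    rw [Module.End.mul_apply, LinearMap.neg_apply, Module.End.mul_apply, he, map_zero,
      neg_zero] at this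
    exact this

end WedgeModel

/-- The operators on `Λ(V) ⊗ L`. -/
noncomputable def wedgeModel (K V L : Type*) [Field K] [AddCommGroup V] [Module K V]
    [AddCommGroup L] [Module K L] : WedgeModel K V L (WedgeTensor K V L) where
  mul := wedgeMul L
  contract := wedgeContract L
  right := wedgeRight V
  one := TensorProduct.mk K (ExteriorAlgebra K V) L 1
  contract_mul := wedgeContract_mul_wedgeMul
  mul_mul := wedgeMul_mul_wedgeMul
  right_mul := wedgeRight_mul_wedgeMul
  right_one _ _ := rfl
  contract_one := wedgeContract_one_tmul
  one_injective _ h := one_tmul_eq_zero (V := V) h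
  eq_zero := eq_zero_of_wedgeMul

/-- The `p`-th power of an inner derivation in characteristic `p`. -/
theorem iterate_commutator {K : Type*} [Field K] (p : ℕ) [Fact p.Prime] [CharP K p] {A : Type*}
    [Ring A] [Algebra K A] (a b : A) : (fun z => a * z - z * a)^[p] b = a ^ p * b - b * a ^ p := by
  cases subsingleton_or_nontrivial A
  · exact Subsingleton.elim _ _
  have hc : CharP (Module.End K A) p := charP_of_injective_algebraMap
    (algebraMap K (Module.End K A)).injective p
  -- Left and right multiplication by `a` commute, so in characteristic `p` the `p`-th power of
  -- their difference is the difference of their `p`-th powers.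
  have h := sub_pow_char_of_commute (R := Module.End K A) (p := p) (x := LinearMap.mulLeft K a)
    (y := LinearMap.mulRight K a) (LinearMap.commute_mulLeft_right a a)
  rw [LinearMap.pow_mulLeft, LinearMap.pow_mulRight] at h
  have h2 := LinearMap.congr_fun h b
  rw [Module.End.pow_apply] at h2
  exact h2

/-! ### The Kac module `Λ(𝔤_{-1}) ⊗ L` and the injectivity of `L → ψ(L)` -/

section KacModule

variable {K : Type*} [Field K] {T : TypeI}
-- Expansion of `y` in a basis, pushed through `F`. It collapses the basis sums in the formulas for
-- the action.
theorem sum_coord {X : Type*} [AddCommGroup X] [Module K X] (F : T.gNeg K →ₗ[K] X)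
    (y : T.gNeg K) : ∑ i, (Module.finBasis K (T.gNeg K)).coord i y • F (Module.finBasis K _ i) =
      F y := by
  conv_rhs => rw [← (Module.finBasis K (T.gNeg K)).sum_repr y, map_sum]
  simp only [map_smul, Module.Basis.coord_apply]

variable (p : ℕ) (χ : Module.Dual K (T.even K))
variable {L : Type*} [AddCommGroup L] [Module K L] [Module (U p χ (T.even K)) L]
  [IsScalarTower K (U p χ (T.even K)) L] {E : Type*} [AddCommGroup E] [Module K E]
  (W : WedgeModel K (T.gNeg K) L E)

/-- Contraction by the `i`-th vector of the dual of a basis of `𝔤_{-1}`. -/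
noncomputable def kacContract (i : Fin (Module.finrank K (T.gNeg K))) :
    Module.End K E :=
  W.contract ((Module.finBasis K (T.gNeg K)).coord i)

variable [NeZero (2 : K)]

/-- The action of `𝔤_0̄` on `Λ(𝔤_{-1}) ⊗ L`. -/
noncomputable def kacEven : T.even K →ₗ[K] Module.End K E :=
  ∑ i, LinearMap.mulRight K (kacContract W i) ∘ₗ W.mul ∘ₗ
    brEvenNeg.flip (Module.finBasis K (T.gNeg K) i) +
  W.right ∘ₗ act p χ (T.even K) L

/-- The action of `𝔤_1` on `Λ(𝔤_{-1}) ⊗ L`. -/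
noncomputable def kacPos : T.gOne K →ₗ[K] Module.End K E :=
  ∑ i, LinearMap.mulRight K (kacContract W i) ∘ₗ W.right ∘ₗ act p χ (T.even K) L ∘ₗ
    brPosNeg.flip (Module.finBasis K (T.gNeg K) i) +
  (2 : K)⁻¹ • ∑ i, ∑ j, LinearMap.mulRight K (kacContract W j * kacContract W i) ∘ₗ W.mul ∘ₗ
    brEvenNeg.flip (Module.finBasis K (T.gNeg K) j) ∘ₗ
    brPosNeg.flip (Module.finBasis K (T.gNeg K) i)

/-- The sum is the derivation of `Λ(𝔤_{-1})` that extends `ad x`; the last term is the action on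
`L`. -/
theorem kacEven_apply (x : T.even K) : kacEven p χ W x =
    ∑ i, W.mul (brEvenNeg x (Module.finBasis K (T.gNeg K) i)) * kacContract W i +
      W.right (act p χ (T.even K) L x) := by
  simp [kacEven]

/-- Moving `z` through a product of elements of `𝔤_{-1}` towards `L` creates a bracket `[z, y_i]` at
each place. This in turn moves to the right, creating `[[z, y_i], y_j]` on the way and acting on `L`
at the end. Both the double brackets and the products of two contractions are antisymmetric in `i`
and `j`, so the sum over pairs is half of the sum over all `i` and `j`, without reference to an
order. -/
theorem kacPos_apply (z : T.gOne K) : kacPos p χ W z =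
    ∑ i, W.right (act p χ (T.even K) L
      (brPosNeg z (Module.finBasis K (T.gNeg K) i))) * kacContract W i +
    (2 : K)⁻¹ • ∑ i, ∑ j, W.mul (brEvenNeg (brPosNeg z (Module.finBasis K (T.gNeg K) i))
      (Module.finBasis K (T.gNeg K) j)) * (kacContract W j * kacContract W i) := by
  simp [kacPos, mul_assoc]

theorem kacContract_mul (i : Fin (Module.finrank K (T.gNeg K))) (y : T.gNeg K) :
    kacContract W i * W.mul y =
      (Module.finBasis K (T.gNeg K)).coord i y • (1 : Module.End K E) -
        W.mul y * kacContract W i :=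
  eq_sub_of_add_eq (W.contract_mul _ _)

theorem kacEven_mul (x : T.even K) (y : T.gNeg K) :
    kacEven p χ W x * W.mul y - W.mul y * kacEven p χ W x =
      W.mul (brEvenNeg x y) := by
  rw [kacEven_apply, add_mul, mul_add, W.right_mul, add_sub_add_right_eq_sub,
    Finset.sum_mul, Finset.mul_sum, ← Finset.sum_sub_distrib]
  have h := sum_coord (W.mul ∘ₗ brEvenNeg x) y
  simp only [LinearMap.comp_apply] at h
  rw [← h]
  refine Finset.sum_congr rfl fun i _ => ?_
  rw [mul_assoc, kacContract_mul, mul_sub, ← mul_assoc, ← mul_assoc,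
    eq_neg_of_add_eq_zero_left (W.mul_mul y _), mul_smul_comm, mul_one]
  noncomm_ring

theorem kacPos_mul (z : T.gOne K) (y : T.gNeg K) :
    kacPos p χ W z * W.mul y + W.mul y * kacPos p χ W z =
      kacEven p χ W (brPosNeg z y) := by
  set b := Module.finBasis K (T.gNeg K) with hb
  -- The first-order terms give the `L`-part of the action of `[z, y]`.
  have h1 : ∑ i, W.right (act p χ (T.even K) L (brPosNeg z (b i))) *
        kacContract W i * W.mul y +
      W.mul y * ∑ i, W.right (act p χ (T.even K) L (brPosNeg z (b i))) *
        kacContract W i = W.right (act p χ (T.even K) L (brPosNeg z y)) := by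
    have h := sum_coord (W.right ∘ₗ act p χ (T.even K) L ∘ₗ brPosNeg z) y
    simp only [LinearMap.comp_apply] at h
    rw [← h, Finset.mul_sum, ← Finset.sum_add_distrib]
    refine Finset.sum_congr rfl fun i _ => ?_
    rw [← mul_assoc, ← W.right_mul, mul_assoc, mul_assoc, ← mul_add,
      kacContract_mul, sub_add_cancel, mul_smul_comm, mul_one]
  have h2 : ∀ i j, W.mul (brEvenNeg (brPosNeg z (b i)) (b j)) *
        (kacContract W j * kacContract W i) * W.mul y +
      W.mul y * (W.mul (brEvenNeg (brPosNeg z (b i)) (b j)) *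
        (kacContract W j * kacContract W i)) =
      b.coord i y • (W.mul (brEvenNeg (brPosNeg z (b i)) (b j)) * kacContract W j) -
      b.coord j y • (W.mul (brEvenNeg (brPosNeg z (b i)) (b j)) * kacContract W i) := by
    intro i j
    rw [← mul_assoc (W.mul y), eq_neg_of_add_eq_zero_left (W.mul_mul y _),
      mul_assoc, mul_assoc (kacContract W j), kacContract_mul, mul_sub, mul_smul_comm, mul_one,
      ← mul_assoc (kacContract W j), kacContract_mul, sub_mul, smul_mul_assoc, one_mul,
      mul_sub, mul_sub, mul_smul_comm, mul_smul_comm]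
    noncomm_ring
  -- The two sums from `h2` are equal because `[[z, b_i], y] = -[[z, y], b_i]`; the resulting factor
  -- `2` cancels the `2⁻¹` in the action of `z`.
  have h3 : ∑ i, ∑ j, (W.mul (brEvenNeg (brPosNeg z (b i)) (b j)) *
        (kacContract W j * kacContract W i) * W.mul y +
      W.mul y * (W.mul (brEvenNeg (brPosNeg z (b i)) (b j)) *
        (kacContract W j * kacContract W i))) =
      (2 : K) • ∑ j, W.mul (brEvenNeg (brPosNeg z y) (b j)) * kacContract W j := by
    simp only [h2, Finset.sum_sub_distrib]
    rw [Finset.sum_comm, two_smul, sub_eq_add_neg]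
    congr 1
    · refine Finset.sum_congr rfl fun j _ => ?_
      have h := sum_coord (LinearMap.mulRight K (kacContract W j) ∘ₗ W.mul ∘ₗ
        brEvenNeg.flip (b j) ∘ₗ brPosNeg z) y
      simpa using h
    · rw [← Finset.sum_neg_distrib]
      refine Finset.sum_congr rfl fun i _ => ?_
      have h := sum_coord (LinearMap.mulRight K (kacContract W i) ∘ₗ W.mul ∘ₗ
        brEvenNeg (brPosNeg z (b i))) y
      simp only [LinearMap.comp_apply, LinearMap.mulRight_apply] at h
      rw [h, brPosNeg_antisymm z (b i) y, map_neg, neg_mul, neg_neg]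
  rw [kacPos_apply, kacEven_apply, ← hb, add_mul, mul_add, smul_mul_assoc, mul_smul_comm]
  have e : ∀ a b c d : Module.End K E,
      a + b + (c + d) = (a + c) + (b + d) := fun a b c d => by abel
  rw [e, Finset.sum_mul, h1, ← smul_add, Finset.sum_mul, Finset.mul_sum, ← Finset.sum_add_distrib]
  simp only [Finset.sum_mul, Finset.mul_sum, ← Finset.sum_add_distrib] at h3 ⊢
  rw [h3, smul_smul, inv_mul_cancel₀ (NeZero.ne _), one_smul, add_comm]

theorem kacEven_one (x : T.even K) (l : L) :
    kacEven p χ W x (W.one l) = W.one (U.of p χ (T.even K) x • l) := by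
  rw [kacEven_apply, LinearMap.add_apply, LinearMap.sum_apply, Finset.sum_eq_zero, zero_add]
  · exact W.right_one _ _
  · intro i _
    rw [Module.End.mul_apply, kacContract, W.contract_one, map_zero]

theorem kacPos_one (z : T.gOne K) (l : L) : kacPos p χ W z (W.one l) = 0 := by
  rw [kacPos_apply, LinearMap.add_apply, LinearMap.sum_apply, Finset.sum_eq_zero, zero_add,
    LinearMap.smul_apply, LinearMap.sum_apply, Finset.sum_eq_zero, smul_zero]
  · intro i _
    rw [LinearMap.sum_apply, Finset.sum_eq_zero]
    intro j _
    rw [Module.End.mul_apply, Module.End.mul_apply, kacContract, kacContract,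
      W.contract_one, map_zero, map_zero]
  · intro i _
    rw [Module.End.mul_apply, kacContract, W.contract_one, map_zero]

/-- On `1 ⊗ L` this is the module structure of `L`, and on commutators with multiplications it is
the Jacobi identity in `𝔤_{-1}`. -/
theorem kacEven_kacEven (x x' z : T.even K)
    (hz : (z : T.Mat K) = (x : T.Mat K) * x' - (x' : T.Mat K) * x) :
    kacEven p χ W x * kacEven p χ W x' - kacEven p χ W x' * kacEven p χ W x = kacEven p χ W z := by
  rw [← sub_eq_zero]
  refine W.eq_zero_of_commute _ (fun l => ?_) fun y => ?_
  · simp only [LinearMap.sub_apply, Module.End.mul_apply, kacEven_one, smul_smul]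
    rw [← map_sub, ← map_sub, ← sub_smul, ← sub_smul,
      U.of_even p χ _ x x' z x.2 hz, sub_self, zero_smul, map_zero]
  · have h1 : ∀ x : T.even K, ∀ y, kacEven p χ W x * W.mul y =
        W.mul y * kacEven p χ W x + W.mul (brEvenNeg x y) := fun x y =>
      eq_add_of_sub_eq' (kacEven_mul p χ W x y)
    have hJ : brEvenNeg x (brEvenNeg x' y) - brEvenNeg x' (brEvenNeg x y) = brEvenNeg z y := by
      refine Subtype.ext ?_
      simp only [Submodule.coe_sub, coe_brEvenNeg, hz]
      noncomm_ring
    rw [sub_mul, sub_mul, mul_assoc, mul_assoc, h1 x', h1 x, mul_add, mul_add, ← mul_assoc,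
      ← mul_assoc, h1 x, h1 x', h1 x, h1 x', h1 z, ← hJ, map_sub]
    noncomm_ring

/-- Both sides vanish on `1 ⊗ L`. Anticommutators with multiplications land in the action of `𝔤_0̄`,
so the claim reduces to `kacEven_kacEven`. -/
theorem kacEven_kacPos (x : T.even K) (z w : T.gOne K)
    (hw : (w : T.Mat K) = (x : T.Mat K) * z - (z : T.Mat K) * x) :
    kacEven p χ W x * kacPos p χ W z - kacPos p χ W z * kacEven p χ W x = kacPos p χ W w := by
  rw [← sub_eq_zero]
  refine W.eq_zero_of_anticommute _ (fun l => ?_) fun y => ?_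
  · simp only [LinearMap.sub_apply, Module.End.mul_apply, kacEven_one, kacPos_one,
      map_zero, sub_self]
  · have h1 : ∀ x : T.even K, ∀ y, kacEven p χ W x * W.mul y =
        W.mul y * kacEven p χ W x + W.mul (brEvenNeg x y) := fun x y =>
      eq_add_of_sub_eq' (kacEven_mul p χ W x y)
    have h2 : ∀ z : T.gOne K, ∀ y, kacPos p χ W z * W.mul y =
        kacEven p χ W (brPosNeg z y) - W.mul y * kacPos p χ W z := fun z y =>
      eq_sub_of_add_eq (kacPos_mul p χ W z y)
    let u : T.even K := ⟨_, bracket_even_even_mem x.2 (brPosNeg z y).2⟩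
    have h3 := kacEven_kacEven p χ W x (brPosNeg z y) u rfl
    have hJ : brPosNeg w y = u - brPosNeg z (brEvenNeg x y) := by
      refine Subtype.ext ?_
      simp only [u, Submodule.coe_sub, coe_brEvenNeg, coe_brPosNeg, hw]
      noncomm_ring
    rw [sub_mul, sub_mul, mul_assoc, mul_assoc, h1 x, h2 z, mul_add, mul_sub, ← mul_assoc,
      ← mul_assoc, h1 x, h2 z, h2 z, h2 w, hJ, map_sub, ← h3]
    noncomm_ring

theorem kacPos_kacPos (z z' : T.gOne K) :
    kacPos p χ W z * kacPos p χ W z' + kacPos p χ W z' * kacPos p χ W z = 0 := by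
  refine W.eq_zero_of_commute _ (fun l => ?_) fun y => ?_
  · simp only [LinearMap.add_apply, Module.End.mul_apply, kacPos_one, map_zero, add_zero]
  · have h2 : ∀ z : T.gOne K, ∀ y, kacPos p χ W z * W.mul y =
        kacEven p χ W (brPosNeg z y) - W.mul y * kacPos p χ W z := fun z y =>
      eq_sub_of_add_eq (kacPos_mul p χ W z y)
    have h3 := kacEven_kacPos p χ W (brPosNeg z y) z' (brEvenPos (brPosNeg z y) z') rfl
    have h4 := kacEven_kacPos p χ W (brPosNeg z' y) z (brEvenPos (brPosNeg z' y) z) rfl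
    -- Jacobi identity for `[[z, z'], y]`, with `[z, z'] = 0`.
    have hJ : brEvenPos (brPosNeg z y) z' + brEvenPos (brPosNeg z' y) z = 0 := by
      refine Subtype.ext ?_
      simp only [Submodule.coe_add, coe_brEvenPos, coe_brPosNeg, Submodule.coe_zero]
      have h := gOne_anticomm K T z.2 z'.2
      have e : ((z : T.Mat K) * z' + (z' : T.Mat K) * z) * (y : T.Mat K) -
          (y : T.Mat K) * ((z : T.Mat K) * z' + (z' : T.Mat K) * z) = 0 := by
        rw [h]; simp
      rw [← neg_eq_zero, ← e]
      noncomm_ring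
    have h5 : kacEven p χ W (brPosNeg z y) * kacPos p χ W z' -
        kacPos p χ W z' * kacEven p χ W (brPosNeg z y) +
        (kacEven p χ W (brPosNeg z' y) * kacPos p χ W z -
        kacPos p χ W z * kacEven p χ W (brPosNeg z' y)) = 0 := by
      rw [h3, h4, ← map_add, hJ, map_zero]
    rw [add_mul, mul_assoc, mul_assoc, h2 z', h2 z, mul_sub, mul_sub, ← mul_assoc, ← mul_assoc,
      h2 z, h2 z', ← sub_eq_zero, ← neg_eq_zero, ← h5]
    noncomm_ring

/-- In characteristic `p` the `p`-th power of an inner derivation is the inner derivation by the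
`p`-th power. Used for operators and for matrices, this shows that the `p`-th power of the action of
`x` and the action of `x^p` have the same commutators with multiplications. On `1 ⊗ L` they differ
by `χ(x)^p`. -/
theorem kacEven_pow [Fact p.Prime] [CharP K p] (x z : T.even K)
    (hz : (z : T.Mat K) = (x : T.Mat K) ^ p) :
    kacEven p χ W x ^ p - kacEven p χ W z = algebraMap K _ (χ x ^ p) := by
  rw [← sub_eq_zero]
  refine W.eq_zero_of_commute _ (fun l => ?_) fun y => ?_
  · have h1 : ∀ k : ℕ, (kacEven p χ W x ^ k) (W.one l) = W.one (U.of p χ (T.even K) x ^ k • l) := by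
      intro k
      induction k with
      | zero => simp
      | succ k ih =>
        rw [pow_succ', Module.End.mul_apply, ih, kacEven_one, smul_smul, ← pow_succ']
    rw [LinearMap.sub_apply, LinearMap.sub_apply, h1, kacEven_one, ← map_sub,
      ← sub_smul, U.of_pow p χ _ x z x.2 hz, algebraMap_smul, Module.algebraMap_end_apply,
      map_smul, sub_self]
  · have h2 := iterate_commutator (K := K) p (kacEven p χ W x) (W.mul y)
    have h3 : ∀ k : ℕ, (fun z => kacEven p χ W x * z - z * kacEven p χ W x)^[k] (W.mul y) =
        W.mul ((brEvenNeg x)^[k] y) := by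
      intro k
      induction k with
      | zero => rfl
      | succ k ih =>
        rw [Function.iterate_succ_apply', ih, kacEven_mul, Function.iterate_succ_apply']
    have h4 : ∀ k : ℕ, (((brEvenNeg x)^[k] y : T.gNeg K) : T.Mat K) =
        (fun z => (x : T.Mat K) * z - z * (x : T.Mat K))^[k] (y : T.Mat K) := by
      intro k
      induction k with
      | zero => rfl
      | succ k ih => rw [Function.iterate_succ_apply', coe_brEvenNeg, ih,
          Function.iterate_succ_apply']
    have h5 : (brEvenNeg x)^[p] y = brEvenNeg z y := by
      refine Subtype.ext ?_
      rw [h4, iterate_commutator (K := K) p, coe_brEvenNeg, hz]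
    rw [h3, h5, ← kacEven_mul p χ W z y] at h2
    have h6 := Algebra.commutes (χ x ^ p) (W.mul y)
    rw [sub_mul, mul_sub, h6, ← sub_eq_zero]
    have h7 := sub_eq_zero.2 h2
    rw [← neg_eq_zero, ← h7]
    noncomm_ring

/-- The action of `𝔤` on the Kac module `Λ(𝔤_{-1}) ⊗ L`. -/
noncomputable def kacAct : T.algebra K →ₗ[K] Module.End K E :=
  W.mul ∘ₗ projNeg + kacEven p χ W ∘ₗ projEven + kacPos p χ W ∘ₗ projPos

theorem kacAct_apply (x : T.algebra K) : kacAct p χ W x =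
    W.mul (projNeg x) + kacEven p χ W (projEven x) + kacPos p χ W (projPos x) := rfl

/-- The action of `U_χ(𝔤)` on the Kac module. -/
noncomputable def kacHom [Fact p.Prime] [CharP K p] :
    U p χ (T.algebra K) →ₐ[K] Module.End K E :=
  U.lift (kacAct p χ W)
    (fun x y z hx hz => by
      obtain ⟨hx1, hx2, hx3⟩ := proj_of_even hx
      obtain ⟨hz1, hz2, hz3⟩ := proj_eq (x := z) (a := brEvenNeg ⟨x, hx⟩ (projNeg y))
        (b := ⟨_, bracket_even_even_mem hx (projEven y).2⟩)
        (c := brEvenPos ⟨x, hx⟩ (projPos y)) (by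
          rw [hz, coe_brEvenNeg, coe_brEvenPos]
          conv_lhs => rw [exists_parts y]
          noncomm_ring)
      have h1 := kacEven_mul p χ W ⟨x, hx⟩ (projNeg y)
      have h2 := kacEven_kacEven p χ W ⟨x, hx⟩ (projEven y)
        ⟨_, bracket_even_even_mem hx (projEven y).2⟩ rfl
      have h3 := kacEven_kacPos p χ W ⟨x, hx⟩ (projPos y) (brEvenPos ⟨x, hx⟩ (projPos y)) rfl
      rw [kacAct_apply, kacAct_apply, kacAct_apply, hz1, hz2, hz3, hx1, hx2, hx3, map_zero,
        map_zero, ← h1, ← h2, ← h3]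
      noncomm_ring)
    (fun x y z hx hy hz => by
      have hx2 := projEven_of_odd hx
      have hy2 := projEven_of_odd hy
      obtain ⟨hz1, hz2, hz3⟩ := proj_eq (x := z) (a := 0)
        (b := brPosNeg (projPos x) (projNeg y) + brPosNeg (projPos y) (projNeg x)) (c := 0) (by
          have h1 := gOne_anticomm K T (projPos x).2 (projPos y).2
          have h2 := gNeg_anticomm (projNeg x).2 (projNeg y).2
          rw [hz]
          conv_lhs => rw [exists_parts x, exists_parts y, hx2, hy2]
          simp only [Submodule.coe_add, coe_brPosNeg, Submodule.coe_zero, add_zero, zero_add]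
          rw [← sub_eq_zero]
          have h3 := congrArg₂ (· + ·) h1 h2
          simp only [add_zero] at h3
          rw [← h3]
          noncomm_ring)
      have h1 := kacPos_mul p χ W (projPos x) (projNeg y)
      have h2 := kacPos_mul p χ W (projPos y) (projNeg x)
      have h3 := kacPos_kacPos p χ W (projPos x) (projPos y)
      have h4 : W.mul (projNeg x) * W.mul (projNeg y) +
        W.mul (projNeg y) * W.mul (projNeg x) = 0 := W.mul_mul _ _
      rw [kacAct_apply, kacAct_apply, kacAct_apply, hz1, hz2, hz3, hx2, hy2, map_zero, map_zero,
        map_zero, map_add, ← h1, ← h2, add_zero, add_zero, zero_add, add_zero]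
      have h5 := congrArg₂ (· + ·) h3 h4
      simp only [add_zero] at h5
      rw [← sub_eq_zero, ← h5]
      noncomm_ring)
    (fun x z hx hz => by
      have hzx : (z : T.Mat K) ∈ T.even K := ⟨z.2, by rw [hz]; exact pow_par_mem K T hx.2 p⟩
      obtain ⟨hx1, hx2, hx3⟩ := proj_of_even hx
      obtain ⟨hz1, hz2, hz3⟩ := proj_of_even hzx
      rw [kacAct_apply, kacAct_apply, hx1, hx2, hx3, hz1, hz2, hz3, map_zero, map_zero, zero_add,
        zero_add, add_zero, add_zero]
      exact kacEven_pow p χ W ⟨x, hx⟩ ⟨z, hzx⟩ hz)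

variable [Fact p.Prime] [CharP K p]

theorem kacHom_of (x : T.algebra K) :
    kacHom p χ W (U.of p χ (T.algebra K) x) = kacAct p χ W x := U.lift_of ..

/-- The subspace `1 ⊗ L` is `L` as a module over `U_χ(𝔤_+)`, with `𝔤_1` acting by zero. Hence `u ⊗ l
↦ u (1 ⊗ l)` respects the relations of `ψ(L)`. -/
theorem kacHom_incl_one (a : U p χ (T.plus K)) (l : L) :
    kacHom p χ W (U.incl p χ plus_le a) (W.one l) = W.one (plusToEven p χ a • l) := by
  induction a using U.induction generalizing l with
  | h0 r =>
    rw [AlgHom.commutes, AlgHom.commutes, AlgHom.commutes, algebraMap_smul,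
      Module.algebraMap_end_apply, map_smul]
  | h1 x =>
    have hx := evenPart_plus x.2
    obtain ⟨h1, h2, h3⟩ := proj_eq (x := Submodule.inclusion plus_le x) (a := 0) (b := plusProj x)
      (c := ⟨_, hx.2⟩) (by
        change (x : T.Mat K) = 0 + evenPart (x : T.Mat K) + (x - evenPart (x : T.Mat K))
        abel)
    rw [U.incl_of, kacHom_of, kacAct_apply, h1, h2, h3, map_zero, zero_add, LinearMap.add_apply,
      kacPos_one, add_zero, kacEven_one, plusToEven_of]
  | h2 a b ha hb =>
    rw [map_mul, map_mul, Module.End.mul_apply, hb, ha, map_mul, mul_smul]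
  | h3 a b ha hb =>
    rw [map_add, map_add, LinearMap.add_apply, ha, hb, map_add, add_smul, map_add]

/-- The canonical map `L → ψ(L)` is injective. -/
theorem Psi.one_tmul_injective (l : L) (h : Psi.tmul p χ (1 : U p χ (T.algebra K)) l = 0) :
    l = 0 := by
  let W := wedgeModel K (T.gNeg K) L
  have h1 : (1 : U p χ (T.algebra K)) ⊗ₜ[K] l ∈ psiRel p χ L :=
    (Submodule.Quotient.mk_eq_zero _).1 h
  let F : U p χ (T.algebra K) ⊗[K] L →ₗ[K] WedgeTensor K (T.gNeg K) L :=
    TensorProduct.lift (LinearMap.mk₂ K (fun u l => kacHom p χ W u (W.one l))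
      (fun u u' l => by rw [map_add, LinearMap.add_apply])
      (fun c u l => by rw [map_smul, LinearMap.smul_apply])
      (fun u l l' => by rw [map_add, map_add])
      (fun c u l => by rw [map_smul, map_smul]))
  have hF : ∀ u l, F (u ⊗ₜ l) = kacHom p χ W u (W.one l) := fun u l => rfl
  have hFs : ∀ (u : U p χ (T.algebra K)) z, F (u • z) = kacHom p χ W u (F z) := by
    intro u z
    induction z using TensorProduct.induction_on with
    | zero => simp
    | tmul u' l => rw [TensorProduct.smul_tmul', hF, hF, smul_eq_mul, map_mul, Module.End.mul_apply]
    | add a b ha hb => rw [smul_add, map_add, map_add, map_add, ha, hb]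
  have h2 : ∀ z ∈ psiRel p χ L, F z = 0 := by
    intro z hz
    induction hz using Submodule.span_induction with
    | mem _ hz =>
      obtain ⟨u, a, l, rfl⟩ := hz
      rw [map_sub, hF, hF, map_mul, Module.End.mul_apply, kacHom_incl_one, sub_self]
    | zero => exact map_zero F
    | add a b _ _ ha hb => rw [map_add, ha, hb, add_zero]
    | smul u a _ ha => rw [hFs, ha, map_zero]
  have h3 := h2 _ h1
  rw [hF, map_one, Module.End.one_apply] at h3
  exact W.one_injective l h3

end KacModule

/-! ### The parity automorphism and the supermodule structure of `ψ(L)` -/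

section Parity

variable {K : Type*} [Field K] {T : TypeI}

theorem sgn_mul_self (i : Fin T.size) : sgn K T i * sgn K T i = 1 := by
  simp only [sgn]
  split_ifs <;> ring

/-- Conjugation by the parity operator of the natural module. -/
def parityConj (x : T.Mat K) : T.Mat K :=
  Matrix.diagonal (sgn K T) * x * Matrix.diagonal (sgn K T)

theorem parityConj_mul (x y : T.Mat K) : parityConj (x * y) = parityConj x * parityConj y := by
  have h : Matrix.diagonal (sgn K T) * Matrix.diagonal (sgn K T) = 1 := by
    rw [Matrix.diagonal_mul_diagonal, ← Matrix.diagonal_one]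
    congr 1
    funext i
    exact sgn_mul_self i
  simp only [parityConj]
  rw [show Matrix.diagonal (sgn K T) * x * Matrix.diagonal (sgn K T) *
      (Matrix.diagonal (sgn K T) * y * Matrix.diagonal (sgn K T)) =
      Matrix.diagonal (sgn K T) * x * (Matrix.diagonal (sgn K T) * Matrix.diagonal (sgn K T)) *
        y * Matrix.diagonal (sgn K T) by noncomm_ring, h]
  noncomm_ring

theorem parityConj_even {x : T.Mat K} (hx : x ∈ T.even K) : parityConj x = x := by
  ext i j
  rw [parityConj, Matrix.mul_diagonal, Matrix.diagonal_mul]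
  by_cases h : x i j = 0
  · rw [h]; ring
  · rw [sgn_even K T i j (even_apply K T hx h), mul_right_comm, sgn_mul_self, one_mul]

theorem parityConj_odd {x : T.Mat K} (hx : x ∈ T.odd K) : parityConj x = - x := by
  ext i j
  rw [parityConj, Matrix.mul_diagonal, Matrix.diagonal_mul, Matrix.neg_apply]
  by_cases h : x i j = 0
  · rw [h]; ring
  · have h1 : T.par i ≠ T.par j := fun hc => h (hx.2 i j (fun h2 => h2 hc))
    rw [sgn_odd K T i j h1, neg_mul, neg_mul, mul_right_comm, sgn_mul_self, one_mul]

theorem parityConj_mem [NeZero (2 : K)] {x : T.Mat K} (hx : x ∈ T.algebra K) :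
    parityConj x ∈ T.algebra K := by
  have h := exists_parts (⟨x, hx⟩ : T.algebra K)
  have e : ∀ a b c : T.Mat K, parityConj (a + b + c) = parityConj a + parityConj b + parityConj c :=
    fun a b c => by simp only [parityConj]; noncomm_ring
  change x = _ at h
  rw [h, e, parityConj_even (projEven _).2, parityConj_odd (projNeg _).2.1,
    parityConj_odd (projPos _).2.1]
  exact add_mem (add_mem (neg_mem (gNeg_le K T (projNeg _).2)) (even_le (projEven _).2))
    (neg_mem (gOne_le (projPos _).2))

variable [NeZero (2 : K)]

/-- The parity automorphism of `𝔤`. -/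
def parityLin : T.algebra K →ₗ[K] T.algebra K where
  toFun x := ⟨parityConj x, parityConj_mem x.2⟩
  map_add' x y := Subtype.ext (by simp only [parityConj, Submodule.coe_add]; noncomm_ring)
  map_smul' c x := Subtype.ext (by simp [parityConj])

theorem coe_parityLin (x : T.algebra K) : (parityLin x : T.Mat K) = parityConj (x : T.Mat K) := rfl

theorem parityLin_even {x : T.algebra K} (hx : (x : T.Mat K) ∈ T.even K) : parityLin x = x :=
  Subtype.ext (parityConj_even hx)

theorem parityLin_odd {x : T.algebra K} (hx : (x : T.Mat K) ∈ T.odd K) : parityLin x = - x :=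
  Subtype.ext (parityConj_odd hx)

variable (p : ℕ) (χ : Module.Dual K (T.even K))

/-- The parity automorphism of `U_χ(𝔤)`. -/
def parityHom : U p χ (T.algebra K) →ₐ[K] U p χ (T.algebra K) :=
  U.lift (U.of p χ (T.algebra K) ∘ₗ parityLin)
    (fun x y z hx hz => U.of_even p χ _ _ _ _ (by rw [parityLin_even hx]; exact hx) (by
      simp only [coe_parityLin, hz, ← parityConj_mul]
      simp only [parityConj]
      noncomm_ring))
    (fun x y z hx hy hz => U.of_odd p χ _ _ _ _ (by rw [parityLin_odd hx]; exact neg_mem hx)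
      (by rw [parityLin_odd hy]; exact neg_mem hy) (by
      simp only [coe_parityLin, hz, ← parityConj_mul]
      simp only [parityConj]
      noncomm_ring))
    (fun x z hx hz => by
      have hz' : (z : T.Mat K) ∈ T.even K := ⟨z.2, by rw [hz]; exact pow_par_mem K T hx.2 p⟩
      rw [LinearMap.comp_apply, LinearMap.comp_apply, parityLin_even hx, parityLin_even hz']
      exact U.of_pow p χ _ x z hx hz)

theorem parityHom_of (x : T.algebra K) :
    parityHom p χ (U.of p χ (T.algebra K) x) = U.of p χ (T.algebra K) (parityLin x) := U.lift_of ..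

theorem zmod_two_cases : ∀ i : ZMod 2, i = 0 ∨ i = 1 := by decide

/-- The parity of `ψ(L)` is defined by spanning sets, so the two parts could a priori overlap. Their
description by eigenvalues of an involution excludes this. -/
theorem parityHom_monomial {i : ZMod 2} {u : U p χ (T.algebra K)}
    (hu : IsMonomial p χ (T.algebra K) i u) :
    parityHom p χ u = (if i = 0 then (1 : K) else -1) • u := by
  induction hu with
  | one => simp
  | even x hx i u _ ih =>
    rw [map_mul, parityHom_of, parityLin_even hx, ih, mul_smul_comm]
  | odd x hx i u _ ih =>
    rw [map_mul, parityHom_of, parityLin_odd hx, ih, mul_smul_comm, map_neg, neg_mul, ← neg_smul_neg,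
      neg_neg]
    congr 1
    have h2 : (1 : ZMod 2) + 1 = 0 := by decide
    rcases zmod_two_cases i with rfl | rfl
    · rw [if_pos rfl, zero_add, if_neg one_ne_zero]
    · rw [if_neg one_ne_zero, h2, if_pos rfl, neg_neg]

variable {L : Type*} [AddCommGroup L] [Module K L] [Module (U p χ (T.even K)) L]

theorem Psi.smul_tmul (u u' : U p χ (T.algebra K)) (l : L) :
    u • Psi.tmul p χ u' l = Psi.tmul p χ (u * u') l := rfl

theorem Psi.tmul_mul_incl (u : U p χ (T.algebra K)) (a : U p χ (T.plus K)) (l : L) :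
    Psi.tmul p χ (u * U.incl p χ plus_le a) l = Psi.tmul p χ u (plusToEven p χ a • l) :=
  (Submodule.Quotient.eq _).2 (Submodule.subset_span ⟨u, a, l, rfl⟩)

/-- The map `L → ψ(L)`. -/
def Psi.unit : L →ₗ[K] Psi p χ L where
  toFun l := Psi.tmul p χ 1 l
  map_add' _ _ := congrArg Submodule.Quotient.mk (TensorProduct.tmul_add _ _ _)
  map_smul' _ _ := congrArg Submodule.Quotient.mk (TensorProduct.tmul_smul _ _ _)

theorem Psi.unit_apply (l : L) : Psi.unit p χ l = Psi.tmul p χ 1 l := rfl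

theorem Psi.of_plus_smul_unit (x : T.plus K) (l : L) :
    U.of p χ (T.algebra K) (Submodule.inclusion plus_le x) • Psi.unit p χ l =
      Psi.unit p χ (U.of p χ (T.even K) (plusProj x) • l) := by
  rw [Psi.unit_apply, Psi.smul_tmul, mul_one, ← one_mul (U.of p χ (T.algebra K) _), ← U.incl_of,
    Psi.tmul_mul_incl, plusToEven_of]
  rfl

theorem Psi.of_even_smul_unit (x : T.even K) (l : L) :
    U.of p χ (T.algebra K) (Submodule.inclusion even_le x) • Psi.unit p χ l =
      Psi.unit p χ (U.of p χ (T.even K) x • l) := by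
  have h := Psi.of_plus_smul_unit p χ (⟨x, Submodule.mem_sup_left x.2⟩ : T.plus K) l
  rwa [plusProj_even _ x.2] at h

theorem Psi.of_gOne_smul_unit (x : T.gOne K) (l : L) :
    U.of p χ (T.algebra K) (Submodule.inclusion gOne_le x) • Psi.unit p χ l = 0 := by
  have h := Psi.of_plus_smul_unit p χ (⟨x, Submodule.mem_sup_right x.2⟩ : T.plus K) l
  rwa [plusProj_odd _ x.2.1, map_zero, zero_smul, map_zero] at h

/-- A subspace of `ψ(L)` which is stable under `𝔤` and contains `L` is everything. -/
theorem Psi.eq_top_of_stable {S : Submodule K (Psi p χ L)}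
    (hS : ∀ x : T.algebra K, ∀ m ∈ S, U.of p χ (T.algebra K) x • m ∈ S)
    (h : ∀ l, Psi.unit p χ l ∈ S) : S = ⊤ := by
  rw [eq_top_iff]
  intro m _
  obtain ⟨z, rfl⟩ := Submodule.Quotient.mk_surjective _ m
  induction z using TensorProduct.induction_on with
  | zero => exact zero_mem S
  | tmul u l =>
    have h1 := (submoduleOfStable S hS).smul_mem u (h l)
    rw [Psi.unit_apply, Psi.smul_tmul, mul_one] at h1
    exact h1
  | add a b ha hb => exact add_mem (ha trivial) (hb trivial)

theorem psiGrading_even_smul_mem (𝓛 : ZMod 2 → Submodule K L) (x : T.algebra K)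
    (hx : (x : T.Mat K) ∈ T.even K) (k : ZMod 2) (m : Psi p χ L) (hm : m ∈ psiGrading p χ 𝓛 k) :
    U.of p χ (T.algebra K) x • m ∈ psiGrading p χ 𝓛 k := by
  induction hm using Submodule.span_induction with
  | mem _ h =>
    obtain ⟨i, j, u, l, hu, hl, hk, rfl⟩ := h
    exact Submodule.subset_span ⟨i, j, _, l, .even x hx i u hu, hl, hk, rfl⟩
  | zero => rw [smul_zero]; exact zero_mem _
  | add a b _ _ ha hb => rw [smul_add]; exact add_mem ha hb
  | smul c a _ ha => rw [smul_algebra_smul_comm]; exact Submodule.smul_mem _ _ ha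

theorem psiGrading_odd_smul_mem (𝓛 : ZMod 2 → Submodule K L) (x : T.algebra K)
    (hx : (x : T.Mat K) ∈ T.odd K) (k : ZMod 2) (m : Psi p χ L) (hm : m ∈ psiGrading p χ 𝓛 k) :
    U.of p χ (T.algebra K) x • m ∈ psiGrading p χ 𝓛 (k + 1) := by
  induction hm using Submodule.span_induction with
  | mem _ h =>
    obtain ⟨i, j, u, l, hu, hl, hk, rfl⟩ := h
    exact Submodule.subset_span ⟨i + 1, j, _, l, .odd x hx i u hu, hl, by rw [← hk]; ring, rfl⟩
  | zero => rw [smul_zero]; exact zero_mem _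
  | add a b _ _ ha hb => rw [smul_add]; exact add_mem ha hb
  | smul c a _ ha => rw [smul_algebra_smul_comm]; exact Submodule.smul_mem _ _ ha

theorem unit_mem_psiGrading {𝓛 : ZMod 2 → Submodule K L} {i : ZMod 2} {l : L} (hl : l ∈ 𝓛 i) :
    Psi.unit p χ l ∈ psiGrading p χ 𝓛 i :=
  Submodule.subset_span ⟨0, i, 1, l, .one, hl, zero_add i, rfl⟩

/-- The parity involution of a `ZMod 2`-graded space. -/
theorem exists_parity {M : Type*} [AddCommGroup M] [Module K M] {𝓜 : ZMod 2 → Submodule K M}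
    (h : IsCompl (𝓜 0) (𝓜 1)) : ∃ σ : M →ₗ[K] M, (∀ m ∈ 𝓜 0, σ m = m) ∧ ∀ m ∈ 𝓜 1, σ m = - m :=
  ⟨LinearMap.ofIsCompl h (𝓜 0).subtype (-(𝓜 1).subtype),
    fun m hm => LinearMap.ofIsCompl_apply_left h (⟨m, hm⟩ : 𝓜 0),
    fun m hm => LinearMap.ofIsCompl_apply_right h (⟨m, hm⟩ : 𝓜 1)⟩

/-- `ψ(L)` is a supermodule. -/
theorem isSupermodule_psi [IsScalarTower K (U p χ (T.even K)) L] {𝓛 : ZMod 2 → Submodule K L}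
    (h : IsSupermodule p χ (T.even K) L 𝓛) :
    IsSupermodule p χ (T.algebra K) (Psi p χ L) (psiGrading p χ 𝓛) where
  even_smul_mem := fun x hx k m hm => psiGrading_even_smul_mem p χ 𝓛 x hx k m hm
  odd_smul_mem := fun x hx k m hm => psiGrading_odd_smul_mem p χ 𝓛 x hx k m hm
  isCompl := by
    have hadd : ∀ l : L, ∃ a ∈ 𝓛 0, ∃ b ∈ 𝓛 1, a + b = l := fun l => by
      simpa using Submodule.mem_sup.1 (h.isCompl.sup_eq_top ▸ Submodule.mem_top (x := l))
    refine ⟨?_, ?_⟩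
    · obtain ⟨σ, hσ0, hσ1⟩ := exists_parity h.isCompl
      have hσ : ∀ (x : T.even K) l, σ (U.of p χ (T.even K) x • l) = U.of p χ (T.even K) x • σ l := by
        intro x l
        obtain ⟨a, ha, b, hb, rfl⟩ := hadd l
        rw [smul_add, map_add, map_add, hσ0 _ ha, hσ1 _ hb, hσ0 _ (h.even_smul_mem x x.2 0 a ha),
          hσ1 _ (h.even_smul_mem x x.2 1 b hb), smul_add, smul_neg]
      -- The candidate for the parity involution of `ψ(L)`. It has to be shown that it preserves the
      -- relations of the tensor product.
      let Θ : U p χ (T.algebra K) ⊗[K] L →ₗ[K] U p χ (T.algebra K) ⊗[K] L :=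
        TensorProduct.map (parityHom p χ).toLinearMap σ
      have hΘ : ∀ u l, Θ (u ⊗ₜ l) = parityHom p χ u ⊗ₜ σ l := fun _ _ => rfl
      have hΘs : ∀ (u : U p χ (T.algebra K)) z, Θ (u • z) = parityHom p χ u • Θ z := by
        intro u z
        induction z using TensorProduct.induction_on with
        | zero => simp
        | tmul u' l => rw [TensorProduct.smul_tmul', hΘ, hΘ, smul_eq_mul, map_mul,
            TensorProduct.smul_tmul', smul_eq_mul]
        | add a b ha hb => rw [smul_add, map_add, map_add, smul_add, ha, hb]
      -- With `u` and `l` arbitrary the claim for `a` and `b` implies the claim for `a b`, so `a ∈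
      -- 𝔤_+` suffices. There the parity automorphism replaces `x_0 + x_1` by `x_0 - x_1`, which
      -- acts on `L` in the same way.
      have hgen : ∀ (a : U p χ (T.plus K)) (u : U p χ (T.algebra K)) (l : L),
          (u * parityHom p χ (U.incl p χ plus_le a)) ⊗ₜ[K] σ l - u ⊗ₜ[K] σ (plusToEven p χ a • l) ∈
            psiRel p χ L := by
        intro a
        induction a using U.induction with
        | h0 r =>
          intro u l
          have e : u * parityHom p χ (U.incl p χ plus_le (algebraMap K (U p χ (T.plus K)) r)) =
              u * U.incl p χ plus_le (algebraMap K (U p χ (T.plus K)) r) := by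
            simp only [AlgHom.commutes]
          have e2 : σ (plusToEven p χ (algebraMap K (U p χ (T.plus K)) r) • l) =
              plusToEven p χ (algebraMap K (U p χ (T.plus K)) r) • σ l := by
            rw [AlgHom.commutes, algebraMap_smul, algebraMap_smul, map_smul]
          rw [e, e2]
          exact Submodule.subset_span ⟨_, _, _, rfl⟩
        | h1 x =>
          intro u l
          have hx := evenPart_plus x.2
          let x' : T.plus K := ⟨evenPart (x : T.Mat K) - ((x : T.Mat K) - evenPart (x : T.Mat K)),
            sub_mem (Submodule.mem_sup_left hx.1) (Submodule.mem_sup_right hx.2)⟩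
          have e1 : parityHom p χ (U.incl p χ plus_le (U.of p χ (T.plus K) x)) =
              U.incl p χ plus_le (U.of p χ (T.plus K) x') := by
            rw [U.incl_of, U.incl_of, parityHom_of]
            congr 1
            refine Subtype.ext ?_
            change parityConj (x : T.Mat K) = _
            have e : ∀ a b : T.Mat K, parityConj (a + b) = parityConj a + parityConj b :=
              fun a b => by simp only [parityConj]; noncomm_ring
            have e' : (x : T.Mat K) = evenPart (x : T.Mat K) +
                ((x : T.Mat K) - evenPart (x : T.Mat K)) := by abel
            conv_lhs => rw [e']
            rw [e, parityConj_even hx.1, parityConj_odd hx.2.1]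
            exact (sub_eq_add_neg _ _).symm
          have e2 : plusProj x' = plusProj x := by
            refine Subtype.ext ?_
            change evenPart (evenPart (x : T.Mat K) - ((x : T.Mat K) - evenPart (x : T.Mat K))) =
              evenPart (x : T.Mat K)
            rw [map_sub, evenPart_odd hx.2.1, evenPart_even hx.1, sub_zero]
          rw [e1, plusToEven_of, hσ, ← e2, ← plusToEven_of]
          exact Submodule.subset_span ⟨_, _, _, rfl⟩
        | h2 a b ha hb =>
          intro u l
          have h1 := hb (u * parityHom p χ (U.incl p χ plus_le a)) l
          have h2 := ha u (plusToEven p χ b • l)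
          have h3 := add_mem h1 h2
          rw [sub_add_sub_cancel] at h3
          rwa [map_mul, map_mul, ← mul_assoc, map_mul, mul_smul]
        | h3 a b ha hb =>
          intro u l
          have h3 := add_mem (ha u l) (hb u l)
          rw [map_add, map_add, mul_add, map_add, add_smul, map_add, TensorProduct.add_tmul,
            TensorProduct.tmul_add]
          rwa [add_sub_add_comm]
      have hrel : ∀ z ∈ psiRel p χ L, Θ z ∈ psiRel p χ L := by
        intro z hz
        induction hz using Submodule.span_induction with
        | mem _ hz =>
          obtain ⟨u, a, l, rfl⟩ := hz
          rw [map_sub, hΘ, hΘ, map_mul]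
          exact hgen a _ l
        | zero => rw [map_zero]; exact zero_mem _
        | add a b _ _ ha hb => rw [map_add]; exact add_mem ha hb
        | smul u a _ ha => rw [hΘs]; exact Submodule.smul_mem _ _ ha
      -- Elements of the two parts lift to eigenvectors of `Θ` in the tensor product before passing
      -- to the quotient.
      have hgr : ∀ k, ∀ m ∈ psiGrading p χ 𝓛 k, ∃ z,
          Submodule.Quotient.mk (p := psiRel p χ L) z = m ∧
            Θ z = (if k = 0 then (1 : K) else -1) • z := by
        intro k m hm
        induction hm using Submodule.span_induction with
        | mem _ hz =>
          obtain ⟨i, j, u, l, hu, hl, hk, rfl⟩ := hz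
          refine ⟨u ⊗ₜ l, rfl, ?_⟩
          have e : σ l = (if j = 0 then (1 : K) else -1) • l := by
            rcases zmod_two_cases j with rfl | rfl
            · rw [hσ0 l hl, if_pos rfl, one_smul]
            · rw [hσ1 l hl, if_neg one_ne_zero, neg_smul, one_smul]
          rw [hΘ, parityHom_monomial p χ hu, e, TensorProduct.smul_tmul_smul, ← hk]
          congr 1
          have h2 : ∀ i j : ZMod 2, (if i = 0 then (1 : K) else -1) * (if j = 0 then (1 : K) else -1) =
              if i + j = 0 then (1 : K) else -1 := by
            intro i j
            have h3 : i + j = 0 ↔ (i = 0 ↔ j = 0) := by revert i j; decide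
            by_cases hi : i = 0 <;> by_cases hj : j = 0 <;> simp [h3, hi, hj]
          exact h2 i j
        | zero => exact ⟨0, rfl, by simp⟩
        | add a b _ _ ha hb =>
          obtain ⟨z, rfl, hz⟩ := ha
          obtain ⟨w, rfl, hw⟩ := hb
          exact ⟨z + w, rfl, by rw [map_add, hz, hw, smul_add]⟩
        | smul c a _ ha =>
          obtain ⟨z, rfl, hz⟩ := ha
          exact ⟨c • z, rfl, by rw [map_smul, hz, smul_comm]⟩
      rw [Submodule.disjoint_def]
      intro m h0 h1
      obtain ⟨z, hz, hz0⟩ := hgr 0 m h0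
      obtain ⟨w, hw, hw1⟩ := hgr 1 m h1
      rw [if_pos rfl, one_smul] at hz0
      rw [if_neg one_ne_zero] at hw1
      replace hw1 := hw1.trans (neg_one_smul K w)
      -- `z` and `w` lift the same vector as an even and an odd element. Both `z - w` and `Θ (z - w)
      -- = z + w` are relations, hence so is `2 z`.
      have h2 : z - w ∈ psiRel p χ L := (Submodule.Quotient.eq _).1 (hz.trans hw.symm)
      have h3 := hrel _ h2
      rw [map_sub, hz0, hw1] at h3
      have h4 := add_mem h2 h3
      have e : z - w + (z - -w) = (2 : K) • z := by rw [two_smul]; abel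
      rw [e] at h4
      have h5 : z ∈ psiRel p χ L := by
        have := Submodule.smul_of_tower_mem (psiRel p χ L) (2 : K)⁻¹ h4
        rwa [smul_smul, inv_mul_cancel₀ (NeZero.ne _), one_smul] at this
      rw [← hz]
      exact (Submodule.Quotient.mk_eq_zero _).2 h5
    · rw [codisjoint_iff]
      refine Psi.eq_top_of_stable p χ (fun x m hm => ?_) fun l => ?_
      · obtain ⟨a, ha, b, hb, rfl⟩ := Submodule.mem_sup.1 hm
        have e : x = Submodule.inclusion (gNeg_le K T) (projNeg x) +
            Submodule.inclusion even_le (projEven x) + Submodule.inclusion gOne_le (projPos x) :=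
          Subtype.ext (exists_parts x)
        have hodd : ∀ y : T.algebra K, (y : T.Mat K) ∈ T.odd K →
            U.of p χ (T.algebra K) y • (a + b) ∈ psiGrading p χ 𝓛 0 ⊔ psiGrading p χ 𝓛 1 := by
          intro y hy
          rw [smul_add, add_comm]
          exact Submodule.add_mem_sup (psiGrading_odd_smul_mem p χ 𝓛 y hy 1 b hb)
            (psiGrading_odd_smul_mem p χ 𝓛 y hy 0 a ha)
        rw [e, map_add, map_add, add_smul, add_smul]
        refine add_mem (add_mem (hodd _ (projNeg x).2.1) ?_) (hodd _ (projPos x).2.1)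
        rw [smul_add]
        exact Submodule.add_mem_sup (psiGrading_even_smul_mem p χ 𝓛 _ (projEven x).2 0 a ha)
          (psiGrading_even_smul_mem p χ 𝓛 _ (projEven x).2 1 b hb)
      · obtain ⟨a, ha, b, hb, rfl⟩ := hadd l
        rw [map_add]
        exact Submodule.add_mem_sup (unit_mem_psiGrading p χ ha) (unit_mem_psiGrading p χ hb)

end Parity

/-! ### Ordered odd roots, their root vectors, and `ρ` -/

section RootData

variable (K : Type*) [Field K]

/-- An ordering `β_0, β_1, …` of the positive odd roots, with root vectors `e_k` of `β_k` and `f_k`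
of `-β_k`, such that `[e_k, f_j]` is in `𝔫_0̄^+` for `j < k` and `[𝔫_0̄^+, f_k]` is in the span of the
`f_j` with `j < k`. -/
structure OddRootData (T : TypeI) (d : ℕ) (β : Fin d → Fin T.size × Fin T.size)
    (e f : Fin d → T.Mat K) : Prop where
  mem_posOdd : ∀ k, β k ∈ T.posOdd
  e_mem : ∀ k, e k ∈ T.gOne K
  f_mem : ∀ k, f k ∈ T.gNeg K
  span : ∀ y ∈ T.gNeg K, y ∈ Submodule.span K (Set.range f)
  upper : ∀ j k, j < k → e k * f j + f j * e k ∈ supported fun a b => a < b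
  coroot : ∀ k, e k * f k + f k * e k = T.dualEltMat K (β k)
  lower : ∀ x ∈ T.nilEven K, ∀ k, x * f k - f k * x ∈ Submodule.span K {y | ∃ j, j < k ∧ f j = y}
  weight : ∀ h ∈ T.cartan K, ∀ k, h * f k - f k * h = (h (β k).2 (β k).2 - h (β k).1 (β k).1) • f k
  rho : ∀ k, T.rho K (T.dualElt K (β k)) =
    - ∑ j, if j < k then T.root K (β j) (T.dualElt K (β k)) else 0

/-- The product `sgn a * sgn b` is `1` on even and `-1` on odd roots, so both sums in `ρ` become one
sum over index pairs. -/
theorem rho_apply (T : TypeI) (h : T.cartan K) : T.rho K h =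
    2⁻¹ * ∑ a, ∑ b, (if (a, b) ∈ T.posRoots then sgn K T a * sgn K T b else 0) *
      ((h : T.Mat K) a a - (h : T.Mat K) b b) := by
  have h1 : ∀ β : Fin T.size × Fin T.size, T.root K β h =
      (h : T.Mat K) β.1 β.1 - (h : T.Mat K) β.2 β.2 := fun _ => rfl
  rw [← Finset.sum_product' (f := fun a b => (if (a, b) ∈ T.posRoots then sgn K T a * sgn K T b
    else 0) * ((h : T.Mat K) a a - (h : T.Mat K) b b))]
  simp only [rho, LinearMap.smul_apply, LinearMap.sub_apply, LinearMap.sum_apply, smul_eq_mul, h1,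
    posEven, posOdd, ite_mul, zero_mul, Prod.mk.eta]
  congr 1
  rw [Finset.univ_product_univ, ← Finset.sum_filter, Finset.filter_mem_eq_inter,
    Finset.univ_inter, ← Finset.sum_filter_add_sum_filter_not T.posRoots
    (fun β => T.par β.1 = T.par β.2), sub_eq_add_neg, ← Finset.sum_neg_distrib]
  congr 1
  · refine Finset.sum_congr rfl fun β hβ => ?_
    rw [sgn_even K T _ _ (Finset.mem_filter.1 hβ).2, sgn_mul_self, one_mul]
  · refine Finset.sum_congr rfl fun β hβ => ?_
    rw [sgn_odd K T _ _ (Finset.mem_filter.1 hβ).2, neg_mul, sgn_mul_self, neg_one_mul]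

variable {K}

/-- Collects the coefficient of each `t q`. For `t = t_β` only a few diagonal entries are nonzero,
so only those coefficients of `2ρ` have to be computed. -/
theorem sum_mul_sub {ι : Type*} [Fintype ι] (G : ι → ι → K) (t : ι → K) :
    ∑ a, ∑ b, G a b * (t a - t b) = ∑ q, t q * (∑ b, G q b - ∑ a, G a q) := by
  simp only [mul_sub, Finset.sum_sub_distrib, Finset.mul_sum]
  congr 1
  · exact Finset.sum_congr rfl fun _ _ => Finset.sum_congr rfl fun _ _ => mul_comm _ _
  · rw [Finset.sum_comm]
    exact Finset.sum_congr rfl fun _ _ => Finset.sum_congr rfl fun _ _ => mul_comm _ _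

theorem sum_interval {N lo hi : ℕ} (h1 : lo ≤ hi) (h2 : hi ≤ N) :
    ∑ b : Fin N, (if lo ≤ (b : ℕ) ∧ (b : ℕ) < hi then (1 : K) else 0) = (hi : K) - lo := by
  rw [Fin.sum_univ_eq_sum_range (fun b => if lo ≤ b ∧ b < hi then (1 : K) else 0) N,
    Finset.sum_boole]
  have : Finset.filter (fun b => lo ≤ b ∧ b < hi) (Finset.range N) = Finset.Ico lo hi := by
    ext b
    simp only [Finset.mem_filter, Finset.mem_range, Finset.mem_Ico]
    omega
  rw [this, Nat.card_Ico, Nat.cast_sub h1]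

theorem mem_algebra_of_diag_eq_zero_gl {m n : ℕ} (x : (gl m n).Mat K) (hx : ∀ i, x i i = 0) :
    (x : (sl m n).Mat K) ∈ (sl m n).algebra K := by
  change str K (sl m n) x = 0
  simp only [str, LinearMap.coe_mk, AddHom.coe_mk]
  exact Finset.sum_eq_zero fun i _ => by rw [show x i i = 0 from hx i, mul_zero]

/-! ### `gl(m|n)` and `sl(m|n)` -/

section Linear

variable (m n : ℕ)

/-- The `k`-th positive odd root of `gl(m|n)`. -/
def glRoot (k : Fin (m * n)) : Fin (gl m n).size × Fin (gl m n).size :=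
  have h : 0 < m := Nat.pos_of_ne_zero fun hm => by have := k.2; simp [hm] at this
  (⟨m - 1 - k % m, by simp only [size]; omega⟩,
    ⟨m + k / m, by
      have := Nat.div_lt_of_lt_mul k.2
      simp only [size]; omega⟩)

theorem glRoot_fst (k : Fin (m * n)) : ((glRoot m n k).1 : ℕ) = m - 1 - k % m := rfl

theorem glRoot_snd (k : Fin (m * n)) : ((glRoot m n k).2 : ℕ) = m + k / m := rfl

theorem le_glRoot_snd (k : Fin (m * n)) : m ≤ ((glRoot m n k).2 : ℕ) := Nat.le_add_right _ _

variable {m n}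

theorem glRoot_mod_lt (k : Fin (m * n)) : (k : ℕ) % m < m :=
  Nat.mod_lt _ (Nat.pos_of_ne_zero fun hm => by have := k.2; simp [hm] at this)

theorem glRoot_fst_lt (k : Fin (m * n)) : ((glRoot m n k).1 : ℕ) < m := by
  have := glRoot_mod_lt k
  rw [glRoot_fst]; omega

theorem exists_glRoot {i j : Fin (gl m n).size} (hi : (i : ℕ) < m) (hj : m ≤ (j : ℕ)) :
    ∃ k : Fin (m * n), glRoot m n k = (i, j) := by
  have hj2 := j.2
  simp only [size] at hj2
  have hm : 0 < m := by omega
  have hlt : m - 1 - (i : ℕ) < m := by omega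
  refine ⟨⟨(m - 1 - i) + m * (j - m), ?_⟩, ?_⟩
  · calc (m - 1 - i) + m * (j - m) < m + m * (j - m) := by omega
      _ = m * (j - m + 1) := by ring
      _ ≤ m * n := Nat.mul_le_mul_left _ (by omega)
  · refine Prod.ext (Fin.ext ?_) (Fin.ext ?_)
    · rw [glRoot_fst]
      simp only [Nat.add_mul_mod_self_left, Nat.mod_eq_of_lt hlt]
      omega
    · rw [glRoot_snd]
      simp only [Nat.add_mul_div_left _ _ hm, Nat.div_eq_of_lt hlt]
      omega

theorem lt_iff_div_mod (j k m : ℕ) (hm : 0 < m) :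
    j < k ↔ j / m < k / m ∨ (j / m = k / m ∧ j % m < k % m) := by
  have h1 := Nat.div_add_mod j m
  have h2 := Nat.div_add_mod k m
  have h3 := Nat.mod_lt j hm
  have h4 := Nat.mod_lt k hm
  constructor
  · intro h
    rcases lt_trichotomy (j / m) (k / m) with h5 | h5 | h5
    · exact Or.inl h5
    · rw [h5] at h1
      exact Or.inr ⟨h5, by omega⟩
    · have h6 := Nat.mul_le_mul_left m (Nat.succ_le_of_lt h5)
      rw [Nat.mul_succ] at h6
      omega
  · rintro (h | ⟨h5, h6⟩)
    · have h6 := Nat.mul_le_mul_left m (Nat.succ_le_of_lt h)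
      rw [Nat.mul_succ] at h6
      omega
    · rw [h5] at h1
      omega

/-- The root `ε_i - ε_j` comes earlier for smaller `j` and, at equal `j`, for larger `i`; the first
one is the simple odd root. Commuting `E_{ji}` with `𝔫_0̄^+` decreases `j` or increases `i`, so it
leads to earlier roots. -/
theorem glRoot_lt_iff (j k : Fin (m * n)) : j < k ↔ (glRoot m n j).2 < (glRoot m n k).2 ∨
    ((glRoot m n j).2 = (glRoot m n k).2 ∧ (glRoot m n k).1 < (glRoot m n j).1) := by
  have h1 := glRoot_mod_lt j
  have h2 := glRoot_mod_lt k
  rw [Fin.lt_def, Fin.lt_def, Fin.lt_def, Fin.ext_iff, glRoot_fst, glRoot_fst, glRoot_snd,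
    glRoot_snd, lt_iff_div_mod _ _ m (by omega)]
  omega

theorem sum_glRoot (k : Fin (m * n)) (G : Fin (gl m n).size × Fin (gl m n).size → K) :
    ∑ j : Fin (m * n), (if j < k then G (glRoot m n j) else 0) =
      ∑ a : Fin (gl m n).size, ∑ b : Fin (gl m n).size, if (a : ℕ) < m ∧ m ≤ (b : ℕ) ∧ (b < (glRoot m n k).2 ∨
        (b = (glRoot m n k).2 ∧ (glRoot m n k).1 < a)) then G (a, b) else 0 := by
  rw [← Finset.sum_product' (f := fun a b : Fin (gl m n).size => if (a : ℕ) < m ∧ m ≤ (b : ℕ) ∧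
    (b < (glRoot m n k).2 ∨ (b = (glRoot m n k).2 ∧ (glRoot m n k).1 < a)) then G (a, b) else 0),
    Finset.univ_product_univ, ← Finset.sum_filter, ← Finset.sum_filter]
  refine Finset.sum_bij (fun j _ => glRoot m n j) ?_ ?_ ?_ ?_
  · intro j hj
    have hj := (Finset.mem_filter.1 hj).2
    rw [glRoot_lt_iff] at hj
    refine Finset.mem_filter.2 ⟨Finset.mem_univ _, glRoot_fst_lt j, le_glRoot_snd m n j, hj⟩
  · intro j _ j' _ h
    by_contra hc
    rcases lt_or_gt_of_ne hc with h1 | h1 <;> rw [glRoot_lt_iff, h] at h1 <;> simp at h1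
  · rintro ⟨a, b⟩ hab
    obtain ⟨-, ha, hb, h⟩ := Finset.mem_filter.1 hab
    obtain ⟨j, hj⟩ := exists_glRoot ha hb
    refine ⟨j, Finset.mem_filter.2 ⟨Finset.mem_univ _, ?_⟩, hj⟩
    rw [glRoot_lt_iff, hj]
    exact h
  · intro j _; rfl

theorem gl_dualEltMat (k : Fin (m * n)) : (gl m n).dualEltMat K (glRoot m n k) =
    Matrix.single (glRoot m n k).1 (glRoot m n k).1 1 +
      Matrix.single (glRoot m n k).2 (glRoot m n k).2 1 := by
  have h1 : sgn K (gl m n) (glRoot m n k).1 = 1 := by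
    simp [sgn, par, glRoot_fst_lt k]
  have h2 : sgn K (gl m n) (glRoot m n k).2 = -1 := by
    simp [sgn, par, glRoot_snd]
  rw [dualEltMat, h1, h2, one_smul, neg_one_smul, sub_neg_eq_add]
  rfl

theorem gl_dualEltMat_apply (k : Fin (m * n)) (q : Fin (gl m n).size) :
    (gl m n).dualEltMat K (glRoot m n k) q q =
      (if q = (glRoot m n k).1 then 1 else 0) + (if q = (glRoot m n k).2 then 1 else 0) := by
  rw [gl_dualEltMat, Matrix.add_apply, Matrix.single_apply, Matrix.single_apply]
  simp only [and_self, eq_comm]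

/-- With `β_k = ε_i - ε_j`, so that `t_{β_k} = E_{ii} + E_{jj}`, the earlier roots that contribute
are the `j - m` roots `ε_i - ε_b` with `b < j`, each with `1`, and the `m - 1 - i` roots `ε_a - ε_j`
with `a > i`, each with `-1`. -/
theorem gl_sum_root (k : Fin (m * n)) :
    ∑ j : Fin (m * n), (if j < k then
      (gl m n).dualEltMat K (glRoot m n k) (glRoot m n j).1 (glRoot m n j).1 -
      (gl m n).dualEltMat K (glRoot m n k) (glRoot m n j).2 (glRoot m n j).2 else 0) =
      ((glRoot m n k).2 : ℕ) + ((glRoot m n k).1 : ℕ) + 1 - 2 * (m : K) := by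
  have h := sum_glRoot k fun q => (gl m n).dualEltMat K (glRoot m n k) q.1 q.1 -
    (gl m n).dualEltMat K (glRoot m n k) q.2 q.2
  simp only [gl_dualEltMat_apply] at h ⊢
  rw [h]
  set i := (glRoot m n k).1
  set j := (glRoot m n k).2
  have hi : (i : ℕ) < m := glRoot_fst_lt k
  have hj : m ≤ (j : ℕ) := Nat.le_add_right _ _
  have hj2 : (j : ℕ) < m + n := j.2
  have e : ∀ a b : Fin (gl m n).size, (if (a : ℕ) < m ∧ m ≤ (b : ℕ) ∧ (b < j ∨ (b = j ∧ i < a)) then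
      ((if a = i then (1 : K) else 0) + (if a = j then 1 else 0)) -
      ((if b = i then 1 else 0) + (if b = j then 1 else 0)) else 0) =
      (if a = i then (if m ≤ (b : ℕ) ∧ (b : ℕ) < j then 1 else 0) else 0) -
      (if b = j then (if (i : ℕ) + 1 ≤ (a : ℕ) ∧ (a : ℕ) < m then 1 else 0) else 0) := by
    intro a b
    simp only [Fin.lt_def, Fin.ext_iff]
    split_ifs <;> first | omega | simp
  simp only [e, Finset.sum_sub_distrib]
  have e1 : ∑ a : Fin (gl m n).size, ∑ b : Fin (gl m n).size,
      (if a = i then (if m ≤ (b : ℕ) ∧ (b : ℕ) < j then (1 : K) else 0) else 0) = (j : ℕ) - m := by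
    rw [Finset.sum_comm]
    simp only [Finset.sum_ite_eq', Finset.mem_univ, if_true]
    exact sum_interval hj hj2.le
  have e2 : ∑ a : Fin (gl m n).size, ∑ b : Fin (gl m n).size,
      (if b = j then (if (i : ℕ) + 1 ≤ (a : ℕ) ∧ (a : ℕ) < m then (1 : K) else 0) else 0) =
        m - ((i : ℕ) + 1 : ℕ) := by
    simp only [Finset.sum_ite_eq', Finset.mem_univ, if_true]
    exact sum_interval (N := (gl m n).size) hi (by simp only [size]; omega)
  rw [e1, e2]
  push_cast
  ring

/-- The coefficients of `2ρ` at `ε_i` and at `ε_j` are `m - n - 1 - 2i` and `3m + n - 1 - 2j`, found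
by counting intervals of indices; the value is half of their sum. -/
theorem gl_sum_posRoots [NeZero (2 : K)] (k : Fin (m * n)) :
    2⁻¹ * ∑ a, ∑ b, (if (a, b) ∈ (gl m n).posRoots then sgn K (gl m n) a * sgn K (gl m n) b else 0) *
      ((gl m n).dualEltMat K (glRoot m n k) a a - (gl m n).dualEltMat K (glRoot m n k) b b) =
    - (((glRoot m n k).2 : ℕ) + ((glRoot m n k).1 : ℕ) + 1 - 2 * (m : K)) := by
  rw [sum_mul_sub]
  simp only [gl_dualEltMat_apply]
  set i := (glRoot m n k).1
  set j := (glRoot m n k).2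
  have hi : (i : ℕ) < m := glRoot_fst_lt k
  have hj : m ≤ (j : ℕ) := Nat.le_add_right _ _
  have hj2 : (j : ℕ) < m + n := j.2
  have hN : (gl m n).size = m + n := rfl
  have hsgn : ∀ q : Fin (gl m n).size, sgn K (gl m n) q = if (q : ℕ) < m then 1 else -1 := by
    intro q
    simp only [sgn, par]
    split_ifs <;> simp_all
  have hmem : ∀ a b : Fin (gl m n).size, (a, b) ∈ (gl m n).posRoots ↔ (a : ℕ) < b := by
    intro a b
    simp [posRoots]
  simp only [hmem, add_mul, ite_mul, one_mul, zero_mul, Finset.sum_add_distrib, Finset.sum_ite_eq',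
    Finset.mem_univ, if_true]
  have e1 : ∀ b : Fin (gl m n).size,
      (if (i : ℕ) < b then sgn K (gl m n) i * sgn K (gl m n) b else 0) =
        (if (i : ℕ) + 1 ≤ (b : ℕ) ∧ (b : ℕ) < m then 1 else 0) -
        (if m ≤ (b : ℕ) ∧ (b : ℕ) < m + n then 1 else 0) := by
    intro b
    have := b.2
    rw [hsgn, hsgn]
    split_ifs <;> first | omega | norm_num
  have e2 : ∀ a : Fin (gl m n).size,
      (if (a : ℕ) < i then sgn K (gl m n) a * sgn K (gl m n) i else 0) =
        (if 0 ≤ (a : ℕ) ∧ (a : ℕ) < i then 1 else 0) := by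
    intro b
    have := b.2
    rw [hsgn, hsgn]
    split_ifs <;> first | omega | norm_num
  have e3 : ∀ b : Fin (gl m n).size,
      (if (j : ℕ) < b then sgn K (gl m n) j * sgn K (gl m n) b else 0) =
        (if (j : ℕ) + 1 ≤ (b : ℕ) ∧ (b : ℕ) < m + n then 1 else 0) := by
    intro b
    have := b.2
    rw [hsgn, hsgn]
    split_ifs <;> first | omega | norm_num
  have e4 : ∀ a : Fin (gl m n).size,
      (if (a : ℕ) < j then sgn K (gl m n) a * sgn K (gl m n) j else 0) =
        (if m ≤ (a : ℕ) ∧ (a : ℕ) < j then 1 else 0) -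
        (if 0 ≤ (a : ℕ) ∧ (a : ℕ) < m then 1 else 0) := by
    intro b
    have := b.2
    rw [hsgn, hsgn]
    split_ifs <;> first | omega | norm_num
  simp only [e1, e2, e3, e4, Finset.sum_sub_distrib]
  rw [sum_interval (by omega) (by omega), sum_interval (by omega) (by omega),
    sum_interval (by omega) (by omega), sum_interval (by omega) (by omega),
    sum_interval (by omega) (by omega), sum_interval (by omega) (by omega)]
  push_cast
  have h2 : (2 : K) ≠ 0 := NeZero.ne _
  field_simp
  ring

/-- The root vectors of `gl(m|n)`. -/
theorem oddRootData_gl [NeZero (2 : K)] (m n : ℕ) : OddRootData K (gl m n) (m * n) (glRoot m n)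
    (fun k => Matrix.single (glRoot m n k).1 (glRoot m n k).2 1)
    (fun k => Matrix.single (glRoot m n k).2 (glRoot m n k).1 1) where
  mem_posOdd k := by
    have h1 := glRoot_fst_lt k
    have h2 := le_glRoot_snd m n k
    simp only [posOdd, posRoots, Finset.mem_filter, Finset.mem_univ, true_and, Fin.lt_def, par]
    refine ⟨by omega, ?_⟩
    rw [if_pos h1, if_neg (by omega)]
    decide
  e_mem k := by
    have h1 := glRoot_fst_lt k
    have h2 := le_glRoot_snd m n k
    refine ⟨⟨trivial, fun i j h => ?_⟩, fun i j h => ?_⟩ <;>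
      refine Matrix.single_apply_of_ne _ _ _ _ _ ?_ <;> rintro ⟨rfl, rfl⟩ <;> apply h
    · simp only [par]
      rw [if_pos h1, if_neg (by omega)]
      decide
    · rw [Fin.lt_def]; omega
  f_mem k := by
    have h1 := glRoot_fst_lt k
    have h2 := le_glRoot_snd m n k
    refine ⟨⟨trivial, fun i j h => ?_⟩, fun i j h => ?_⟩ <;>
      refine Matrix.single_apply_of_ne _ _ _ _ _ ?_ <;> rintro ⟨rfl, rfl⟩ <;> apply h
    · simp only [par]
      rw [if_pos h1, if_neg (by omega)]
      decide
    · rw [Fin.lt_def]; omega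
  span y hy := by
    rw [Matrix.matrix_eq_sum_single y]
    refine Submodule.sum_mem _ fun b _ => Submodule.sum_mem _ fun a _ => ?_
    by_cases h : y b a = 0
    · rw [h, Matrix.single_zero]; exact zero_mem _
    · have h1 : a < b := by
        by_contra hc; exact h (hy.2 b a hc)
      have h2 : (gl m n).par b ≠ (gl m n).par a := by
        by_contra hc; exact h (hy.1.2 b a (fun h2 => h2 hc))
      have h3 : (a : ℕ) < m ∧ m ≤ (b : ℕ) := by
        rw [Fin.lt_def] at h1
        simp only [par] at h2
        split_ifs at h2 <;> simp at h2 <;> omega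
      obtain ⟨k, hk⟩ := exists_glRoot h3.1 h3.2
      have e : Matrix.single b a (y b a) = y b a • (Matrix.single (glRoot m n k).2 (glRoot m n k).1 1) := by
        rw [hk, Matrix.smul_single, smul_eq_mul, mul_one]
      rw [e]
      exact Submodule.smul_mem _ _ (Submodule.subset_span ⟨k, rfl⟩)
  upper j k hjk := by
    -- Each product of matrix units vanishes unless the two roots share an index; then the order of
    -- the roots says that the resulting matrix unit lies strictly above the diagonal.
    rw [glRoot_lt_iff] at hjk
    refine add_mem ?_ ?_
    · by_cases h : (glRoot m n k).2 = (glRoot m n j).2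
      · rw [h, Matrix.single_mul_single_same]
        intro a b hab
        refine Matrix.single_apply_of_ne _ _ _ _ _ ?_
        rintro ⟨rfl, rfl⟩
        rw [h] at hjk
        exact hab (by simpa using hjk)
      · rw [Matrix.single_mul_single_of_ne _ _ _ _ h]; exact zero_mem _
    · by_cases h : (glRoot m n j).1 = (glRoot m n k).1
      · rw [h, Matrix.single_mul_single_same]
        intro a b hab
        refine Matrix.single_apply_of_ne _ _ _ _ _ ?_
        rintro ⟨rfl, rfl⟩
        rw [h] at hjk
        exact hab (by simpa using hjk)
      · rw [Matrix.single_mul_single_of_ne _ _ _ _ h]; exact zero_mem _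
  coroot k := by
    rw [Matrix.single_mul_single_same, Matrix.single_mul_single_same, mul_one, gl_dualEltMat]
  lower x hx k := by
    have h1 := glRoot_fst_lt k
    have h2 := le_glRoot_snd m n k
    set i := (glRoot m n k).1 with hi
    set j := (glRoot m n k).2 with hj
    -- The matrix units of the earlier roots. Left multiplication of `E_{ji}` by `x` produces those
    -- with `b < j`, right multiplication those with `b = j` and `a > i`.
    have hs : ∀ a b : Fin (gl m n).size, (a : ℕ) < m → m ≤ (b : ℕ) →
        (b < j ∨ (b = j ∧ i < a)) → ∀ c : K, Matrix.single b a c ∈ Submodule.span K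
          {y | ∃ j, j < k ∧ Matrix.single (glRoot m n j).2 (glRoot m n j).1 (1 : K) = y} := by
      intro a b ha hb hab c
      obtain ⟨l, hl⟩ := exists_glRoot ha hb
      have e : Matrix.single b a c = c • (Matrix.single (glRoot m n l).2 (glRoot m n l).1 1) := by
        rw [hl, Matrix.smul_single, smul_eq_mul, mul_one]
      rw [e]
      refine Submodule.smul_mem _ _ (Submodule.subset_span ⟨l, ?_, rfl⟩)
      rw [glRoot_lt_iff, hl]
      exact hab
    have hx1 : ∀ a b, x a b ≠ 0 → a < b ∧ ((a : ℕ) < m ↔ (b : ℕ) < m) := by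
      intro a b h
      refine ⟨by by_contra hc; exact h (hx.2 a b hc), ?_⟩
      have h3 := even_apply K _ hx.1 h
      simp only [par] at h3
      split_ifs at h3 <;> simp at h3 <;> omega
    rw [Matrix.matrix_eq_sum_single x, Finset.sum_mul, Finset.mul_sum]
    simp only [Finset.sum_mul, Finset.mul_sum]
    refine sub_mem (Submodule.sum_mem _ fun a _ => Submodule.sum_mem _ fun b _ => ?_)
      (Submodule.sum_mem _ fun a _ => Submodule.sum_mem _ fun b _ => ?_)
    · by_cases h : x a b = 0
      · rw [h, Matrix.single_zero, zero_mul]; exact zero_mem _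
      obtain ⟨h3, h4⟩ := hx1 a b h
      by_cases hbj : b = j
      · rw [hbj, Matrix.single_mul_single_same]
        rw [hbj] at h3 h4
        exact hs i a h1 (by omega) (Or.inl h3) _
      · rw [Matrix.single_mul_single_of_ne _ _ _ _ hbj]; exact zero_mem _
    · by_cases h : x a b = 0
      · rw [h, Matrix.single_zero, mul_zero]; exact zero_mem _
      obtain ⟨h3, h4⟩ := hx1 a b h
      by_cases hbj : i = a
      · rw [← hbj, Matrix.single_mul_single_same]
        rw [← hbj] at h3 h4
        exact hs b j (by omega) (by omega) (Or.inr ⟨rfl, h3⟩) _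
      · rw [Matrix.single_mul_single_of_ne _ _ _ _ hbj]; exact zero_mem _
  weight h hh k := by
    have hd : h = Matrix.diagonal fun q => h q q := by
      ext a b
      by_cases hab : a = b
      · rw [hab, Matrix.diagonal_apply_eq]
      · rw [hh.2 a b hab, Matrix.diagonal_apply_ne _ hab]
    conv_lhs => rw [hd]
    ext a b
    rw [Matrix.sub_apply, Matrix.diagonal_mul, Matrix.mul_diagonal, Matrix.smul_apply,
      Matrix.single_apply]
    split_ifs with h1
    · rw [← h1.1, ← h1.2, smul_eq_mul]; ring
    · simp
  rho k := by
    rw [rho_apply]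
    exact (gl_sum_posRoots k).trans (congrArg Neg.neg (gl_sum_root k).symm)

/-- The root vectors of `sl(m|n)`. -/
theorem oddRootData_sl [NeZero (2 : K)] (m n : ℕ) : OddRootData K (sl m n) (m * n) (glRoot m n)
    (fun k => Matrix.single (glRoot m n k).1 (glRoot m n k).2 1)
    (fun k => Matrix.single (glRoot m n k).2 (glRoot m n k).1 1) where
  mem_posOdd := (oddRootData_gl (K := K) m n).mem_posOdd
  e_mem k := ⟨⟨mem_algebra_of_diag_eq_zero_gl _ fun i =>
    ((oddRootData_gl (K := K) m n).e_mem k).1.2 i i (fun h => h rfl),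
    ((oddRootData_gl (K := K) m n).e_mem k).1.2⟩, ((oddRootData_gl (K := K) m n).e_mem k).2⟩
  f_mem k := ⟨⟨mem_algebra_of_diag_eq_zero_gl _ fun i =>
    ((oddRootData_gl (K := K) m n).f_mem k).1.2 i i (fun h => h rfl),
    ((oddRootData_gl (K := K) m n).f_mem k).1.2⟩, ((oddRootData_gl (K := K) m n).f_mem k).2⟩
  span y hy := (oddRootData_gl (K := K) m n).span y ⟨⟨trivial, hy.1.2⟩, hy.2⟩
  upper := (oddRootData_gl (K := K) m n).upper
  coroot := (oddRootData_gl (K := K) m n).coroot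
  lower x hx := (oddRootData_gl (K := K) m n).lower x ⟨⟨trivial, hx.1.2⟩, hx.2⟩
  weight h hh := (oddRootData_gl (K := K) m n).weight h ⟨trivial, hh.2⟩
  rho k := by
    rw [rho_apply]
    exact (gl_sum_posRoots k).trans (congrArg Neg.neg (gl_sum_root k).symm)

end Linear

end RootData

/-! ### Root vectors of `osp(2|2n)` -/

section OspRootData

variable {K : Type*} [Field K] {n : ℕ}

variable (n) in
/-- The index of the first basis vector. -/
def ospZero : Fin (osp n).size := ⟨0, by simp only [size]; omega⟩

/-- The index of the `k`-th odd basis vector. -/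
def ospOdd (k : Fin (2 * n)) : Fin (osp n).size := ⟨k + 1, by simp only [size]; omega⟩

variable (K) in
/-- The sign `B(e_q, e_{2n+1-q})`. -/
def ospEps (q : Fin (osp n).size) : K := ospForm K n q q.rev

theorem val_ospZero : (ospZero n : ℕ) = 0 := rfl

theorem val_ospOdd (k : Fin (2 * n)) : (ospOdd k : ℕ) = k + 1 := rfl

theorem val_osp_rev (q : Fin (osp n).size) : (q.rev : ℕ) = 2 * n + 1 - q := by
  rw [Fin.val_rev]; simp only [size]; omega

theorem ospEps_eq (q : Fin (osp n).size) :
    ospEps K q = if n < (q : ℕ) ∧ (q : ℕ) < 2 * n + 1 then -1 else 1 := by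
  have := q.2
  simp only [size] at this
  rw [ospEps, ospForm, if_pos (by rw [val_osp_rev]; omega)]

theorem ospEps_mul_self (q : Fin (osp n).size) : ospEps K q * ospEps K q = 1 := by
  rw [ospEps_eq]; split_ifs <;> ring

theorem ospEps_zero : ospEps K (ospZero n) = 1 := by
  rw [ospEps_eq, if_neg (by rw [val_ospZero]; omega)]

theorem ospEps_rev_zero : ospEps K (ospZero n).rev = 1 := by
  rw [ospEps_eq, if_neg (by rw [val_osp_rev, val_ospZero]; omega)]

theorem ospEps_rev_odd (k : Fin (2 * n)) : ospEps K (ospOdd k).rev = - ospEps K (ospOdd k) := by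
  have := k.2
  rw [ospEps_eq, ospEps_eq, val_osp_rev, val_ospOdd]
  split_ifs <;> first | omega | norm_num

theorem par_ospZero : (osp n).par (ospZero n) = 0 := by simp [par, val_ospZero]

theorem par_rev_ospZero : (osp n).par (ospZero n).rev = 0 := by
  simp only [par, val_osp_rev, val_ospZero]
  rw [if_pos (by omega)]

theorem par_ospOdd (k : Fin (2 * n)) : (osp n).par (ospOdd k) = 1 := by
  have := k.2
  change (if (ospOdd k : ℕ) = 0 ∨ (ospOdd k : ℕ) = 2 * n + 1 then (0 : ZMod 2) else 1) = 1
  rw [if_neg (by rw [val_ospOdd]; omega)]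

theorem par_rev_ospOdd (k : Fin (2 * n)) : (osp n).par (ospOdd k).rev = 1 := by
  have := k.2
  simp only [par, val_osp_rev, val_ospOdd]
  rw [if_neg (by omega)]

theorem osp_index_cases (q : Fin (osp n).size) :
    q = ospZero n ∨ q = (ospZero n).rev ∨ ∃ k, q = ospOdd k := by
  have hq := q.2
  simp only [size] at hq
  by_cases h0 : (q : ℕ) = 0
  · exact Or.inl (Fin.ext h0)
  by_cases h1 : (q : ℕ) = 2 * n + 1
  · right; left
    refine Fin.ext ?_
    rw [val_osp_rev, val_ospZero, h1]; rfl
  · right; right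
    refine ⟨⟨q - 1, by omega⟩, Fin.ext ?_⟩
    rw [val_ospOdd]
    simp only
    omega

theorem ospOdd_ne_zero (k : Fin (2 * n)) : ospOdd k ≠ ospZero n := fun h => by
  have := congrArg Fin.val h
  rw [val_ospOdd, val_ospZero] at this
  omega

theorem ospOdd_ne_rev_zero (k : Fin (2 * n)) : ospOdd k ≠ (ospZero n).rev := fun h => by
  have := congrArg Fin.val h
  have := k.2
  rw [val_ospOdd, val_osp_rev, val_ospZero] at *
  omega

theorem rev_ospZero_ne_zero : (ospZero n).rev ≠ ospZero n := fun h => by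
  have := congrArg Fin.val h
  rw [val_osp_rev, val_ospZero] at *
  omega

theorem rev_ospOdd_ne_zero (k : Fin (2 * n)) : (ospOdd k).rev ≠ ospZero n := fun h =>
  ospOdd_ne_rev_zero k (by rw [← h, Fin.rev_rev])

theorem ospOdd_injective {k l : Fin (2 * n)} (h : ospOdd k = ospOdd l) : k = l := by
  have := congrArg Fin.val h
  rw [val_ospOdd, val_ospOdd] at this
  exact Fin.ext (by omega)

/-- The Gram matrix is antidiagonal, so each defining equation involves just two entries of `x`. -/
theorem osp_mem_iff {x : (osp n).Mat K} : x ∈ (osp n).algebra K ↔ ∀ i j : Fin (osp n).size,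
    x j.rev i * ospEps K j.rev + ospSign K n i j * (ospEps K i * x i.rev j) = 0 := by
  refine forall₂_congr fun i j => ?_
  rw [transpose_mul_ospForm_apply, ospForm_mul_apply, ospEps, ospEps, Fin.rev_rev]

variable (K) in
/-- The root vector of the positive odd root `ε_0 - ε_{k+1}`. -/
def ospE (k : Fin (2 * n)) : (osp n).Mat K :=
  Matrix.single (ospZero n) (ospOdd k) 1 +
    ospEps K (ospOdd k) • Matrix.single (ospOdd k).rev (ospZero n).rev 1

variable (K) in
/-- The root vector of the negative odd root `ε_{k+1} - ε_0`. -/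
def ospF (k : Fin (2 * n)) : (osp n).Mat K :=
  Matrix.single (ospOdd k) (ospZero n) 1 -
    ospEps K (ospOdd k) • Matrix.single (ospZero n).rev (ospOdd k).rev 1

theorem ospE_apply (k : Fin (2 * n)) (p q : Fin (osp n).size) : ospE K k p q =
    (if ospZero n = p ∧ ospOdd k = q then 1 else 0) +
      ospEps K (ospOdd k) * (if (ospOdd k).rev = p ∧ (ospZero n).rev = q then 1 else 0) := rfl

theorem ospF_apply (k : Fin (2 * n)) (p q : Fin (osp n).size) : ospF K k p q =
    (if ospOdd k = p ∧ ospZero n = q then 1 else 0) -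
      ospEps K (ospOdd k) * (if (ospZero n).rev = p ∧ (ospOdd k).rev = q then 1 else 0) := rfl

theorem ospSign_eq_one {i j : Fin (osp n).size} (h : (osp n).par i = 0) : ospSign K n i j = 1 := by
  rw [ospSign, if_neg]
  rintro ⟨h1, -⟩
  rw [h] at h1
  exact zero_ne_one h1

theorem ospSign_eq_neg_one {i j : Fin (osp n).size} (h : (osp n).par i = 1)
    (h' : (osp n).par j = 0) : ospSign K n i j = -1 := if_pos ⟨h, h'⟩

theorem ospF_mem (k : Fin (2 * n)) : ospF K k ∈ (osp n).gNeg K := by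
  have hk := k.2
  refine ⟨⟨?_, fun i j h => ?_⟩, fun i j h => ?_⟩
  · refine osp_mem_iff.2 ?_
    intro i j
    have hj : ∀ a : Fin (osp n).size, a = j.rev ↔ a.rev = j := fun a =>
      ⟨fun h => by rw [h, Fin.rev_rev], fun h => by rw [← h, Fin.rev_rev]⟩
    have hi : ∀ a : Fin (osp n).size, a = i.rev ↔ a.rev = i := fun a =>
      ⟨fun h => by rw [h, Fin.rev_rev], fun h => by rw [← h, Fin.rev_rev]⟩
    rw [ospF_apply, ospF_apply]
    simp only [hi, hj, Fin.rev_rev]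
    -- The matrix has two nonzero entries, and they occur together in the defining equations; only
    -- two pairs `(i, j)` give an equation that is not `0 = 0`.
    by_cases h1 : ospZero n = i ∧ (ospOdd k).rev = j
    · obtain ⟨rfl, rfl⟩ := h1
      rw [if_pos ⟨rfl, rfl⟩, if_neg (fun h => rev_ospOdd_ne_zero k h.2),
        if_neg (fun h => rev_ospOdd_ne_zero k h.1), if_pos ⟨rfl, rfl⟩, Fin.rev_rev,
        ospSign_eq_one par_ospZero, ospEps_zero]
      ring
    by_cases h2 : (ospOdd k).rev = i ∧ ospZero n = j
    · obtain ⟨rfl, rfl⟩ := h2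
      rw [if_neg (fun h => rev_ospOdd_ne_zero k h.1), if_pos ⟨rfl, rfl⟩, if_pos ⟨rfl, rfl⟩,
        if_neg (fun h => rev_ospOdd_ne_zero k h.2),
        ospSign_eq_neg_one (par_rev_ospOdd k) par_ospZero, ospEps_rev_odd, ospEps_rev_zero]
      ring
    · rw [if_neg (fun h => h1 h.symm), if_neg (fun h => h2 h.symm), if_neg h2, if_neg h1]
      ring
  · rw [ospF_apply, if_neg, if_neg, mul_zero, sub_zero]
    · rintro ⟨rfl, rfl⟩
      exact h (by beta_reduce; rw [par_rev_ospZero, par_rev_ospOdd]; decide)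
    · rintro ⟨rfl, rfl⟩
      exact h (by beta_reduce; rw [par_ospZero, par_ospOdd]; decide)
  · rw [ospF_apply, if_neg, if_neg, mul_zero, sub_zero]
    · rintro ⟨rfl, rfl⟩
      exact h (by beta_reduce; rw [Fin.lt_def, val_osp_rev, val_osp_rev, val_ospOdd, val_ospZero]; omega)
    · rintro ⟨rfl, rfl⟩
      exact h (by beta_reduce; rw [Fin.lt_def, val_ospOdd, val_ospZero]; omega)

theorem ospE_mem (k : Fin (2 * n)) : ospE K k ∈ (osp n).gOne K := by
  have hk := k.2
  refine ⟨⟨?_, fun i j h => ?_⟩, fun i j h => ?_⟩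
  · refine osp_mem_iff.2 ?_
    intro i j
    have hj : ∀ a : Fin (osp n).size, a = j.rev ↔ a.rev = j := fun a =>
      ⟨fun h => by rw [h, Fin.rev_rev], fun h => by rw [← h, Fin.rev_rev]⟩
    have hi : ∀ a : Fin (osp n).size, a = i.rev ↔ a.rev = i := fun a =>
      ⟨fun h => by rw [h, Fin.rev_rev], fun h => by rw [← h, Fin.rev_rev]⟩
    rw [ospE_apply, ospE_apply]
    simp only [hi, hj, Fin.rev_rev]
    by_cases h1 : ospOdd k = i ∧ (ospZero n).rev = j
    · obtain ⟨rfl, rfl⟩ := h1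
      rw [if_pos ⟨rfl, rfl⟩, if_neg (fun h => ospOdd_ne_rev_zero k h.1),
        if_neg (fun h => ospOdd_ne_rev_zero k h.1.symm), if_pos ⟨rfl, rfl⟩, Fin.rev_rev,
        ospSign_eq_neg_one (par_ospOdd k) par_rev_ospZero, ospEps_zero]
      have := ospEps_mul_self (K := K) (ospOdd k)
      linear_combination -this
    by_cases h2 : (ospZero n).rev = i ∧ ospOdd k = j
    · obtain ⟨rfl, rfl⟩ := h2
      rw [if_neg (fun h => ospOdd_ne_rev_zero k h.2), if_pos ⟨rfl, rfl⟩, if_pos ⟨rfl, rfl⟩,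
        if_neg (fun h => ospOdd_ne_rev_zero k h.1),
        ospSign_eq_one par_rev_ospZero, ospEps_rev_odd, ospEps_rev_zero]
      have := ospEps_mul_self (K := K) (ospOdd k)
      linear_combination -this
    · rw [if_neg (fun h => h1 h.symm), if_neg (fun h => h2 h.symm), if_neg h2, if_neg h1]
      ring
  · rw [ospE_apply, if_neg, if_neg, mul_zero, add_zero]
    · rintro ⟨rfl, rfl⟩
      exact h (by beta_reduce; rw [par_rev_ospZero, par_rev_ospOdd]; decide)
    · rintro ⟨rfl, rfl⟩
      exact h (by beta_reduce; rw [par_ospZero, par_ospOdd]; decide)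
  · rw [ospE_apply, if_neg, if_neg, mul_zero, add_zero]
    · rintro ⟨rfl, rfl⟩
      exact h (by beta_reduce; rw [Fin.lt_def, val_osp_rev, val_osp_rev, val_ospOdd, val_ospZero]; omega)
    · rintro ⟨rfl, rfl⟩
      exact h (by beta_reduce; rw [Fin.lt_def, val_ospOdd, val_ospZero]; omega)

theorem ospF_apply_zero (k : Fin (2 * n)) (p : Fin (osp n).size) :
    ospF K k p (ospZero n) = if ospOdd k = p then 1 else 0 := by
  simp [ospF_apply, rev_ospOdd_ne_zero]

/-- An element of `𝔤_{-1}` has nonzero entries only in the first column and the last row, and the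
form determines the last row from the first column. -/
theorem osp_gNeg_eq_zero {z : (osp n).Mat K} (hz : z ∈ (osp n).gNeg K)
    (h : ∀ k : Fin (2 * n), z (ospOdd k) (ospZero n) = 0) : z = 0 := by
  ext p q
  by_contra hc
  have h1 : q < p := by by_contra h2; exact hc (hz.2 p q h2)
  have h2 : (osp n).par p ≠ (osp n).par q := by
    intro h2; exact hc (hz.1.2 p q (fun h3 => h3 h2))
  rcases osp_index_cases p with rfl | rfl | ⟨k, rfl⟩
  · exact absurd h1 (by rw [Fin.lt_def, val_ospZero]; omega)
  · have h3 := osp_mem_iff.1 hz.1.1 (ospZero n) q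
    rw [ospSign_eq_one par_ospZero, ospEps_zero] at h3
    rcases osp_index_cases q.rev with h4 | h4 | ⟨k, h4⟩
    · rw [← Fin.rev_rev q, h4] at h1
      exact lt_irrefl _ h1
    · rw [Fin.rev_injective h4, par_ospZero, par_rev_ospZero] at h2
      exact h2 rfl
    · rw [h4, h k] at h3
      exact hc (by simpa using h3)
  · rcases osp_index_cases q with rfl | rfl | ⟨l, rfl⟩
    · exact hc (h k)
    · have := k.2
      exact absurd h1 (by rw [Fin.lt_def, val_osp_rev, val_ospZero, val_ospOdd]; omega)
    · rw [par_ospOdd, par_ospOdd] at h2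
      exact h2 rfl

/-- The coordinates with respect to the `f_k` are the entries of the first column. Brackets with
`f_k` can therefore be computed from that column alone. -/
theorem osp_gNeg_eq_sum {y : (osp n).Mat K} (hy : y ∈ (osp n).gNeg K) :
    y = ∑ k : Fin (2 * n), y (ospOdd k) (ospZero n) • ospF K k := by
  rw [← sub_eq_zero]
  refine osp_gNeg_eq_zero (sub_mem hy (Submodule.sum_mem _ fun k _ =>
    Submodule.smul_mem _ _ (ospF_mem k))) fun l => ?_
  rw [Matrix.sub_apply, Matrix.sum_apply, sub_eq_zero, Finset.sum_eq_single l]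
  · rw [Matrix.smul_apply, ospF_apply_zero, if_pos rfl, smul_eq_mul, mul_one]
  · intro k _ hk
    rw [Matrix.smul_apply, ospF_apply_zero, if_neg (fun h => hk (ospOdd_injective h)), smul_zero]
  · simp

theorem mul_ospF_apply_zero (x : (osp n).Mat K) (k : Fin (2 * n)) (p : Fin (osp n).size) :
    (x * ospF K k) p (ospZero n) = x p (ospOdd k) := by
  simp [Matrix.mul_apply, ospF_apply_zero]

theorem ospF_mul_apply_odd (x : (osp n).Mat K) (k l : Fin (2 * n)) (q : Fin (osp n).size) :
    (ospF K k * x) (ospOdd l) q = if k = l then x (ospZero n) q else 0 := by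
  rw [Matrix.mul_apply, Finset.sum_eq_single (ospZero n)]
  · rw [ospF_apply_zero]
    by_cases h : k = l
    · rw [if_pos (by rw [h]), if_pos h, one_mul]
    · rw [if_neg (fun h2 => h (ospOdd_injective h2)), if_neg h, zero_mul]
  · intro b _ hb
    rw [ospF_apply, if_neg (fun h => hb h.2.symm),
      if_neg (fun h => ospOdd_ne_rev_zero l h.1.symm)]
    ring
  · simp

theorem ospE_mul_ospF (j k : Fin (2 * n)) (h : j ≠ k) : ospE K k * ospF K j + ospF K j * ospE K k =
    Matrix.single (ospOdd j) (ospOdd k) 1 -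
      (ospEps K (ospOdd k) * ospEps K (ospOdd j)) • Matrix.single (ospOdd k).rev (ospOdd j).rev 1 := by
  have h1 : ospOdd k ≠ ospOdd j := fun hc => h (ospOdd_injective hc).symm
  have h2 : (ospOdd j).rev ≠ (ospOdd k).rev := fun hc => h1 (Fin.rev_injective hc).symm
  have h3 := ospOdd_ne_rev_zero k
  have h4 := ospOdd_ne_rev_zero j
  have h5 := rev_ospOdd_ne_zero k
  have h6 := rev_ospOdd_ne_zero j
  rw [ospE, ospF]
  simp only [Matrix.smul_single, smul_eq_mul, add_mul, mul_add, sub_mul, mul_sub,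
    Matrix.single_mul_single_same, Matrix.single_mul_single_of_ne _ _ _ _ h1,
    Matrix.single_mul_single_of_ne _ _ _ _ h2, Matrix.single_mul_single_of_ne _ _ _ _ h3,
    Matrix.single_mul_single_of_ne _ _ _ _ h4.symm, Matrix.single_mul_single_of_ne _ _ _ _ h5.symm,
    Matrix.single_mul_single_of_ne _ _ _ _ h6, mul_one]
  rw [mul_comm (ospEps K (ospOdd k))]
  abel

theorem ospE_mul_ospF_self (k : Fin (2 * n)) : ospE K k * ospF K k + ospF K k * ospE K k =
    (Matrix.single (ospZero n) (ospZero n) 1 - Matrix.single (ospZero n).rev (ospZero n).rev 1) +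
    (Matrix.single (ospOdd k) (ospOdd k) 1 - Matrix.single (ospOdd k).rev (ospOdd k).rev 1) := by
  have h3 := ospOdd_ne_rev_zero k
  have h5 := rev_ospOdd_ne_zero k
  rw [ospE, ospF]
  simp only [Matrix.smul_single, smul_eq_mul, add_mul, mul_add, sub_mul, mul_sub,
    Matrix.single_mul_single_same, Matrix.single_mul_single_of_ne _ _ _ _ h3,
    Matrix.single_mul_single_of_ne _ _ _ _ h3.symm, Matrix.single_mul_single_of_ne _ _ _ _ h5.symm,
    Matrix.single_mul_single_of_ne _ _ _ _ h5, mul_one, ospEps_mul_self]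
  abel

theorem osp_dualEltMat (k : Fin (2 * n)) : (osp n).dualEltMat K (ospZero n, ospOdd k) =
    (Matrix.single (ospZero n) (ospZero n) 1 - Matrix.single (ospZero n).rev (ospZero n).rev 1) +
    (Matrix.single (ospOdd k) (ospOdd k) 1 - Matrix.single (ospOdd k).rev (ospOdd k).rev 1) := by
  have h1 : sgn K (osp n) (ospZero n) = 1 := by rw [sgn, par_ospZero, if_pos rfl]
  have h2 : sgn K (osp n) (ospOdd k) = -1 := by
    rw [sgn, par_ospOdd, if_neg one_ne_zero]
  rw [dualEltMat, h1, h2, one_smul, neg_one_smul, sub_neg_eq_add]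
  rfl

theorem osp_dualEltMat_apply (k : Fin (2 * n)) (q : Fin (osp n).size) :
    (osp n).dualEltMat K (ospZero n, ospOdd k) q q =
      (if q = ospZero n then 1 else 0) - (if q = (ospZero n).rev then 1 else 0) +
      ((if q = ospOdd k then 1 else 0) - (if q = (ospOdd k).rev then 1 else 0)) := by
  rw [osp_dualEltMat, Matrix.add_apply, Matrix.sub_apply, Matrix.sub_apply, Matrix.single_apply,
    Matrix.single_apply, Matrix.single_apply, Matrix.single_apply]
  simp only [and_self, eq_comm]

/-- Each of the `k` earlier roots contributes `1` through `ε_0`. A further `1` comes from the root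
whose second index is the reverse of that of `β_k`; it is number `2n - 1 - k`, which is earlier
exactly if `n ≤ k`. -/
theorem osp_sum_root (k : Fin (2 * n)) :
    ∑ j : Fin (2 * n), (if j < k then
      (osp n).dualEltMat K (ospZero n, ospOdd k) (ospZero n) (ospZero n) -
      (osp n).dualEltMat K (ospZero n, ospOdd k) (ospOdd j) (ospOdd j) else 0) =
      (k : ℕ) + if n ≤ (k : ℕ) then 1 else 0 := by
  have hk := k.2
  have e : ∀ j : Fin (2 * n), (if j < k then
      (osp n).dualEltMat K (ospZero n, ospOdd k) (ospZero n) (ospZero n) -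
      (osp n).dualEltMat K (ospZero n, ospOdd k) (ospOdd j) (ospOdd j) else 0) =
      (if 0 ≤ (j : ℕ) ∧ (j : ℕ) < k then 1 else 0) +
      (if n ≤ (k : ℕ) then (if 2 * n - 1 - k ≤ (j : ℕ) ∧ (j : ℕ) < 2 * n - k then 1 else 0) else 0) := by
    intro j
    have hj := j.2
    rw [osp_dualEltMat_apply, osp_dualEltMat_apply, if_pos rfl, if_neg rev_ospZero_ne_zero.symm,
      if_neg (ospOdd_ne_zero k).symm, if_neg (rev_ospOdd_ne_zero k).symm, if_neg (ospOdd_ne_zero j),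
      if_neg (ospOdd_ne_rev_zero j)]
    simp only [Fin.ext_iff, Fin.lt_def, val_osp_rev, val_ospOdd]
    split_ifs <;> first | omega | norm_num
  simp only [e, Finset.sum_add_distrib]
  rw [sum_interval (by omega) (by omega)]
  congr 1
  · simp
  · split_ifs with h
    · rw [sum_interval (by omega) (by omega), show 2 * n - (k : ℕ) = (2 * n - 1 - k) + 1 by omega]
      push_cast
      ring
    · simp

theorem osp_sum_posRoots [NeZero (2 : K)] (k : Fin (2 * n)) :
    2⁻¹ * ∑ a, ∑ b, (if (a, b) ∈ (osp n).posRoots then sgn K (osp n) a * sgn K (osp n) b else 0) *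
      ((osp n).dualEltMat K (ospZero n, ospOdd k) a a -
        (osp n).dualEltMat K (ospZero n, ospOdd k) b b) =
    - ((k : ℕ) + if n ≤ (k : ℕ) then 1 else 0) := by
  rw [sum_mul_sub]
  simp only [osp_dualEltMat_apply]
  have hk := k.2
  have hN : (osp n).size = 2 * n + 2 := rfl
  have hsgn : ∀ q : Fin (osp n).size, sgn K (osp n) q =
      if (q : ℕ) = 0 ∨ (q : ℕ) = 2 * n + 1 then 1 else -1 := by
    intro q
    simp only [sgn, par]
    split_ifs <;> simp_all
  have hmem : ∀ a b : Fin (osp n).size, (a, b) ∈ (osp n).posRoots ↔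
      (a : ℕ) < b ∧ (a : ℕ) + b ≤ 2 * n + 1 ∧ ¬ ((a : ℕ) = 0 ∧ (b : ℕ) = 2 * n + 1) := by
    intro a b
    simp [posRoots]
  simp only [hmem, hsgn]
  -- The coefficient of `2ρ` at the diagonal entry `q`. As `posRoots` lists one of the two pairs for
  -- each root, `X q` and `X q.rev` are not opposite, and only their difference, which `t_β` picks
  -- out, is meaningful. The values for `1 ≤ q ≤ n` and `n < q ≤ 2n` are computed separately.
  set X : Fin (osp n).size → K := fun q =>
    ∑ b : Fin (osp n).size, (if (q : ℕ) < b ∧ (q : ℕ) + b ≤ 2 * n + 1 ∧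
      ¬ ((q : ℕ) = 0 ∧ (b : ℕ) = 2 * n + 1) then
      (if (q : ℕ) = 0 ∨ (q : ℕ) = 2 * n + 1 then (1 : K) else -1) *
      (if (b : ℕ) = 0 ∨ (b : ℕ) = 2 * n + 1 then 1 else -1) else 0) -
    ∑ a : Fin (osp n).size, (if (a : ℕ) < q ∧ (a : ℕ) + q ≤ 2 * n + 1 ∧
      ¬ ((a : ℕ) = 0 ∧ (q : ℕ) = 2 * n + 1) then
      (if (a : ℕ) = 0 ∨ (a : ℕ) = 2 * n + 1 then (1 : K) else -1) *
      (if (q : ℕ) = 0 ∨ (q : ℕ) = 2 * n + 1 then 1 else -1) else 0) with hX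
  have hsum : ∀ G H : Fin (osp n).size → K, (∀ b, G b = H b) → ∑ b, G b = ∑ b, H b :=
    fun G H h => Finset.sum_congr rfl fun b _ => h b
  have hX0 : ∀ q : Fin (osp n).size, (q : ℕ) = 0 → X q = - (2 * n : ℕ) := by
    intro q hq
    simp only [hX]
    rw [hsum _ (fun b => - (if 1 ≤ (b : ℕ) ∧ (b : ℕ) < 2 * n + 1 then 1 else 0)) (by
        intro b
        have := b.2
        split_ifs <;> first | omega | norm_num),
      hsum (fun a : Fin (osp n).size => (if (a : ℕ) < q ∧ _ then _ else (0 : K))) (fun b => 0) (by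
        intro b
        rw [if_neg (by omega)]),
      Finset.sum_neg_distrib, sum_interval (by omega) (by omega)]
    simp
  have hXN : X (ospZero n).rev = 0 := by
    simp only [hX, val_osp_rev, val_ospZero]
    rw [hsum _ (fun b => 0) (by
        intro b
        rw [if_neg (by omega)]),
      hsum (fun a : Fin (osp n).size => (if (a : ℕ) < 2 * n + 1 - 0 ∧ _ then _ else (0 : K)))
        (fun b => 0) (by
        intro b
        rw [if_neg (by omega)])]
    simp
  have hX1 : ∀ q : Fin (osp n).size, 1 ≤ (q : ℕ) → (q : ℕ) ≤ n → X q = 2 * n + 3 - 3 * (q : ℕ) := by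
    intro q h1 h2
    simp only [hX]
    rw [hsum _ (fun b => (if (q : ℕ) + 1 ≤ (b : ℕ) ∧ (b : ℕ) < 2 * n + 2 - q then 1 else 0)) (by
        intro b
        have := b.2
        split_ifs <;> first | omega | norm_num),
      hsum (fun a : Fin (osp n).size => (if (a : ℕ) < q ∧ _ then _ else (0 : K)))
        (fun b => (if 1 ≤ (b : ℕ) ∧ (b : ℕ) < q then 1 else 0) -
          (if 0 ≤ (b : ℕ) ∧ (b : ℕ) < 1 then 1 else 0)) (by
        intro b
        split_ifs <;> first | omega | norm_num),
      Finset.sum_sub_distrib, sum_interval (by omega) (by omega), sum_interval (by omega) (by omega),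
      sum_interval (by omega) (by omega), Nat.cast_sub (by omega)]
    push_cast
    ring
  have hX2 : ∀ q : Fin (osp n).size, n < (q : ℕ) → (q : ℕ) ≤ 2 * n → X q = (q : ℕ) - 2 * n := by
    intro q h1 h2
    simp only [hX]
    rw [hsum _ (fun b => 0) (by
        intro b
        rw [if_neg (by omega)]),
      hsum (fun a : Fin (osp n).size => (if (a : ℕ) < q ∧ _ then _ else (0 : K)))
        (fun b => (if 1 ≤ (b : ℕ) ∧ (b : ℕ) < 2 * n + 2 - q then 1 else 0) -
          (if 0 ≤ (b : ℕ) ∧ (b : ℕ) < 1 then 1 else 0)) (by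
        intro b
        split_ifs <;> first | omega | norm_num),
      Finset.sum_sub_distrib, sum_interval (by omega) (by omega),
      sum_interval (by omega) (by omega), Nat.cast_sub (by omega)]
    push_cast
    simp
    ring
  change 2⁻¹ * ∑ q, ((if q = ospZero n then 1 else 0) - (if q = (ospZero n).rev then 1 else 0) +
      ((if q = ospOdd k then 1 else 0) - (if q = (ospOdd k).rev then 1 else 0))) * X q = _
  clear_value X
  simp only [add_mul, sub_mul, ite_mul, one_mul, zero_mul, Finset.sum_add_distrib,
    Finset.sum_sub_distrib, Finset.sum_ite_eq', Finset.mem_univ, if_true]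
  change 2⁻¹ * (X (ospZero n) - X (ospZero n).rev + (X (ospOdd k) - X (ospOdd k).rev)) = _
  have h2 : (2 : K) ≠ 0 := NeZero.ne _
  have hrev : ((ospOdd k).rev : ℕ) = 2 * n - k := by rw [val_osp_rev, val_ospOdd]; omega
  rw [hX0 _ rfl, hXN]
  split_ifs with h
  · rw [hX2 (ospOdd k) (by rw [val_ospOdd]; omega) (by rw [val_ospOdd]; omega),
      hX1 (ospOdd k).rev (by omega) (by omega), hrev, val_ospOdd, Nat.cast_sub (by omega)]
    push_cast
    field_simp
    ring
  · rw [hX1 (ospOdd k) (by rw [val_ospOdd]; omega) (by rw [val_ospOdd]; omega),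
      hX2 (ospOdd k).rev (by omega) (by omega), hrev, val_ospOdd, Nat.cast_sub (by omega)]
    push_cast
    field_simp
    ring

/-- The root vectors of `osp(2|2n)`. -/
theorem oddRootData_osp [NeZero (2 : K)] (n : ℕ) : OddRootData K (osp n) (2 * n)
    (fun k => (ospZero n, ospOdd k)) (ospE K) (ospF K) where
  mem_posOdd k := by
    have := k.2
    simp only [posOdd, posRoots, Finset.mem_filter, Finset.mem_univ, true_and, Fin.lt_def,
      par_ospZero, par_ospOdd, val_ospZero, val_ospOdd]
    exact ⟨by omega, by decide⟩
  e_mem := ospE_mem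
  f_mem := ospF_mem
  span y hy := by
    rw [osp_gNeg_eq_sum hy]
    exact Submodule.sum_mem _ fun k _ => Submodule.smul_mem _ _ (Submodule.subset_span ⟨k, rfl⟩)
  upper j k hjk := by
    have hj := j.2
    have hk := k.2
    rw [ospE_mul_ospF j k hjk.ne]
    rw [Fin.lt_def] at hjk
    refine sub_mem ?_ (Submodule.smul_mem _ _ ?_) <;> intro a b hab <;>
      refine Matrix.single_apply_of_ne _ _ _ _ _ ?_ <;> rintro ⟨rfl, rfl⟩ <;> apply hab
    · rw [Fin.lt_def, val_ospOdd, val_ospOdd]; omega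
    · rw [Fin.lt_def, val_osp_rev, val_osp_rev, val_ospOdd, val_ospOdd]; omega
  coroot k := by rw [ospE_mul_ospF_self, osp_dualEltMat]
  lower x hx k := by
    -- In the first column the bracket has the entries of the column of `x` belonging to `k`, as `x`
    -- has zero diagonal; they vanish unless `l < k`.
    rw [osp_gNeg_eq_sum (bracket_gNeg_mem hx.1 (ospF_mem k))]
    refine Submodule.sum_mem _ fun l _ => ?_
    rw [Matrix.sub_apply, mul_ospF_apply_zero, ospF_mul_apply_odd,
      hx.2 (ospZero n) (ospZero n) (lt_irrefl _), ite_self, sub_zero]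
    by_cases h : x (ospOdd l) (ospOdd k) = 0
    · rw [h, zero_smul]; exact zero_mem _
    · refine Submodule.smul_mem _ _ (Submodule.subset_span ⟨l, ?_, rfl⟩)
      have h1 : ospOdd l < ospOdd k := by by_contra hc; exact h (hx.2 _ _ hc)
      rw [Fin.lt_def, val_ospOdd, val_ospOdd] at h1
      rw [Fin.lt_def]
      omega
  weight h hh k := by
    rw [osp_gNeg_eq_sum (bracket_gNeg_mem (cartan_le_even K _ hh) (ospF_mem k)),
      Finset.sum_eq_single k]
    · rw [Matrix.sub_apply, mul_ospF_apply_zero, ospF_mul_apply_odd, if_pos rfl]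
    · intro l _ hl
      rw [Matrix.sub_apply, mul_ospF_apply_zero, ospF_mul_apply_odd, if_neg (Ne.symm hl),
        hh.2 _ _ (fun hc => hl (ospOdd_injective hc)), sub_zero, zero_smul]
    · simp
  rho k := by
    rw [rho_apply]
    exact (osp_sum_posRoots k).trans (congrArg Neg.neg (osp_sum_root k).symm)

end OspRootData

/-- Each of the Lie superalgebras has root vectors as in `OddRootData`. -/
theorem exists_oddRootData (K : Type*) [Field K] [NeZero (2 : K)] (T : TypeI) :
    ∃ (d : ℕ) (β : Fin d → Fin T.size × Fin T.size) (e f : Fin d → T.Mat K),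
      OddRootData K T d β e f := by
  cases T with
  | gl m n => exact ⟨_, _, _, _, oddRootData_gl m n⟩
  | sl m n => exact ⟨_, _, _, _, oddRootData_sl m n⟩
  | osp n => exact ⟨_, _, _, _, oddRootData_osp n⟩

/-! ### Conjugation of `𝔤` by elements of the group of `𝔤_0̄` -/

section GroupElements

variable {K : Type*} [Field K] {T : TypeI} {g : (T.Mat K)ˣ}

/-- The sign in the relation defining `osp` depends only on the parities of row and column, which a
parity-preserving factor does not mix. -/
theorem sign_relation_mul {n : ℕ} {A C h : (osp n).Mat K}
    (hh : h ∈ supported fun i j => (osp n).par i = (osp n).par j)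
    (hAC : ∀ i j, A i j = - (ospSign K n i j * C i j)) (i j : Fin (osp n).size) :
    (A * h) i j = - (ospSign K n i j * (C * h) i j) := by
  rw [Matrix.mul_apply, Matrix.mul_apply, Finset.mul_sum, ← Finset.sum_neg_distrib]
  refine Finset.sum_congr rfl fun k _ => ?_
  by_cases hk : h k j = 0
  · rw [hk]; ring
  · have hp : (osp n).par k = (osp n).par j := by
      by_contra hc; exact hk (hh k j hc)
    rw [hAC, (ospSign_mul K n k j i hp).2]; ring

theorem sign_relation_transpose_mul {n : ℕ} {A C h : (osp n).Mat K}
    (hh : h ∈ supported fun i j => (osp n).par i = (osp n).par j)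
    (hAC : ∀ i j, A i j = - (ospSign K n i j * C i j)) (i j : Fin (osp n).size) :
    (h.transpose * A) i j = - (ospSign K n i j * (h.transpose * C) i j) := by
  rw [Matrix.mul_apply, Matrix.mul_apply, Finset.mul_sum, ← Finset.sum_neg_distrib]
  refine Finset.sum_congr rfl fun k _ => ?_
  rw [Matrix.transpose_apply]
  by_cases hk : h k i = 0
  · rw [hk]; ring
  · have hp : (osp n).par k = (osp n).par i := by
      by_contra hc; exact hk (hh k i hc)
    rw [hAC, (ospSign_mul K n k i j hp).1]; ring

theorem IsGroupElt.conj_mem_algebra (hg : IsGroupElt K T g) {x : T.Mat K}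
    (hx : x ∈ T.algebra K) : (g : T.Mat K) * x * ((g⁻¹ : (T.Mat K)ˣ) : T.Mat K) ∈ T.algebra K := by
  have hiso := hg.isometry
  cases T with
  | gl m n => trivial
  | sl m n =>
    have h0 : str K (sl m n) x = 0 := hx
    change str K (sl m n) _ = 0
    rw [str_eq_trace] at h0 ⊢
    rw [← Matrix.mul_assoc, ← Matrix.mul_assoc, sgn_commute K _ hg.even, Matrix.trace_mul_comm,
      ← Matrix.mul_assoc, ← Matrix.mul_assoc, Units.inv_mul, Matrix.one_mul, h0]
  | osp n =>
    have h2 : (g : (osp n).Mat K).transpose * ospForm K n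
        = ospForm K n * ((g⁻¹ : ((osp n).Mat K)ˣ) : (osp n).Mat K) := by
      rw [← hiso.1, Matrix.mul_assoc _ (g : (osp n).Mat K), Units.mul_inv, Matrix.mul_one, hiso.1]
    have h3 : ((g⁻¹ : ((osp n).Mat K)ˣ) : (osp n).Mat K).transpose * ospForm K n
        = ospForm K n * (g : (osp n).Mat K) := by
      have h4 := congrArg (fun z => ((g⁻¹ : ((osp n).Mat K)ˣ) : (osp n).Mat K).transpose * z *
        (g : (osp n).Mat K)) h2
      rw [← Matrix.mul_assoc, ← Matrix.transpose_mul, Units.mul_inv, Matrix.transpose_one,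
        Matrix.one_mul, Matrix.mul_assoc, Matrix.mul_assoc, Units.inv_mul, Matrix.mul_one] at h4
      exact h4.symm
    have h5 := sign_relation_mul hg.even_inv (sign_relation_transpose_mul hg.even_inv
      ((osp_iff K).1 hx))
    refine (osp_iff K).2 fun i j => ?_
    have h6 := h5 i j
    rw [← Matrix.mul_assoc _ (ospForm K n), h3] at h6
    rw [Matrix.transpose_mul, Matrix.transpose_mul, Matrix.mul_assoc, Matrix.mul_assoc, h2]
    simp only [Matrix.mul_assoc] at h6 ⊢
    exact h6

/-- For `osp(2|2n)` parity does not determine the degree: the two even basis vectors have degrees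
`1` and `-1`. Being the identity on the even part excludes mixing them. -/
theorem hasDeg_of_supported {x : T.Mat K} (hx : x ∈ supported fun i j => T.par i = T.par j)
    (h1 : ∀ n, T = osp n → ∀ i j, T.par i = 0 → x i j = (1 : T.Mat K) i j) : HasDeg 0 x := by
  intro i j hij
  have hp : T.par i = T.par j := by
    by_contra hc; exact hij (hx i j hc)
  rw [add_zero]
  cases T with
  | gl m n =>
    simp only [par, deg] at hp ⊢
    split_ifs at hp ⊢ <;> simp_all
  | sl m n =>
    simp only [par, deg] at hp ⊢
    split_ifs at hp ⊢ <;> simp_all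
  | osp n =>
    by_cases h : (osp n).par i = 0
    · rw [h1 n rfl i j h] at hij
      rw [show i = j by by_contra hc; exact hij (Matrix.one_apply_ne hc)]
    · have h' : (osp n).par j ≠ 0 := hp ▸ h
      simp only [par, deg] at h h' ⊢
      split_ifs at h h' ⊢ <;> simp_all

theorem IsGroupElt.hasDeg (hg : IsGroupElt K T g) : HasDeg 0 (g : T.Mat K) := by
  refine hasDeg_of_supported hg.even ?_
  rintro n rfl
  exact hg.isometry.2

theorem IsGroupElt.hasDeg_inv (hg : IsGroupElt K T g) :
    HasDeg 0 ((g⁻¹ : (T.Mat K)ˣ) : T.Mat K) := by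
  refine hasDeg_of_supported hg.even_inv ?_
  rintro n rfl i j hi
  have h : ((g : (osp n).Mat K) * ((g⁻¹ : ((osp n).Mat K)ˣ) : (osp n).Mat K)) i j =
      (1 : (osp n).Mat K) i j := by rw [Units.mul_inv]
  rw [Matrix.mul_apply, Finset.sum_eq_single i] at h
  · rwa [hg.isometry.2 i i hi, Matrix.one_apply_eq, one_mul] at h
  · intro k _ hk
    rw [hg.isometry.2 i k hi, Matrix.one_apply_ne (Ne.symm hk), zero_mul]
  · simp

variable (g) in
/-- Conjugation by a group element, as a linear map. -/
def conjMat : T.Mat K →ₗ[K] T.Mat K :=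
  LinearMap.mulLeft K (g : T.Mat K) ∘ₗ LinearMap.mulRight K ((g⁻¹ : (T.Mat K)ˣ) : T.Mat K)

theorem conjMat_apply (x : T.Mat K) :
    conjMat g x = (g : T.Mat K) * x * ((g⁻¹ : (T.Mat K)ˣ) : T.Mat K) :=
  (mul_assoc _ _ _).symm

theorem conjMat_mul (x y : T.Mat K) : conjMat g (x * y) = conjMat g x * conjMat g y := by
  rw [conjMat_apply, conjMat_apply, conjMat_apply]
  simp only [mul_assoc, Units.inv_mul_cancel_left]

theorem conjMat_injective : Function.Injective (conjMat g) := by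
  intro x y h
  rw [conjMat_apply, conjMat_apply] at h
  exact g.isUnit.mul_left_cancel (g⁻¹.isUnit.mul_right_cancel h)

theorem HasDeg.conj (hg : IsGroupElt K T g) {k : ℤ} {x : T.Mat K} (hx : HasDeg k x) :
    HasDeg k (conjMat g x) := by
  rw [conjMat_apply]
  have h := (hg.hasDeg.mul hx).mul hg.hasDeg_inv
  rwa [zero_add, add_zero] at h

theorem conjMat_mem_algebra (hg : IsGroupElt K T g) {x : T.Mat K} (hx : x ∈ T.algebra K) :
    conjMat g x ∈ T.algebra K := by
  rw [conjMat_apply]; exact hg.conj_mem_algebra hx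

theorem conjMat_mem_even (hg : IsGroupElt K T g) {x : T.Mat K} (hx : x ∈ T.even K) :
    conjMat g x ∈ T.even K := by
  rw [conjMat_apply]; exact hg.conj_mem hx

theorem conjMat_mem_gOne (hg : IsGroupElt K T g) {x : T.Mat K} (hx : x ∈ T.gOne K) :
    conjMat g x ∈ T.gOne K :=
  mem_gOne_of_hasDeg (conjMat_mem_algebra hg hx.1.1) ((hasDeg_of_gOne hx).conj hg)

theorem conjMat_mem_gNeg (hg : IsGroupElt K T g) {x : T.Mat K} (hx : x ∈ T.gNeg K) :
    conjMat g x ∈ T.gNeg K :=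
  mem_gNeg_of_hasDeg (conjMat_mem_algebra hg hx.1.1) ((hasDeg_of_gNeg hx).conj hg)

/-- An injective endomorphism of a finite-dimensional space is onto; consequently the conjugated
`f_k` still span `𝔤_{-1}`. -/
theorem map_conjMat_gNeg (hg : IsGroupElt K T g) :
    (T.gNeg K).map (conjMat g) = T.gNeg K := by
  refine Submodule.eq_of_le_of_finrank_eq ?_ ?_
  · rintro _ ⟨x, hx, rfl⟩
    exact conjMat_mem_gNeg hg hx
  · exact (Submodule.equivMapOfInjective _ conjMat_injective _).finrank_eq.symm

end GroupElements

/-! ### Descent from `f_{d-1} ⋯ f_0 v` to `v` -/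

section Chain

variable {K : Type*} [Field K] {M : Type*} [AddCommGroup M] [Module K M]

/-- Operators `e_k` and `f_k` which act like the root vectors of odd roots with the relations of
`OddRootData`, and a highest weight vector `v`: a subspace stable under the `e_k` which contains
`f_{d-1} ⋯ f_0 v` contains `v`, if the weight is typical. -/
theorem mem_of_prod_apply_mem {d : ℕ} (e f : Fin d → Module.End K M) {𝔫 : Set (Module.End K M)}
    {H : Type*} (hop : H → Module.End K M) (r : Fin d → H → K) (t : Fin d → H) (l : H → K)
    (upper : ∀ j k, j < k → e k * f j + f j * e k ∈ 𝔫)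
    (coroot : ∀ k, e k * f k + f k * e k = hop (t k))
    (lower : ∀ x ∈ 𝔫, ∀ k, x * f k - f k * x ∈ Submodule.span K {y | ∃ j, j < k ∧ f j = y})
    (weight : ∀ h k, hop h * f k - f k * hop h = - r k h • f k)
    (anticomm : ∀ j k, f j * f k + f k * f j = 0) (square : ∀ k, f k * f k = 0)
    {v : M} (hn : ∀ x ∈ 𝔫, x v = 0) (hh : ∀ h, hop h v = l h • v) (he : ∀ k, e k v = 0)
    (typical : ∀ k, l (t k) - ∑ j, (if j < k then r j (t k) else 0) ≠ 0)
    {N : Submodule K M} (hN : ∀ k, ∀ m ∈ N, e k m ∈ N)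
    (hv : (List.ofFn f).reverse.prod v ∈ N) : v ∈ N := by
  -- `V k = f_{k-1} ⋯ f_0 v`.
  let V : ℕ → M := fun k => ((List.ofFn f).take k).reverse.prod v
  have hV0 : V 0 = v := by simp [V]
  have hVs : ∀ k : Fin d, V (k + 1) = f k (V k) := fun k => by
    simp [V, List.take_add_one]
  have hfV : ∀ k : ℕ, k ≤ d → ∀ j : Fin d, (j : ℕ) < k → f j (V k) = 0 := by
    intro k
    induction k with
    | zero => intro _ j hj; omega
    | succ k ih =>
      intro hk j hj
      rw [hVs ⟨k, hk⟩]
      by_cases hjk : (j : ℕ) = k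
      · rw [show j = ⟨k, hk⟩ from Fin.ext hjk]
        exact LinearMap.congr_fun (square ⟨k, hk⟩) (V k)
      · have h := LinearMap.congr_fun (anticomm j ⟨k, hk⟩) (V k)
        simp only [LinearMap.add_apply, Module.End.mul_apply, LinearMap.zero_apply] at h
        rwa [ih (by omega) j (by omega), map_zero, add_zero] at h
  -- All `V k` are highest weight vectors for `𝔫_0̄^+`: the commutator of `x` with `f_k` is a
  -- combination of the `f_j` with `j < k`, and these kill `V k` because they already occur in it.
  have hnV : ∀ k : ℕ, k ≤ d → ∀ x ∈ 𝔫, x (V k) = 0 := by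
    intro k
    induction k with
    | zero => intro _ x hx; rw [hV0]; exact hn x hx
    | succ k ih =>
      intro hk x hx
      have h : (x * f ⟨k, hk⟩ - f ⟨k, hk⟩ * x) (V k) ∈ (⊥ : Submodule K M) :=
        apply_mem_of_mem_span (lower x hx ⟨k, hk⟩) (by
          rintro _ ⟨j, hj, rfl⟩
          rw [hfV k (by omega) j hj]; exact zero_mem _)
      rw [Submodule.mem_bot, LinearMap.sub_apply, Module.End.mul_apply, Module.End.mul_apply,
        ih (by omega) x hx, map_zero, sub_zero] at h
      rwa [hVs ⟨k, hk⟩]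
  have hhV : ∀ k : ℕ, k ≤ d → ∀ h,
      hop h (V k) = (l h - ∑ j : Fin d, if (j : ℕ) < k then r j h else 0) • V k := by
    intro k
    induction k with
    | zero => intro _ h; simp [hV0, hh]
    | succ k ih =>
      intro hk h
      have h1 := LinearMap.congr_fun (weight h ⟨k, hk⟩) (V k)
      rw [LinearMap.sub_apply, Module.End.mul_apply, Module.End.mul_apply, ih (by omega) h,
        LinearMap.smul_apply, map_smul, sub_eq_iff_eq_add, ← add_smul] at h1
      rw [hVs ⟨k, hk⟩, h1]
      congr 1
      have h2 : ∀ j : Fin d, (if (j : ℕ) < k + 1 then r j h else 0) =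
          (if (j : ℕ) < k then r j h else 0) + if j = ⟨k, hk⟩ then r j h else 0 := by
        intro j
        simp only [Fin.ext_iff]
        split_ifs <;> first | omega | simp
      simp only [h2, Finset.sum_add_distrib, Finset.sum_ite_eq', Finset.mem_univ, if_true]
      ring
  -- For `j > k`, `e_j f_k V_k = [e_j, f_k] V_k - f_k e_j V_k`, and the bracket lies in `𝔫_0̄^+`.
  have heV : ∀ k : ℕ, k ≤ d → ∀ j : Fin d, k ≤ (j : ℕ) → e j (V k) = 0 := by
    intro k
    induction k with
    | zero => intro _ j _; rw [hV0]; exact he j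
    | succ k ih =>
      intro hk j hj
      have h := hnV k (by omega) _ (upper ⟨k, hk⟩ j hj)
      rw [LinearMap.add_apply, Module.End.mul_apply, Module.End.mul_apply,
        ih (by omega) j (by omega), map_zero, add_zero] at h
      rwa [hVs ⟨k, hk⟩]
  -- `e_k V_{k+1} = e_k f_k V_k = t_{β_k} V_k`, as `e_k V_k = 0`; this is `V_k` times the nonzero
  -- scalar from typicality.
  have hN' : ∀ k : ℕ, k ≤ d → V k ∈ N → V 0 ∈ N := by
    intro k
    induction k with
    | zero => exact fun _ h => h
    | succ k ih =>
      intro hk hm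
      refine ih (by omega) ?_
      have h1 := hN ⟨k, hk⟩ _ hm
      have h2 := LinearMap.congr_fun (coroot ⟨k, hk⟩) (V k)
      rw [LinearMap.add_apply, Module.End.mul_apply, Module.End.mul_apply,
        heV k (by omega) ⟨k, hk⟩ le_rfl, map_zero, add_zero, hhV k (by omega)] at h2
      rw [hVs ⟨k, hk⟩, h2] at h1
      exact (Submodule.smul_mem_iff _ (typical ⟨k, hk⟩)).1 h1
  rw [← hV0]
  refine hN' d le_rfl ?_
  simpa [V, List.take_of_length_le] using hv

/-- A product of odd operators shifts the parity by a constant. -/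
theorem exists_shift {𝓜 : ZMod 2 → Submodule K M} (fs : List (Module.End K M))
    (h : ∀ f ∈ fs, ∀ i, ∀ m ∈ 𝓜 i, f m ∈ 𝓜 (i + 1)) :
    ∃ c : ZMod 2, ∀ i, ∀ m ∈ 𝓜 i, fs.prod m ∈ 𝓜 (i + c) := by
  induction fs with
  | nil => exact ⟨0, fun i m hm => by simpa using hm⟩
  | cons f fs ih =>
    obtain ⟨c, hc⟩ := ih fun g hg => h g (List.mem_cons_of_mem _ hg)
    refine ⟨c + 1, fun i m hm => ?_⟩
    rw [List.prod_cons, Module.End.mul_apply, ← add_assoc]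
    exact h f List.mem_cons_self _ _ (hc i m hm)

/-- Homogeneous components are unique, so the components provided by the homogeneity of `N` are the
given ones. -/
theorem IsHomogeneousSubspace.mem_of_add_mem {𝓜 : ZMod 2 → Submodule K M}
    (h𝓜 : IsCompl (𝓜 0) (𝓜 1)) {N : Submodule K M} (hN : IsHomogeneousSubspace 𝓜 N)
    {i : ZMod 2} {a b : M} (ha : a ∈ 𝓜 i) (hb : b ∈ 𝓜 (i + 1)) (h : a + b ∈ N) :
    a ∈ N ∧ b ∈ N := by
  have key : ∀ x ∈ 𝓜 0, ∀ y ∈ 𝓜 1, x + y ∈ N → x ∈ N ∧ y ∈ N := by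
    intro x hx y hy hxy
    obtain ⟨x', hx', y', hy', h1, h2, h3⟩ := hN _ hxy
    have h4 : x' - x = y - y' := by
      rw [sub_eq_sub_iff_add_eq_add, h3, add_comm]
    have h5 := Submodule.disjoint_def.1 h𝓜.disjoint _ (sub_mem hx' hx)
      (by rw [h4]; exact sub_mem hy hy')
    rw [h5] at h4
    rw [sub_eq_zero.1 h5] at h1
    rw [← sub_eq_zero.1 h4.symm] at h2
    exact ⟨h1, h2⟩
  rcases zmod_two_cases i with rfl | rfl
  · exact key a ha b hb h
  · exact (key b hb a ha (by rwa [add_comm])).symm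

/-- The preimage of a homogeneous subspace under a map which shifts the parity by a constant. -/
theorem IsHomogeneousSubspace.comap {M' : Type*} [AddCommGroup M'] [Module K M']
    {𝓜 : ZMod 2 → Submodule K M} {𝓜' : ZMod 2 → Submodule K M'} (h𝓜 : IsCompl (𝓜 0) (𝓜 1))
    (h𝓜' : IsCompl (𝓜' 0) (𝓜' 1)) {N : Submodule K M} (hN : IsHomogeneousSubspace 𝓜 N)
    (φ : M' →ₗ[K] M) {c : ZMod 2} (hφ : ∀ i, ∀ m ∈ 𝓜' i, φ m ∈ 𝓜 (i + c)) :
    IsHomogeneousSubspace 𝓜' (N.comap φ) := by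
  intro m hm
  obtain ⟨a, ha, b, hb, rfl⟩ := Submodule.mem_sup.1 (h𝓜'.sup_eq_top ▸ Submodule.mem_top (x := m))
  rw [Submodule.mem_comap, map_add] at hm
  have h := hN.mem_of_add_mem h𝓜 (hφ 0 a ha) (b := φ b)
    (by have := hφ 1 b hb; rwa [add_comm 1 c, ← zero_add c] at this) hm
  exact ⟨a, ha, b, hb, h.1, h.2, rfl⟩

end Chain

/-! ### Typical modules: the descent for the conjugated root vectors -/

section Conjugation

variable {K : Type*} [Field K] {T : TypeI} {g : (T.Mat K)ˣ}

/-- Conjugation by a group element, as a linear map on `𝔤`. -/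
def IsGroupElt.conj (hg : IsGroupElt K T g) : T.algebra K →ₗ[K] T.algebra K :=
  (conjMat g).restrict fun _ hx => conjMat_mem_algebra hg hx

theorem IsGroupElt.coe_conj (hg : IsGroupElt K T g) (x : T.algebra K) :
    (hg.conj x : T.Mat K) = conjMat g x := rfl

theorem map_mem_span_image {V W : Type*} [AddCommGroup V] [Module K V] [AddCommGroup W] [Module K W]
    {s : Submodule K V} (B : s →ₗ[K] W) {S : Set s} {y : s}
    (hy : (y : V) ∈ Submodule.span K (Subtype.val '' S)) : B y ∈ Submodule.span K (B '' S) := by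
  rw [← Submodule.coe_subtype, ← Submodule.map_span] at hy
  obtain ⟨z, hz, hzy⟩ := hy
  rw [← Subtype.ext hzy, ← Submodule.map_span]
  exact Submodule.mem_map_of_mem hz

variable (p : ℕ) (χ : Module.Dual K (T.even K))
variable {L : Type*} [AddCommGroup L] [Module K L] [Module (U p χ (T.even K)) L]
  [IsScalarTower K (U p χ (T.even K)) L] [NeZero (2 : K)]

/-- In `ψ(L)`, for typical `L`, one can return from `f_{d-1} ⋯ f_0 v` to `v`. -/
theorem IsTypical.exists_list (h : IsTypical p χ L) :
    ∃ (v : L) (fs : List (Module.End K (Psi p χ L))), v ≠ 0 ∧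
      (∀ f ∈ fs, f ∈ opSpace p χ (Psi p χ L) (gNeg_le K T)) ∧
      (∀ y ∈ opSpace p χ (Psi p χ L) (gNeg_le K T), y ∈ Submodule.span K {f | f ∈ fs}) ∧
      ∀ N : Submodule K (Psi p χ L), (∀ x : T.algebra K, ∀ m ∈ N, U.of p χ (T.algebra K) x • m ∈ N) →
        fs.reverse.prod (Psi.unit p χ v) ∈ N → Psi.unit p χ v ∈ N := by
  obtain ⟨g, hg, -, v, l, hv, hn, hh, htyp⟩ := h
  obtain ⟨d, β, e, f, D⟩ := exists_oddRootData K T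
  -- The action twisted by `Ad(g)`. For it, `v` is a highest weight vector with respect to the
  -- standard `𝔫_0̄^+` and `𝔥`.
  let B : T.algebra K →ₗ[K] Module.End K (Psi p χ L) := act p χ (T.algebra K) (Psi p χ L) ∘ₗ hg.conj
  have hBe : ∀ x y z : T.algebra K, (x : T.Mat K) ∈ T.even K →
      (z : T.Mat K) = (x : T.Mat K) * y - (y : T.Mat K) * x → B x * B y - B y * B x = B z :=
    fun x y z hx hz => act_even p χ _ _ _ (conjMat_mem_even hg hx) (by
      rw [hg.coe_conj, hg.coe_conj, hg.coe_conj, hz, map_sub, conjMat_mul, conjMat_mul])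
  have hBo : ∀ x y z : T.algebra K, (x : T.Mat K) ∈ T.gOne K → (y : T.Mat K) ∈ T.gNeg K →
      (z : T.Mat K) = (x : T.Mat K) * y + (y : T.Mat K) * x → B x * B y + B y * B x = B z :=
    fun x y z hx hy hz => act_odd p χ _ _ _ (conjMat_mem_gOne hg hx).1 (conjMat_mem_gNeg hg hy).1 (by
      rw [hg.coe_conj, hg.coe_conj, hg.coe_conj, hz, map_add, conjMat_mul, conjMat_mul])
  let f' : Fin d → T.algebra K := fun k => ⟨f k, (D.f_mem k).1.1⟩
  let e' : Fin d → T.algebra K := fun k => ⟨e k, (D.e_mem k).1.1⟩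
  let n' : T.nilEven K → T.algebra K := fun x => ⟨x, x.2.1.1⟩
  let h' : T.cartan K → T.algebra K := fun x => ⟨x, x.2.1⟩
  have hf' : ∀ k, B (f' k) ∈ opSpace p χ (Psi p χ L) (gNeg_le K T) := fun k =>
    act_mem_opSpace p χ _ (conjMat_mem_gNeg hg (D.f_mem k))
  have hanti : ∀ j k, B (f' j) * B (f' k) + B (f' k) * B (f' j) = 0 := fun j k =>
    (isGradedAction (M := Psi p χ L) p χ).neg_neg _ (hf' j) _ (hf' k)
  have hmem : ∀ x, x ∈ List.ofFn (fun k => B (f' k)) ↔ ∃ k, B (f' k) = x := by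
    intro x
    rw [List.mem_ofFn']
    rfl
  refine ⟨v, List.ofFn fun k => B (f' k), hv, ?_, ?_, ?_⟩
  · intro x hx
    obtain ⟨k, rfl⟩ := (hmem x).1 hx
    exact hf' k
  · rintro _ ⟨y, rfl⟩
    have hy : (y : T.Mat K) ∈ (T.gNeg K).map (conjMat g) := by
      rw [map_conjMat_gNeg hg]; exact y.2
    obtain ⟨z, hz, hzy⟩ := hy
    have e1 : (act p χ (T.algebra K) (Psi p χ L) ∘ₗ Submodule.inclusion (gNeg_le K T)) y =
        B ⟨z, hz.1.1⟩ := congrArg (act p χ (T.algebra K) (Psi p χ L)) (Subtype.ext hzy.symm)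
    have h1 : z ∈ Submodule.span K (Subtype.val '' Set.range f') := by
      rw [← Set.range_comp]
      exact D.span z hz
    rw [e1]
    refine Submodule.span_mono ?_ (map_mem_span_image B (y := ⟨z, hz.1.1⟩) h1)
    rintro _ ⟨_, ⟨k, rfl⟩, rfl⟩
    exact (hmem _).2 ⟨k, rfl⟩
  · intro N hN
    have hcoe : ∀ (x : T.even K) (hx : (x : T.Mat K) ∈ T.algebra K) (w : L),
        B ⟨x, hx⟩ (Psi.unit p χ w) = Psi.unit p χ (U.of p χ (T.even K) (hg.Ad x) • w) := by
      intro x hx w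
      refine Eq.trans ?_ (Psi.of_even_smul_unit p χ (hg.Ad x) w)
      exact congrArg (fun z => U.of p χ (T.algebra K) z • Psi.unit p χ w)
        (Subtype.ext (conjMat_apply (x : T.Mat K)))
    refine mem_of_prod_apply_mem (fun k => B (e' k)) (fun k => B (f' k))
      (𝔫 := Set.range fun x => B (n' x)) (fun h => B (h' h)) (fun k h => T.root K (β k) h)
      (fun k => T.dualElt K (β k)) l ?_ ?_ ?_ ?_ hanti ?_ ?_ ?_ ?_ ?_ ?_
    · intro j k hjk
      have h1 := bracket_gOne_gNeg_mem (D.e_mem k) (D.f_mem j)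
      exact ⟨⟨_, h1, D.upper j k hjk⟩, (hBo (e' k) (f' j) _ (D.e_mem k) (D.f_mem j) rfl).symm⟩
    · intro k
      exact hBo (e' k) (f' k) _ (D.e_mem k) (D.f_mem k) (D.coroot k).symm
    · rintro _ ⟨x, rfl⟩ k
      have h1 := bracket_gNeg_mem x.2.1 (D.f_mem k)
      rw [hBe (n' x) (f' k) ⟨_, h1.1.1⟩ x.2.1 rfl]
      have h2 := map_mem_span_image B (S := {y | ∃ j, j < k ∧ f' j = y}) (y := ⟨_, h1.1.1⟩) (by
        refine Submodule.span_mono ?_ (D.lower x x.2 k)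
        rintro _ ⟨j, hj, rfl⟩
        exact ⟨f' j, ⟨j, hj, rfl⟩, rfl⟩)
      refine Submodule.span_mono ?_ h2
      rintro _ ⟨_, ⟨j, hj, rfl⟩, rfl⟩
      exact ⟨j, hj, rfl⟩
    · intro h k
      have h1 : - T.root K (β k) h = (h : T.Mat K) (β k).2 (β k).2 - (h : T.Mat K) (β k).1 (β k).1 :=
        neg_sub _ _
      rw [h1, ← map_smul]
      exact hBe (h' h) (f' k) _ (T.cartan_le_even K h.2) (D.weight h h.2 k).symm
    · intro k
      exact mul_self_eq_zero_of_anticomm (hanti k k)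
    · rintro _ ⟨x, rfl⟩
      have h1 := hcoe (Submodule.inclusion (T.nilEven_le_even K) x) x.2.1.1 v
      rw [hn x, map_zero] at h1
      exact h1
    · intro x
      have h1 := hcoe (Submodule.inclusion (T.cartan_le_even K) x) x.2.1 v
      rw [hh x, map_smul] at h1
      exact h1
    · intro k
      exact Psi.of_gOne_smul_unit p χ (⟨_, conjMat_mem_gOne hg (D.e_mem k)⟩ : T.gOne K) v
    · intro k
      -- The formula for `ρ(t_{β_k})` turns `(λ + ρ | β_k)` into the scalar of the descent.
      have h1 := htyp (β k) (D.mem_posOdd k)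
      rw [pairing, LinearMap.add_apply, D.rho k, ← sub_eq_add_neg] at h1
      exact h1
    · exact fun k m hm => hN _ m hm

end Conjugation

/-! ### Irreducibility of `ψ(L)` and proof of part (2) -/

section Irreducible

variable {K : Type*} [Field K] {T : TypeI} {p : ℕ} {χ : Module.Dual K (T.even K)}
variable {L : Type*} [AddCommGroup L] [Module K L] [Module (U p χ (T.even K)) L]
  [IsScalarTower K (U p χ (T.even K)) L] [NeZero (2 : K)] {𝓛 : ZMod 2 → Submodule K L}

/-- The subspace `{l | F (1 ⊗ l) ∈ N}` of `L` is everything or zero, for a product `F` of a spanning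
list of operators from `𝔤_{-1}`. -/
theorem comap_prod_eq_bot_or_top (h : IsIrreducibleSupermodule p χ (T.even K) L 𝓛)
    {fs : List (Module.End K (Psi p χ L))}
    (hfs : ∀ f ∈ fs, f ∈ opSpace p χ (Psi p χ L) (gNeg_le K T))
    (hspan : ∀ y ∈ opSpace p χ (Psi p χ L) (gNeg_le K T), y ∈ Submodule.span K {f | f ∈ fs})
    {N : Submodule K (Psi p χ L)} (hN : IsHomogeneousSubspace (psiGrading p χ 𝓛) N)
    (hs : ∀ x : T.algebra K, ∀ m ∈ N, U.of p χ (T.algebra K) x • m ∈ N) :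
    N.comap (fs.prod ∘ₗ Psi.unit p χ) = ⊥ ∨ N.comap (fs.prod ∘ₗ Psi.unit p χ) = ⊤ := by
  have hsm := isSupermodule_psi p χ h.toIsSupermodule
  have hact := isGradedAction (M := Psi p χ L) p χ
  have hodd : ∀ f ∈ fs, ∀ i, ∀ m ∈ psiGrading p χ 𝓛 i, f m ∈ psiGrading p χ 𝓛 (i + 1) := by
    intro f hf i m hm
    obtain ⟨y, rfl⟩ := hfs f hf
    exact hsm.odd_smul_mem (Submodule.inclusion (gNeg_le K T) y) y.2.1 i m hm
  obtain ⟨c, hc⟩ := exists_shift fs hodd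
  refine h.eq_bot_or_top _ (hN.comap hsm.isCompl h.isCompl _
    fun i m hm => hc i _ (unit_mem_psiGrading p χ hm)) ?_
  intro x l hl
  rw [Submodule.mem_comap, LinearMap.comp_apply] at hl ⊢
  rw [← Psi.of_even_smul_unit, ← act_apply]
  set X := act p χ (T.algebra K) (Psi p χ L) (Submodule.inclusion even_le x) with hX
  -- For `F l ∈ N`, also `F X l = X F l - [X, F] l` is in `N`, because `[X, F]` is a multiple of
  -- `F`.
  have h1 := commutator_prod_mem_span fs
    (fun f hf g hg => hact.neg_neg f (hfs f hf) g (hfs g hg)) X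
    (fun f hf => hspan _ (hact.zero_neg X (act_mem_opSpace p χ even_le x.2) f (hfs f hf)))
  have h2 : (X * fs.prod - fs.prod * X) (Psi.unit p χ l) ∈ N :=
    apply_mem_of_mem_span h1 (by rintro _ rfl; exact hl)
  have h3 : X (fs.prod (Psi.unit p χ l)) ∈ N := hs _ _ hl
  have h4 := sub_mem h3 h2
  rwa [LinearMap.sub_apply, Module.End.mul_apply, Module.End.mul_apply, sub_sub_cancel] at h4

variable [Fact p.Prime] [CharP K p]

/-- The induced module of a typical irreducible module is irreducible. -/
theorem isIrreducibleSupermodule_psi (h : IsIrreducibleSupermodule p χ (T.even K) L 𝓛)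
    (ht : IsTypical p χ L) :
    IsIrreducibleSupermodule p χ (T.algebra K) (Psi p χ L) (psiGrading p χ 𝓛) := by
  obtain ⟨v, fs, hv, hfs, hspan, hback⟩ := ht.exists_list
  have hsm := isSupermodule_psi p χ h.toIsSupermodule
  have hact := isGradedAction (M := Psi p χ L) p χ
  have hv0 : Psi.unit p χ v ≠ 0 := fun hc => hv (Psi.one_tmul_injective p χ v hc)
  have hanti : ∀ f ∈ fs, ∀ g ∈ fs, f * g + g * f = 0 :=
    fun f hf g hg => hact.neg_neg f (hfs f hf) g (hfs g hg)
  -- If `F l ∈ N` for all `l`, then `F v ∈ N`, so `v ∈ N`; irreducibility of `L` gives `L ⊆ N`, and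
  -- `L` generates `ψ(L)`.
  have key : ∀ N : Submodule K (Psi p χ L), IsHomogeneousSubspace (psiGrading p χ 𝓛) N →
      (∀ x : T.algebra K, ∀ m ∈ N, U.of p χ (T.algebra K) x • m ∈ N) →
      (∀ l, fs.reverse.prod (Psi.unit p χ l) ∈ N → l = 0) ∨ N = ⊤ := by
    intro N hN hs
    rcases comap_prod_eq_bot_or_top h (fs := fs.reverse) (fun f hf => hfs f (List.mem_reverse.1 hf))
      (by simpa using hspan) hN hs with h1 | h1
    · left
      intro l hl
      have h2 : l ∈ N.comap (fs.reverse.prod ∘ₗ Psi.unit p χ) := hl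
      rwa [h1, Submodule.mem_bot] at h2
    · right
      have h2 : v ∈ N.comap (fs.reverse.prod ∘ₗ Psi.unit p χ) := h1 ▸ Submodule.mem_top
      have h3 := hback N hs h2
      refine Psi.eq_top_of_stable p χ hs fun l => ?_
      rcases h.eq_bot_or_top (N.comap (Psi.unit p χ)) (hN.comap hsm.isCompl h.isCompl _ (c := 0)
        fun i m hm => by rw [add_zero]; exact unit_mem_psiGrading p χ hm) (fun x l hl => by
          rw [Submodule.mem_comap, ← Psi.of_even_smul_unit]; exact hs _ _ hl) with h4 | h4
      · have h5 : v ∈ N.comap (Psi.unit p χ) := h3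
        rw [h4, Submodule.mem_bot] at h5
        exact absurd h5 hv
      · have h5 : l ∈ N.comap (Psi.unit p χ) := h4 ▸ Submodule.mem_top
        exact h5
  -- The alternative for the zero submodule: `F` is injective on `L`, since `ψ(L) ≠ 0`.
  have hinj : ∀ l, fs.reverse.prod (Psi.unit p χ l) = 0 → l = 0 := by
    rcases key ⊥ (fun m hm => ⟨0, zero_mem _, 0, zero_mem _, zero_mem _, zero_mem _, by
        rw [(Submodule.mem_bot K).1 hm, add_zero]⟩) (fun x m hm => by
        rw [(Submodule.mem_bot K).1 hm, smul_zero]; exact zero_mem _) with h1 | h1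
    · exact fun l hl => h1 l ((Submodule.mem_bot K).2 hl)
    · exact absurd ((Submodule.mem_bot K).1 (h1 ▸ Submodule.mem_top (x := Psi.unit p χ v))) hv0
  -- `L` is stable under `𝔤_0̄` and killed by `𝔤_1`, so its closure under `𝔤_{-1}` is already stable
  -- under `𝔤`.
  have htop : wedgeSpan fs (LinearMap.range (Psi.unit p χ (L := L))) = ⊤ := by
    have hst0 : ∀ x ∈ opSpace p χ (Psi p χ L) even_le, ∀ m ∈ LinearMap.range (Psi.unit p χ (L := L)),
        x m ∈ LinearMap.range (Psi.unit p χ (L := L)) := by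
      rintro _ ⟨x, rfl⟩ _ ⟨l, rfl⟩
      exact ⟨_, (Psi.of_even_smul_unit p χ x l).symm⟩
    have hst1 : ∀ z ∈ opSpace p χ (Psi p χ L) gOne_le,
        ∀ m ∈ LinearMap.range (Psi.unit p χ (L := L)), z m = 0 := by
      rintro _ ⟨x, rfl⟩ _ ⟨l, rfl⟩
      exact Psi.of_gOne_smul_unit p χ x l
    have h1 : opClosure (opSpace p χ (Psi p χ L) (gNeg_le K T))
        (LinearMap.range (Psi.unit p χ (L := L))) = ⊤ :=
      Psi.eq_top_of_stable p χ (fun x m hm => of_smul_mem_of_stable p χ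
        (fun x hx m hm => opClosure_stable_zero hact hst0 hx hm)
        (fun x hx m hm => opClosure_stable_pos hact hst0 hst1 hx hm)
        (fun x hx m hm => opClosure_stable hx hm) x hm) fun l => le_opClosure ⟨l, rfl⟩
    rw [eq_top_iff, ← h1]
    exact opClosure_le (le_wedgeSpan _ _) fun y hy m hm => apply_mem_of_mem_span (hspan y hy)
      fun f hf => apply_mem_wedgeSpan fs hanti _ hf hm
  refine { hsm with nontrivial := ⟨⟨_, 0, hv0⟩⟩, eq_bot_or_eq_top := fun N hN => ?_ }
  by_cases hN0 : N = ⊥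
  · exact Or.inl hN0
  right
  obtain ⟨m, hm, hm0⟩ := N.ne_bot_iff.1 hN0
  have hs : ∀ x : T.algebra K, ∀ m ∈ N.restrictScalars K,
      U.of p χ (T.algebra K) x • m ∈ N.restrictScalars K := fun x m hm => N.smul_mem _ hm
  obtain ⟨_, ⟨l, rfl⟩, hl0, hl⟩ := exists_prod_apply_mem fs hanti
    (LinearMap.range (Psi.unit p χ (L := L)))
    (by rintro _ ⟨l, rfl⟩ hl; rw [hinj l hl, map_zero]) (N.restrictScalars K)
    (fun f hf m hm => by
      obtain ⟨y, rfl⟩ := hfs f hf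
      exact hs (Submodule.inclusion (gNeg_le K T) y) m hm)
    (htop ▸ Submodule.mem_top) hm hm0
  rcases key (N.restrictScalars K) hN hs with h1 | h1
  · exact absurd (by rw [h1 l hl, map_zero]) hl0
  · exact (Submodule.restrictScalars_eq_top_iff K _ _).1 h1

/-- The map `L → ψ(L)^{𝔤_1}`. -/
def Psi.toInvariants (p : ℕ) (χ : Module.Dual K (T.even K)) (L : Type*) [AddCommGroup L] [Module K L]
    [Module (U p χ (T.even K)) L] [IsScalarTower K (U p χ (T.even K)) L] :
    L →ₗ[U p χ (T.even K)] invariants p χ (Psi p χ L) where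
  toFun l := ⟨Psi.unit p χ l, fun y => Psi.of_gOne_smul_unit p χ y l⟩
  map_add' a b := Subtype.ext (map_add _ a b)
  map_smul' u l := by
    rw [RingHom.id_apply]
    induction u using U.induction generalizing l with
    | h0 r =>
      rw [algebraMap_smul, algebraMap_smul]
      exact Subtype.ext (map_smul _ r l)
    | h1 x =>
      refine Subtype.ext ?_
      rw [coe_smul_invariants]
      exact (Psi.of_even_smul_unit p χ x l).symm
    | h2 a b ha hb => rw [mul_smul, mul_smul, ha, hb]
    | h3 a b ha hb =>
      rw [add_smul, add_smul, ← ha, ← hb]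
      exact Subtype.ext (map_add _ _ _)

/-- A typical irreducible `U_χ(𝔤_0̄)`-module is the module of `𝔤_1`-invariants of the module induced
from it. -/
theorem exists_equiv_invariants_psi (h : IsIrreducibleSupermodule p χ (T.even K) L 𝓛)
    (ht : IsTypical p χ L) :
    ∃ e : L ≃ₗ[U p χ (T.even K)] invariants p χ (Psi p χ L), ∀ (i : ZMod 2) (l : L),
      l ∈ 𝓛 i ↔ e l ∈ invariantsGrading p χ (psiGrading p χ 𝓛) i := by
  have hirr := isIrreducibleSupermodule_psi h ht
  have hinv := isIrreducibleSupermodule_invariants p χ hirr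
  have hadd : ∀ l : L, ∃ a ∈ 𝓛 0, ∃ b ∈ 𝓛 1, a + b = l := fun l => by
    simpa using Submodule.mem_sup.1 (h.isCompl.sup_eq_top ▸ Submodule.mem_top (x := l))
  have hgr : ∀ i, ∀ l ∈ 𝓛 i,
      Psi.toInvariants p χ L l ∈ invariantsGrading p χ (psiGrading p χ 𝓛) i :=
    fun i l hl => unit_mem_psiGrading p χ hl
  have hinj : Function.Injective (Psi.toInvariants p χ L) := by
    rw [injective_iff_map_eq_zero]
    exact fun l hl => Psi.one_tmul_injective p χ l (congrArg Subtype.val hl)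
  -- By part (1) the invariants are irreducible, and the image of `L` is a nonzero subsupermodule.
  have hsurj : Function.Surjective (Psi.toInvariants p χ L) := by
    rw [← LinearMap.range_eq_top]
    refine (hinv.eq_bot_or_eq_top _ ?_).resolve_left fun hc => ?_
    · rintro _ ⟨l, rfl⟩
      obtain ⟨a, ha, b, hb, rfl⟩ := hadd l
      exact ⟨_, hgr 0 a ha, _, hgr 1 b hb, ⟨a, rfl⟩, ⟨b, rfl⟩, (map_add _ a b).symm⟩
    · have := h.nontrivial
      obtain ⟨l, hl⟩ := exists_ne (0 : L)
      refine hl (hinj ?_)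
      rw [LinearMap.range_eq_bot.1 hc, LinearMap.zero_apply, LinearMap.zero_apply]
  refine ⟨LinearEquiv.ofBijective _ ⟨hinj, hsurj⟩, fun i l => ⟨hgr i l, fun hl => ?_⟩⟩
  change Psi.toInvariants p χ L l ∈ _ at hl
  -- The component of `l` of the wrong parity is mapped into both parity parts, so its image is
  -- zero, and it is zero by injectivity.
  have hdisj := Submodule.disjoint_def.1 hinv.isCompl.disjoint
  obtain ⟨a, ha, b, hb, rfl⟩ := hadd l
  rw [map_add] at hl
  rcases zmod_two_cases i with rfl | rfl
  · have h1 := hdisj _ ((Submodule.add_mem_iff_right _ (hgr 0 a ha)).1 hl) (hgr 1 b hb)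
    rw [hinj (h1.trans (map_zero _).symm), add_zero]
    exact ha
  · have h1 := hdisj _ (hgr 0 a ha) ((Submodule.add_mem_iff_left _ (hgr 1 b hb)).1 hl)
    rw [hinj (h1.trans (map_zero _).symm), zero_add]
    exact hb

end Irreducible

end TypeI

theorem proposition3p5 {K : Type*} [Field K] [IsAlgClosed K] (p : ℕ) [Fact p.Prime] [CharP K p]
    [NeZero (2 : K)] (T : TypeI) (χ : Module.Dual K (T.even K)) :
    (∀ (M : Type*) [AddCommGroup M] [Module K M] [Module (TypeI.U p χ (T.algebra K)) M]
      [IsScalarTower K (TypeI.U p χ (T.algebra K)) M] (𝓜 : ZMod 2 → Submodule K M),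
      TypeI.IsIrreducibleSupermodule p χ (T.algebra K) M 𝓜 →
      TypeI.IsIrreducibleSupermodule p χ (T.even K) (TypeI.invariants p χ M)
        (TypeI.invariantsGrading p χ 𝓜)) ∧
    (∀ (L : Type*) [AddCommGroup L] [Module K L] [Module (TypeI.U p χ (T.even K)) L]
      [IsScalarTower K (TypeI.U p χ (T.even K)) L] (𝓛 : ZMod 2 → Submodule K L),
      TypeI.IsIrreducibleSupermodule p χ (T.even K) L 𝓛 →
      TypeI.IsTypical p χ L →
      ∃ e : L ≃ₗ[TypeI.U p χ (T.even K)] TypeI.invariants p χ (TypeI.Psi p χ L),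
        ∀ (i : ZMod 2) (l : L), l ∈ 𝓛 i ↔
          e l ∈ TypeI.invariantsGrading p χ (TypeI.psiGrading p χ 𝓛) i) :=
  ⟨fun M _ _ _ _ _ h => TypeI.isIrreducibleSupermodule_invariants p χ h,
    fun L _ _ _ _ _ h ht => TypeI.exists_equiv_invariants_psi h ht⟩
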